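/- Let $(M,g)$ be a connected smooth Lorentzian manifold of dimension $n\ge 3$ with metric of signature $(-,+,\dots,+)$ and Levi-Civita connection $\nabla$, and let $K$ be a smooth vector field on $M$ with $g(K,K)<0$ everywhere. Write $R_{XY}Z=\nabla_X\nabla_YZ-\nabla_Y\nabla_XZ-\nabla_{[X,Y]}Z$. Let $\pi:TM\to M$ be the projection, let $c:TTM\to TM$ be the connector of $\nabla$ (so $c(\alpha'(0))=\frac{\nabla\alpha}{dt}(0)$ for a curve $\alpha$ in $TM$), and let $\hat g(\zeta,\xi)=g(d\pi\,\zeta,d\pi\,\xi)+g(c(\zeta),c(\xi))$ be the Sasaki metric on $TM$. For $u,v\in T_pM$ let $(u)_v\in T_v(T_pM)\subset T_vTM$ be the velocity at $t=0$ of $t\mapsto v+tu$. The null congruence $$C_KM=\{v\in TM : g(v,v)=0,\ g(v,K_{\pi(v)})=-1\}$$ is a $(2n-2)$-dimensional submanifold of $TM$; equip it with the metric induced by $\hat g$ (again written $\hat g$), with Levi-Civita connection $\hat\nabla$. For the semi-Riemannian submersion $\pi|_{C_KM}:C_KM\to M$, let $\mathcal V$ and $\mathcal H$ be the orthogonal projections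 onto the vertical vectors (those tangent to the fibres) and the horizontal vectors (those orthogonal to the fibres), let $\widetilde X$ be the horizontal lift to $C_KM$ of a vector field $X$ on $M$, and let $$A_{E_1}E_2=\mathcal H\hat\nabla_{\mathcal HE_1}\mathcal VE_2+\mathcal V\hat\nabla_{\mathcal HE_1}\mathcal HE_2$$ be the O'Neill tensor. Then for all smooth vector fields $X,Y$ on $M$ and all $v\in C_KM$, with $p=\pi(v)$, the following holds in $T_vTM$: $$2\,\bigl(A_{\widetilde X}\widetilde Y\bigr)_v=-\bigl(R_{X_pY_p}v\bigr)_v-\hat g\bigl((R_{X_pY_p}v)_v,(K_p)_v\bigr)\,(v)_v .$$ That is, $2A_{\widetilde X}\widetilde Y=-(R_{XY})^--\hat g\bigl((R_{XY})^-,\mathbb K\bigr)\mathbb A$ along $C_KM$, where $(R_{XY})^-_v=(R_{X_pY_p}v)_v$, $\mathbb K_v=(K_p)_v$ is the vertical lift of $K$, and $\mathbb A_v=(v)_v$ is the Liouville (position) field. -/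

import Mathlib

open scoped Manifold ContDiff

namespace NullCong

noncomputable section

open Bundle Set Module FiberBundle

section Slices

variable {E : Type*} [NormedAddCommGroup E] [NormedSpace ℝ E]
  {H : Type*} [TopologicalSpace H] (I : ModelWithCorners ℝ E H)
  {N : Type*} [TopologicalSpace N] [ChartedSpace H N]
  (B W : Type*) [NormedAddCommGroup B] [NormedSpace ℝ B]
  [NormedAddCommGroup W] [NormedSpace ℝ W]

/-- A slice chart of `N` for the subset `S`: a diffeomorphism between an open subset of `N` and an
open subset of `B × W` which carries `S` to the slice `B × {0}`. -/
structure SliceChart (S : Set N) where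
  toHomeo : OpenPartialHomeomorph N (B × W)
  smooth_toFun : ContMDiffOn I 𝓘(ℝ, B × W) ∞ toHomeo toHomeo.source
  smooth_invFun : ContMDiffOn 𝓘(ℝ, B × W) I ∞ toHomeo.symm toHomeo.target
  mem_iff : ∀ x ∈ toHomeo.source, x ∈ S ↔ (toHomeo x).2 = 0

variable {I B W} {S : Set N}

open Classical in
/-- The chart of the subset `S`, with values in `B`, which a slice chart induces on `S`. The point
`x₀` only serves as the value of the inverse outside of its domain. -/
def SliceChart.chart (e : SliceChart I B W S) (x₀ : S) : OpenPartialHomeomorph S B where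
  toFun x := (e.toHomeo x).1
  invFun b := if h : (b, (0 : W)) ∈ e.toHomeo.target then
      ⟨e.toHomeo.symm (b, 0), (e.mem_iff _ (e.toHomeo.map_target h)).2 (by
        rw [e.toHomeo.right_inv h])⟩
    else x₀
  source := {x | (x : N) ∈ e.toHomeo.source}
  target := {b | (b, (0 : W)) ∈ e.toHomeo.target}
  map_source' x hx := by
    have h0 : (e.toHomeo x).2 = 0 := (e.mem_iff _ hx).1 x.2
    have := e.toHomeo.map_source hx
    simp only [mem_ofPred_eq]
    rwa [← h0, Prod.mk.eta]
  map_target' b hb := by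
    simp only [mem_ofPred_eq] at hb ⊢
    rw [dif_pos hb]
    exact e.toHomeo.map_target hb
  left_inv' x hx := by
    have h0 : (e.toHomeo x).2 = 0 := (e.mem_iff _ hx).1 x.2
    have h1 : ((e.toHomeo x).1, (0 : W)) = e.toHomeo x := by rw [← h0]
    have h2 := e.toHomeo.map_source hx
    rw [dif_pos (by rw [h1]; exact h2)]
    apply Subtype.ext
    simp only [h1]
    exact e.toHomeo.left_inv hx
  right_inv' b hb := by
    simp only [mem_ofPred_eq] at hb
    rw [dif_pos hb]
    simp only [e.toHomeo.right_inv hb]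
  open_source := e.toHomeo.open_source.preimage continuous_subtype_val
  open_target := e.toHomeo.open_target.preimage (by fun_prop)
  continuousOn_toFun := continuous_fst.comp_continuousOn
    (e.toHomeo.continuousOn.comp continuous_subtype_val.continuousOn fun _ hx => hx)
  continuousOn_invFun := by
    rw [Topology.IsInducing.subtypeVal.continuousOn_iff]
    refine ContinuousOn.congr (f := fun b => e.toHomeo.symm (b, (0 : W))) ?_ ?_
    · exact e.toHomeo.continuousOn_symm.comp (by fun_prop) fun _ hb => hb
    · intro b hb
      simp only [mem_ofPred_eq] at hb
      simp [dif_pos hb]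

variable (I B W S) in
/-- The smooth structure of a subset `S` of `N` which admits slice charts around all of its points:
its atlas consists of the charts induced by all slice charts. -/
@[reducible]
def sliceChartedSpace (h : ∀ x ∈ S, ∃ e : SliceChart I B W S, x ∈ e.toHomeo.source) :
    ChartedSpace B S where
  atlas := {φ | ∃ (e : SliceChart I B W S) (x₀ : S), φ = e.chart x₀}
  chartAt x := (h x.1 x.2).choose.chart x
  mem_chart_source x := (h x.1 x.2).choose_spec
  chart_mem_atlas _ := ⟨_, _, rfl⟩

theorem sliceIsManifold (h : ∀ x ∈ S, ∃ e : SliceChart I B W S, x ∈ e.toHomeo.source) :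
    letI := sliceChartedSpace I B W S h
    IsManifold 𝓘(ℝ, B) ∞ S := by
  let _ := sliceChartedSpace I B W S h
  apply isManifold_of_contDiffOn
  rintro _ _ ⟨e, x₀, rfl⟩ ⟨e', x₀', rfl⟩
  have key : ContMDiffOn 𝓘(ℝ, B) 𝓘(ℝ, B) ∞
      (fun b => (e'.toHomeo (e.toHomeo.symm (b, (0 : W)))).1)
      {b | (b, (0 : W)) ∈ e.toHomeo.target ∧ e.toHomeo.symm (b, (0 : W)) ∈ e'.toHomeo.source} := by
    have h1 : ContMDiffOn 𝓘(ℝ, B) 𝓘(ℝ, B × W) ∞ (fun b : B => (b, (0 : W)))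
        {b | (b, (0 : W)) ∈ e.toHomeo.target ∧
          e.toHomeo.symm (b, (0 : W)) ∈ e'.toHomeo.source} := by
      apply ContDiffOn.contMDiffOn
      fun_prop
    have h2 := e.smooth_invFun.comp h1 (fun b hb => hb.1)
    have h3 := e'.smooth_toFun.comp h2 (fun b hb => hb.2)
    have h4 : ContMDiff 𝓘(ℝ, B × W) 𝓘(ℝ, B) ∞ (Prod.fst : B × W → B) :=
      contDiff_fst.contMDiff
    exact h4.comp_contMDiffOn h3
  rw [contMDiffOn_iff_contDiffOn] at key
  refine (key.congr_mono ?_ ?_)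
  · rintro b ⟨hb, -⟩
    have hb' : b ∈ ((e.chart x₀).symm ≫ₕ e'.chart x₀').source := hb
    have hb1 : (b, (0 : W)) ∈ e.toHomeo.target := hb'.1
    simp [SliceChart.chart, dif_pos hb1]
  · rintro b ⟨hb, -⟩
    have hb' : b ∈ ((e.chart x₀).symm ≫ₕ e'.chart x₀').source := hb
    have hb1 : (b, (0 : W)) ∈ e.toHomeo.target := hb'.1
    refine ⟨hb1, ?_⟩
    have hb2 := hb'.2
    simpa [SliceChart.chart, dif_pos hb1] using hb2

/-- Regular value theorem: the zero set of a smooth map with values in `W` admits slice charts around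
each of its regular points. -/
theorem exists_sliceChart [FiniteDimensional ℝ E] [FiniteDimensional ℝ B] [FiniteDimensional ℝ W]
    [I.Boundaryless] [IsManifold I ∞ N]
    (hdim : finrank ℝ B + finrank ℝ W = finrank ℝ E)
    {f : N → W} (hf : ContMDiff I 𝓘(ℝ, W) ∞ f) (x : N)
    (hx : Function.Surjective (mfderiv I 𝓘(ℝ, W) f x)) :
    ∃ e : SliceChart I B W {y | f y = 0}, x ∈ e.toHomeo.source := by
  set φ := extChartAt I x with hφ
  have hT : IsOpen φ.target := isOpen_extChartAt_target x
  have hsymm : ContMDiffOn 𝓘(ℝ, E) I ∞ φ.symm φ.target := contMDiffOn_extChartAt_symm x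
  have hψ : ContDiffOn ℝ ∞ (f ∘ φ.symm) φ.target := by
    rw [← contMDiffOn_iff_contDiffOn]
    exact hf.comp_contMDiffOn hsymm
  set y₀ := φ x with hy₀
  have hy₀T : y₀ ∈ φ.target := mem_extChartAt_target x
  set D : E →L[ℝ] W := fderiv ℝ (f ∘ φ.symm) y₀ with hD
  have hDs : Function.Surjective D := by
    have hmd : MDifferentiableAt I 𝓘(ℝ, W) f x := (hf x).mdifferentiableAt (by simp)
    have : mfderiv I 𝓘(ℝ, W) f x = D := by
      rw [hmd.mfderiv, hD]
      rw [I.range_eq_univ, fderivWithin_univ]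
      rfl
    rw [← this]
    exact hx
  -- a complementary linear map
  have hker : finrank ℝ (LinearMap.ker (D : E →ₗ[ℝ] W)) = finrank ℝ B := by
    have h1 := LinearMap.finrank_range_add_finrank_ker (D : E →ₗ[ℝ] W)
    have h2 : LinearMap.range (D : E →ₗ[ℝ] W) = ⊤ := LinearMap.range_eq_top.2 hDs
    rw [h2, finrank_top] at h1
    omega
  obtain ⟨P, hP⟩ := (LinearMap.ker (D : E →ₗ[ℝ] W)).subtype.exists_leftInverse_of_injective
    (Submodule.ker_subtype _)
  let L := LinearEquiv.ofFinrankEq _ _ hker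
  let A : E →L[ℝ] B := LinearMap.toContinuousLinearMap (L.toLinearMap ∘ₗ P)
  have hinj : Function.Injective ((A.prod D : E →L[ℝ] B × W) : E →ₗ[ℝ] B × W) := by
    rw [← LinearMap.ker_eq_bot, LinearMap.ker_eq_bot']
    intro z hz
    have hz1 : A z = 0 := congrArg Prod.fst hz
    have hz2 : D z = 0 := congrArg Prod.snd hz
    have hz3 : P z = 0 := by
      have : L (P z) = 0 := hz1
      simpa using this
    have hz4 : P ((LinearMap.ker (D : E →ₗ[ℝ] W)).subtype ⟨z, hz2⟩) = ⟨z, hz2⟩ :=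
      LinearMap.congr_fun hP _
    have hz5 : (⟨z, hz2⟩ : LinearMap.ker (D : E →ₗ[ℝ] W)) = 0 := by
      rw [← hz4]; exact hz3
    exact congrArg Subtype.val hz5
  let Λ : E ≃L[ℝ] B × W := (LinearMap.linearEquivOfInjective _ hinj (by
    rw [Module.finrank_prod, hdim])).toContinuousLinearEquiv
  have hΛ : (Λ : E →L[ℝ] B × W) = A.prod D := by
    ext z <;> rfl
  let G : E → B × W := fun y => (A y, (f ∘ φ.symm) y)
  have hG : ContDiffOn ℝ ∞ G φ.target := by
    apply ContDiffOn.prodMk _ hψ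
    exact A.contDiff.contDiffOn
  have hGat : ∀ y ∈ φ.target, ContDiffAt ℝ ∞ G y := fun y hy =>
    hG.contDiffAt (hT.mem_nhds hy)
  have hG0 : HasFDerivAt G (Λ : E →L[ℝ] B × W) y₀ := by
    rw [hΛ]
    apply HasFDerivAt.prodMk A.hasFDerivAt
    exact ((hψ.contDiffAt (hT.mem_nhds hy₀T)).differentiableAt (by simp)).hasFDerivAt
  let θ := (hGat y₀ hy₀T).toOpenPartialHomeomorph G hG0 (by simp)
  let U : Set E := φ.target ∩ fderiv ℝ G ⁻¹' range ((↑) : (E ≃L[ℝ] B × W) → E →L[ℝ] B × W)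
  have hU : IsOpen U := by
    apply ContinuousOn.isOpen_inter_preimage _ hT ContinuousLinearEquiv.isOpen
    exact hG.continuousOn_fderiv_of_isOpen hT (by simp)
  have hy₀U : y₀ ∈ U := ⟨hy₀T, ⟨Λ, hG0.fderiv.symm⟩⟩
  let θ' := θ.restrOpen U hU
  have hθ'U : θ'.source ⊆ U := fun y hy => hy.2
  have hθ'c : ∀ y, θ' y = G y := fun y => rfl
  have hθ's : ContDiffOn ℝ ∞ θ'.symm θ'.target := by
    intro b hb
    have hbU := hθ'U (θ'.map_target hb)
    obtain ⟨Λ', hΛ'⟩ := hbU.2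
    apply ContDiffAt.contDiffWithinAt
    apply θ'.contDiffAt_symm (f₀' := Λ') hb
    · rw [hΛ']
      exact ((hGat _ hbU.1).differentiableAt (by simp)).hasFDerivAt
    · exact hGat _ hbU.1
  let Φ : OpenPartialHomeomorph N E :=
    { φ with
      open_source := isOpen_extChartAt_source x
      open_target := hT
      continuousOn_toFun := continuousOn_extChartAt x
      continuousOn_invFun := continuousOn_extChartAt_symm x }
  have hΦ : ContMDiffOn I 𝓘(ℝ, E) ∞ Φ Φ.source := by
    have := contMDiffOn_extChartAt (I := I) (n := ∞) (x := x)
    rwa [← extChartAt_source I] at this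
  refine ⟨⟨Φ.trans θ', ?_, ?_, ?_⟩, ?_⟩
  · have h1 : ContMDiffOn 𝓘(ℝ, E) 𝓘(ℝ, B × W) ∞ θ' U :=
      (hG.mono inter_subset_left).contMDiffOn
    exact h1.comp (hΦ.mono fun y hy => hy.1) fun y hy => hθ'U hy.2
  · exact hsymm.comp (hθ's.contMDiffOn.mono fun b hb => hb.1) fun b hb => hb.2
  · intro y hy
    have hy1 : y ∈ φ.source := hy.1
    have : ((Φ.trans θ') y).2 = f (φ.symm (φ y)) := rfl
    rw [this, φ.left_inv hy1]
    rfl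
  · refine ⟨mem_extChartAt_source x, ?_, hy₀U⟩
    exact ContDiffAt.mem_toOpenPartialHomeomorph_source _ hG0 (by simp)

end Slices

section General

variable {E : Type*} [NormedAddCommGroup E] [NormedSpace ℝ E]
  {H : Type*} [TopologicalSpace H] {I : ModelWithCorners ℝ E H}
  {N : Type*} [TopologicalSpace N] [ChartedSpace H N] [IsManifold I ∞ N]
  {E' : Type*} [NormedAddCommGroup E'] [NormedSpace ℝ E']
  {H' : Type*} [TopologicalSpace H'] (J : ModelWithCorners ℝ E' H')
  {M : Type*} [TopologicalSpace M] [ChartedSpace H' M]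

/-- The right-hand side of the Koszul formula for `2 g(∇_X Y, Z)` at `x`. -/
def koszul (g : ∀ x : N, TangentSpace I x → TangentSpace I x → ℝ)
    (X Y Z : ∀ x : N, TangentSpace I x) (x : N) : ℝ :=
  mvfderiv I (fun y => g y (Y y) (Z y)) x (X x)
    + mvfderiv I (fun y => g y (Z y) (X y)) x (Y x)
    - mvfderiv I (fun y => g y (X y) (Y y)) x (Z x)
    + g x (VectorField.mlieBracket I X Y x) (Z x)
    - g x (VectorField.mlieBracket I Y Z x) (X x)
    + g x (VectorField.mlieBracket I Z X x) (Y x)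

/-- The Levi-Civita connection of a pseudo-Riemannian metric `g`: `leviCivita g X Y x` is the value
at `x` of `∇_X Y`, that is, the unique tangent vector satisfying the Koszul formula. -/
def leviCivita (g : ∀ x : N, TangentSpace I x → TangentSpace I x → ℝ)
    (X Y : ∀ x : N, TangentSpace I x) (x : N) : TangentSpace I x :=
  Classical.epsilon fun w : TangentSpace I x => ∀ Z : ∀ x : N, TangentSpace I x,
    MDifferentiableAt I I.tangent (fun y => (⟨y, Z y⟩ : TangentBundle I N)) x →
      2 * g x w (Z x) = koszul g X Y Z x

/-- The vector field `R(X, Y) Z = ∇_X ∇_Y Z - ∇_Y ∇_X Z - ∇_[X, Y] Z`. -/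
def curvatureField (g : ∀ x : N, TangentSpace I x → TangentSpace I x → ℝ)
    (X Y Z : ∀ x : N, TangentSpace I x) (x : N) : TangentSpace I x :=
  leviCivita g X (leviCivita g Y Z) x - leviCivita g Y (leviCivita g X Z) x
    - leviCivita g (VectorField.mlieBracket I X Y) Z x

/-- The curvature tensor `R_{x y} z` at a point, computed with extensions of the three tangent
vectors to vector fields which are smooth near that point. -/
def curvature (g : ∀ x : N, TangentSpace I x → TangentSpace I x → ℝ) (p : N)
    (x y z : TangentSpace I p) : TangentSpace I p :=
  curvatureField g (extend E x) (extend E y) (extend E z) p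

/-! Submersions `q : (N, g) → M`. -/

variable (g : ∀ x : N, TangentSpace I x → TangentSpace I x → ℝ) (q : N → M)

/-- `ξ` is vertical: it is tangent to the fibre of the submersion `q`. -/
def IsVertical (x : N) (ξ : TangentSpace I x) : Prop := mfderiv I J q x ξ = 0

/-- `ξ` is horizontal: it is orthogonal to the vertical vectors. -/
def IsHorizontal (x : N) (ξ : TangentSpace I x) : Prop :=
  ∀ η : TangentSpace I x, IsVertical J q x η → g x ξ η = 0

/-- The orthogonal projection onto the vertical vectors. -/
def verticalPart (x : N) (ξ : TangentSpace I x) : TangentSpace I x :=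
  Classical.epsilon fun η : TangentSpace I x =>
    IsVertical J q x η ∧ IsHorizontal J g q x (ξ - η)

/-- The orthogonal projection onto the horizontal vectors. -/
def horizontalPart (x : N) (ξ : TangentSpace I x) : TangentSpace I x :=
  ξ - verticalPart J g q x ξ

/-- The horizontal lift of a vector field `X` on `M`: the horizontal vector field which is
`q`-related to `X`. -/
def horizontalLift (X : ∀ p : M, TangentSpace J p) (x : N) : TangentSpace I x :=
  Classical.epsilon fun ξ : TangentSpace I x =>
    IsHorizontal J g q x ξ ∧ mfderiv I J q x ξ = X (q x)

/-- The O'Neill tensor `A_{F₁} F₂ = H ∇_{H F₁} (V F₂) + V ∇_{H F₁} (H F₂)` of `q`, where `∇` is the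
Levi-Civita connection of `g` and `H`, `V` are the horizontal and vertical projections. -/
def oneillA (F₁ F₂ : ∀ x : N, TangentSpace I x) (x : N) : TangentSpace I x :=
  horizontalPart J g q x
      (leviCivita g (fun y => horizontalPart J g q y (F₁ y))
        (fun y => verticalPart J g q y (F₂ y)) x)
    + verticalPart J g q x
      (leviCivita g (fun y => horizontalPart J g q y (F₁ y))
        (fun y => horizontalPart J g q y (F₂ y)) x)

end General

section NullCongruence

variable {n : ℕ} {M : Type*} [TopologicalSpace M] [ChartedSpace (EuclideanSpace ℝ (Fin n)) M]
  [IsManifold (𝓡 n) ∞ M]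

variable (n M) in
/-- A Lorentzian metric on the `n`-dimensional manifold `M`, of signature `(-, +, …, +)`. -/
structure LorentzMetric where
  /-- the scalar product on each tangent space -/
  val (p : M) : TangentSpace (𝓡 n) p →L[ℝ] TangentSpace (𝓡 n) p →L[ℝ] ℝ
  symm (p : M) (u w : TangentSpace (𝓡 n) p) : val p u w = val p w u
  signature (p : M) : ∃ b : Basis (Fin n) ℝ (TangentSpace (𝓡 n) p), ∀ i j,
    val p (b i) (b j) = if i = j then (if (i : ℕ) = 0 then -1 else 1) else 0
  smooth : ContMDiff (𝓡 n)
    ((𝓡 n).prod 𝓘(ℝ, EuclideanSpace ℝ (Fin n) →L[ℝ] EuclideanSpace ℝ (Fin n) →L[ℝ] ℝ)) ∞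
    (fun p => TotalSpace.mk' (EuclideanSpace ℝ (Fin n) →L[ℝ] EuclideanSpace ℝ (Fin n) →L[ℝ] ℝ)
      p (val p))

/-- Smoothness of a vector field on `M`. -/
def IsSmoothField (X : ∀ p : M, TangentSpace (𝓡 n) p) : Prop :=
  ContMDiff (𝓡 n) (𝓡 n).tangent ∞ (fun p => (⟨p, X p⟩ : TangentBundle (𝓡 n) M))

/-- A (smooth) timelike vector field on the Lorentzian manifold `(M, g)`. -/
structure TimelikeField (g : LorentzMetric n M) where
  /-- the vector field -/
  val (p : M) : TangentSpace (𝓡 n) p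
  timelike (p : M) : g.val p (val p) (val p) < 0
  smooth : IsSmoothField val

/-- The metric as a family of functions of two tangent vectors. -/
def LorentzMetric.form (g : LorentzMetric n M) (p : M) (u w : TangentSpace (𝓡 n) p) : ℝ :=
  g.val p u w

/-- The null congruence `C_K M = {v ∈ TM | g(v, v) = 0 and g(v, K) = -1}`. -/
def nullCongruence (g : LorentzMetric n M) (K : TimelikeField g) : Set (TangentBundle (𝓡 n) M) :=
  {v | g.val v.proj v.2 v.2 = 0 ∧ g.val v.proj v.2 (K.val v.proj) = -1}

/-- The vector `(u)_v` tangent to `TM` at `v`, for `v` and `u` in the same tangent space: the velocity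
of the curve `t ↦ v + t u`. -/
def vlift (v : TangentBundle (𝓡 n) M) (u : TangentSpace (𝓡 n) v.proj) :
    TangentSpace (𝓡 n).tangent v :=
  mfderiv 𝓘(ℝ, ℝ) (𝓡 n).tangent
    (fun t : ℝ => (⟨v.proj, v.2 + t • u⟩ : TangentBundle (𝓡 n) M)) 0 (1 : ℝ)

/-- The connector `c : TTM → TM` of the Levi-Civita connection. In the trivialization of `TM` given by
a chart at `p = π(v)`, it sends the velocity of a curve `(x(t), α(t))` in `TM` to
`α' + Γ(x', α)`; here the Christoffel term `Γ(x', α)` is the covariant derivative in the direction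
`x'` of the vector field `extend α` which is constant in this trivialization. -/
def connector (g : LorentzMetric n M) (v : TangentBundle (𝓡 n) M)
    (ξ : TangentSpace (𝓡 n).tangent v) : TangentSpace (𝓡 n) v.proj :=
  (trivializationAt (EuclideanSpace ℝ (Fin n)) (TangentSpace (𝓡 n)) v.proj).symm v.proj
      (mvfderiv (𝓡 n).tangent
        (fun w : TangentBundle (𝓡 n) M =>
          (trivializationAt (EuclideanSpace ℝ (Fin n)) (TangentSpace (𝓡 n)) v.proj w).2) v ξ)
    + leviCivita g.form
        (extend (EuclideanSpace ℝ (Fin n)) (mfderiv (𝓡 n).tangent (𝓡 n) TotalSpace.proj v ξ))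
        (extend (EuclideanSpace ℝ (Fin n)) v.2) v.proj

/-- The Sasaki metric `ĝ(ζ, ξ) = g(dπ ζ, dπ ξ) + g(c(ζ), c(ξ))` on `TM`. -/
def sasaki (g : LorentzMetric n M) (v : TangentBundle (𝓡 n) M)
    (ζ ξ : TangentSpace (𝓡 n).tangent v) : ℝ :=
  g.val v.proj (mfderiv (𝓡 n).tangent (𝓡 n) TotalSpace.proj v ζ)
      (mfderiv (𝓡 n).tangent (𝓡 n) TotalSpace.proj v ξ)
    + g.val v.proj (connector g v ζ) (connector g v ξ)

/-! The submanifold structure of the null congruence. -/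

/-- The map whose zero set is the null congruence. -/
def nullMap (g : LorentzMetric n M) (K : TimelikeField g) (v : TangentBundle (𝓡 n) M) : ℝ × ℝ :=
  (g.val v.proj v.2 v.2, g.val v.proj v.2 (K.val v.proj) + 1)

theorem nullCongruence_eq (g : LorentzMetric n M) (K : TimelikeField g) :
    nullCongruence g K = {v | nullMap g K v = 0} := by
  ext v
  simp only [nullCongruence, nullMap, mem_ofPred_eq, Prod.mk_eq_zero]
  exact and_congr_right fun _ => ⟨fun h => by rw [h]; norm_num, fun h => by linarith⟩

theorem smooth_metric_apply (g : LorentzMetric n M)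
    (X : ∀ v : TangentBundle (𝓡 n) M, TangentSpace (𝓡 n) v.proj)
    (hX : ContMDiff (𝓡 n).tangent (𝓡 n).tangent ∞
      (fun v => (⟨v.proj, X v⟩ : TangentBundle (𝓡 n) M))) :
    ContMDiff (𝓡 n).tangent 𝓘(ℝ, ℝ) ∞
      (fun v : TangentBundle (𝓡 n) M => g.val v.proj v.2 (X v)) := by
  have hπ : ContMDiff (𝓡 n).tangent (𝓡 n) ∞ (fun v : TangentBundle (𝓡 n) M => v.proj) :=
    contMDiff_proj _
  intro v
  have : ContMDiffAt (𝓡 n).tangent ((𝓡 n).prod 𝓘(ℝ)) ∞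
      (fun m : TangentBundle (𝓡 n) M =>
        TotalSpace.mk' ℝ (E := Bundle.Trivial M ℝ) m.proj (g.val m.proj m.2 (X m))) v := by
    apply ContMDiffAt.clm_bundle_apply₂ (F₁ := EuclideanSpace ℝ (Fin n))
      (F₂ := EuclideanSpace ℝ (Fin n))
    · exact (g.smooth.comp hπ) v
    · exact contMDiffAt_id
    · exact hX v
  simp only [contMDiffAt_totalSpace] at this
  exact this.2

theorem smooth_nullMap (g : LorentzMetric n M) (K : TimelikeField g) :
    ContMDiff (𝓡 n).tangent 𝓘(ℝ, ℝ × ℝ) ∞ (nullMap g K) := by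
  have hπ : ContMDiff (𝓡 n).tangent (𝓡 n) ∞ (fun v : TangentBundle (𝓡 n) M => v.proj) :=
    contMDiff_proj _
  refine ContMDiff.prodMk_space (smooth_metric_apply g _ contMDiff_id) ?_
  exact (smooth_metric_apply g (fun v => K.val v.proj) (K.smooth.comp hπ)).add contMDiff_const

theorem nullMap_regular (g : LorentzMetric n M) (K : TimelikeField g) (v : TangentBundle (𝓡 n) M)
    (hv : v ∈ nullCongruence g K) :
    Function.Surjective (mfderiv (𝓡 n).tangent 𝓘(ℝ, ℝ × ℝ) (nullMap g K) v) := by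
  set L := mfderiv (𝓡 n).tangent 𝓘(ℝ, ℝ × ℝ) (nullMap g K) v with hL
  have hline : ∀ u : TangentSpace (𝓡 n) v.proj,
      ∃ ξ, L ξ = ((2 * g.val v.proj v.2 u, g.val v.proj u (K.val v.proj)) : ℝ × ℝ) := by
    intro u
    let γ : ℝ → TangentBundle (𝓡 n) M := fun t => ⟨v.proj, v.2 + t • u⟩
    have hγ0 : γ 0 = v := by
      simp only [γ, zero_smul, add_zero]
    have hγ : MDifferentiableAt 𝓘(ℝ, ℝ) (𝓡 n).tangent γ 0 := by
      have : ContMDiffAt 𝓘(ℝ, ℝ) (𝓡 n).tangent ∞ γ 0 := by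
        rw [contMDiffAt_totalSpace]
        refine ⟨contMDiffAt_const, ?_⟩
        let e := trivializationAt (EuclideanSpace ℝ (Fin n)) (TangentSpace (𝓡 n)) v.proj
        have he : ∀ t, (e (γ t)).2 =
            e.linearMapAt ℝ v.proj v.2 + t • e.linearMapAt ℝ v.proj u := by
          intro t
          have hmem : v.proj ∈ e.baseSet := mem_baseSet_trivializationAt' v.proj
          rw [← map_smul, ← map_add]
          rw [e.coe_linearMapAt_of_mem hmem]
        have h2 : ContMDiffAt 𝓘(ℝ, ℝ) 𝓘(ℝ, EuclideanSpace ℝ (Fin n)) ∞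
            (fun t : ℝ => e.linearMapAt ℝ v.proj v.2 + t • e.linearMapAt ℝ v.proj u) 0 := by
          apply ContDiffAt.contMDiffAt
          fun_prop
        exact h2.congr_of_eventuallyEq (Filter.Eventually.of_forall he)
      exact this.mdifferentiableAt (by simp)
    have hf : MDifferentiableAt (𝓡 n).tangent 𝓘(ℝ, ℝ × ℝ) (nullMap g K) (γ 0) :=
      (smooth_nullMap g K (γ 0)).mdifferentiableAt (by simp)
    have hcomp := mfderiv_comp (0 : ℝ) hf hγ
    have hder : HasDerivAt (nullMap g K ∘ γ)
        ((2 * g.val v.proj v.2 u, g.val v.proj u (K.val v.proj)) : ℝ × ℝ) 0 := by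
      have h1 : nullMap g K ∘ γ = fun t : ℝ =>
          (g.val v.proj v.2 v.2 + t * (2 * g.val v.proj v.2 u) + t ^ 2 * g.val v.proj u u,
            g.val v.proj v.2 (K.val v.proj) + t * g.val v.proj u (K.val v.proj) + 1) := by
        funext t
        simp only [nullMap, γ, Function.comp_apply, map_add, map_smul, add_apply, smul_apply,
          smul_eq_mul, Prod.mk.injEq]
        rw [g.symm v.proj u v.2]
        exact ⟨by ring, trivial⟩
      rw [h1]
      apply HasDerivAt.prodMk
      · have := (((hasDerivAt_id (0 : ℝ)).mul_const (2 * g.val v.proj v.2 u)).const_add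
          (g.val v.proj v.2 v.2)).add ((hasDerivAt_pow 2 (0 : ℝ)).mul_const (g.val v.proj u u))
        convert! this using 1
        simp
      · have := (((hasDerivAt_id (0 : ℝ)).mul_const (g.val v.proj u (K.val v.proj))).const_add
          (g.val v.proj v.2 (K.val v.proj))).add_const 1
        simpa using this
    have hval : mfderiv 𝓘(ℝ, ℝ) 𝓘(ℝ, ℝ × ℝ) (nullMap g K ∘ γ) 0 (1 : ℝ) =
        ((2 * g.val v.proj v.2 u, g.val v.proj u (K.val v.proj)) : ℝ × ℝ) := by
      rw [mfderiv_eq_fderiv, hder.hasFDerivAt.fderiv]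
      exact ContinuousLinearMap.toSpanSingleton_apply_one (R₁ := ℝ) (M₁ := ℝ × ℝ) _
    have hL' : mfderiv (𝓡 n).tangent 𝓘(ℝ, ℝ × ℝ) (nullMap g K) (γ 0) = L := by
      rw [hL, hγ0]
    refine ⟨mfderiv 𝓘(ℝ, ℝ) (𝓡 n).tangent γ 0 (1 : ℝ), ?_⟩
    rw [← hval, hcomp, ← hL']
    rfl
  obtain ⟨ξ₁, h₁⟩ := hline v.2
  obtain ⟨ξ₂, h₂⟩ := hline (K.val v.proj)
  obtain ⟨hv1, hv2⟩ := hv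
  rw [hv1, hv2] at h₁
  rw [hv2] at h₂
  rintro ⟨a, b⟩
  let k := g.val v.proj (K.val v.proj) (K.val v.proj)
  refine ⟨(-a / 2) • ξ₂ + (-b - a / 2 * k) • ξ₁, ?_⟩
  rw [map_add, map_smul, map_smul, h₁, h₂]
  change ((-a / 2) * (2 * -1) + (-b - a / 2 * k) * (2 * 0),
    (-a / 2) * k + (-b - a / 2 * k) * -1) = (a, b)
  refine Prod.ext ?_ ?_
  · change -a / 2 * (2 * -1) + (-b - a / 2 * k) * (2 * 0) = a
    ring
  · change -a / 2 * k + (-b - a / 2 * k) * -1 = b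
    ring

theorem nullCongruence_slices (g : LorentzMetric n M) (K : TimelikeField g) :
    ∀ v ∈ nullCongruence g K,
      ∃ e : SliceChart (𝓡 n).tangent (EuclideanSpace ℝ (Fin (2 * n - 2))) (ℝ × ℝ)
        (nullCongruence g K), v ∈ e.toHomeo.source := by
  intro v hv
  have hs := nullMap_regular g K v hv
  have hdim : finrank ℝ (EuclideanSpace ℝ (Fin (2 * n - 2))) + finrank ℝ (ℝ × ℝ) =
      finrank ℝ (EuclideanSpace ℝ (Fin n) × EuclideanSpace ℝ (Fin n)) := by
    let L : EuclideanSpace ℝ (Fin n) × EuclideanSpace ℝ (Fin n) →ₗ[ℝ] ℝ × ℝ :=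
      (mfderiv (𝓡 n).tangent 𝓘(ℝ, ℝ × ℝ) (nullMap g K) v).toLinearMap
    have h := LinearMap.finrank_le_finrank_of_surjective (f := L) hs
    simp only [finrank_prod, finrank_self, finrank_euclideanSpace, Fintype.card_fin] at h ⊢
    omega
  rw [nullCongruence_eq]
  exact exists_sliceChart hdim (smooth_nullMap g K) v hs

/-- The null congruence as a `(2n-2)`-dimensional submanifold of `TM`. -/
instance nullCongruenceChartedSpace (g : LorentzMetric n M) (K : TimelikeField g) :
    ChartedSpace (EuclideanSpace ℝ (Fin (2 * n - 2))) (nullCongruence g K) :=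
  sliceChartedSpace (𝓡 n).tangent (EuclideanSpace ℝ (Fin (2 * n - 2))) (ℝ × ℝ)
    (nullCongruence g K) (nullCongruence_slices g K)

instance nullCongruenceIsManifold (g : LorentzMetric n M) (K : TimelikeField g) :
    IsManifold (𝓡 (2 * n - 2)) ∞ (nullCongruence g K) :=
  sliceIsManifold (nullCongruence_slices g K)

/-- The differential of the inclusion `C_K M → TM`. -/
def inclDeriv (g : LorentzMetric n M) (K : TimelikeField g) (v : nullCongruence g K)
    (ξ : TangentSpace (𝓡 (2 * n - 2)) v) : TangentSpace (𝓡 n).tangent (v : TangentBundle (𝓡 n) M) :=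
  mfderiv (𝓡 (2 * n - 2)) (𝓡 n).tangent (Subtype.val : nullCongruence g K → _) v ξ

/-- The metric on `C_K M` induced by the Sasaki metric. -/
def inducedMetric (g : LorentzMetric n M) (K : TimelikeField g) (v : nullCongruence g K)
    (ζ ξ : TangentSpace (𝓡 (2 * n - 2)) v) : ℝ :=
  sasaki g v (inclDeriv g K v ζ) (inclDeriv g K v ξ)

/-- The restriction to `C_K M` of the projection `TM → M`. -/
def nullProj (g : LorentzMetric n M) (K : TimelikeField g) (v : nullCongruence g K) : M :=
  (v : TangentBundle (𝓡 n) M).proj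

end NullCongruence

end

end NullCong

open NullCong

/-! Put a = v and k = K_p, and split a vector ξ tangent to TM into its base part p = dπ ξ and its
fibre part b = c(ξ), so that ĝ is g on base parts plus g on fibre parts. Differentiating g(v, v) = 0
and g(v, K) = -1 with the metric connection gives g(a, b) = 0 and g(b, k) + g(a, ∇_p K) = 0 for
vectors tangent to the congruence; a dimension count shows that these equations cut out the tangent
space (`exists_parts`). Vertical vectors have p = 0, so their fibre parts fill the orthogonal
complement of a and k. As a and k span a nondegenerate plane, the horizontal vectors are those with
b = g(a, ∇_p K) a (`isHorizontal_iff`).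

Since a is null, ĝ(X̃, Ỹ) equals g(X, Y) at the base point and is constant along the fibres. The
Koszul formula against a vertical field therefore reduces to 2 V∇_X̃ Ỹ = V[X̃, Ỹ]
(`two_mul_leviCivita_horizontalLift`). In coordinates X̃ is the usual horizontal lift for ∇ plus a
multiple of the position field, and the bracket of two such lifts has fibre part t a - R, where R =
R_{XY}v and t is a real number (`exists_vertComp_bracket`). The value of t does not matter: the
vertical projection only changes the multiple of a, and orthogonality to k together with g(a, k) =
-1 fixes the result as -R - g(R, k) a. Finally g(R, k) is the Sasaki product of the vertical lifts
of R and K.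

The calculus is done in vector spaces. The map `nullChart` sends the congruence into E × E; it is an
immersion rather than a chart, and the induced metric is the pullback of `sasakiForm` under it. For
a pullback metric, brackets and the Koszul expression involve only derivatives of vector-valued
functions (`mvfderiv_mlieBracket`, `koszul_eq_of_pullback`), so the slice charts enter only through
the dimension and the fact that the inclusion is a smooth immersion. The connection, the projections
and the lifts are defined by choice, so each is first shown to have a witness. -/

namespace NullCong

open Bundle Set Module Filter Topology VectorField

noncomputable section

section Instances

variable {A B C D : Type*} [NormedAddCommGroup A] [NormedSpace ℝ A] [NormedAddCommGroup B]
  [NormedSpace ℝ B] [NormedAddCommGroup C] [NormedSpace ℝ C] [NormedAddCommGroup D]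
  [NormedSpace ℝ D]

/-! Shortcuts for the search of instances on spaces of multilinear maps. -/

instance clmNormedAddCommGroup : NormedAddCommGroup (A →L[ℝ] B) :=
  ContinuousLinearMap.toNormedAddCommGroup

instance clmNormedSpace : NormedSpace ℝ (A →L[ℝ] B) := ContinuousLinearMap.toNormedSpace

instance clmNormedAddCommGroup₂ : NormedAddCommGroup (A →L[ℝ] B →L[ℝ] C) :=
  ContinuousLinearMap.toNormedAddCommGroup

instance clmNormedSpace₂ : NormedSpace ℝ (A →L[ℝ] B →L[ℝ] C) := ContinuousLinearMap.toNormedSpace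

instance clmNormedAddCommGroup₃ : NormedAddCommGroup (A →L[ℝ] B →L[ℝ] C →L[ℝ] D) :=
  ContinuousLinearMap.toNormedAddCommGroup

instance clmNormedSpace₃ : NormedSpace ℝ (A →L[ℝ] B →L[ℝ] C →L[ℝ] D) :=
  ContinuousLinearMap.toNormedSpace

end Instances

/-! ### Derivatives of vector-valued functions on a manifold, and Lie brackets -/

section Calculus

variable {E : Type*} [NormedAddCommGroup E] [NormedSpace ℝ E]
  {H : Type*} [TopologicalSpace H] {I : ModelWithCorners ℝ E H}
  {N : Type*} [TopologicalSpace N] [ChartedSpace H N]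
  {F F' F'' : Type*} [NormedAddCommGroup F] [NormedSpace ℝ F]
  [NormedAddCommGroup F'] [NormedSpace ℝ F'] [NormedAddCommGroup F''] [NormedSpace ℝ F'']
  {x : N}

theorem mvfderiv_congr {f f' : N → F} (h : f =ᶠ[𝓝 x] f') (ξ : TangentSpace I x) :
    mvfderiv I f x ξ = mvfderiv I f' x ξ :=
  congrArg (fun L : E →L[ℝ] F => L ξ) h.mfderiv_eq

theorem mvfderiv_fderiv_comp {h : F → F'} {f : N → F} (hh : DifferentiableAt ℝ h (f x))
    (hf : MDifferentiableAt I 𝓘(ℝ, F) f x) (ξ : TangentSpace I x) :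
    mvfderiv I (fun y => h (f y)) x ξ = fderiv ℝ h (f x) (mvfderiv I f x ξ) := by
  have := mfderiv_comp x hh.mdifferentiableAt hf
  rw [mfderiv_eq_fderiv] at this
  exact congrArg (fun L : E →L[ℝ] F' => L ξ) this

theorem mdifferentiableAt_fderiv_comp {h : F → F'} {f : N → F} (hh : DifferentiableAt ℝ h (f x))
    (hf : MDifferentiableAt I 𝓘(ℝ, F) f x) :
    MDifferentiableAt I 𝓘(ℝ, F') (fun y => h (f y)) x :=
  MDifferentiableAt.comp x hh.mdifferentiableAt hf

theorem mvfderiv_prodMk {f : N → F} {f' : N → F'} (hf : MDifferentiableAt I 𝓘(ℝ, F) f x)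
    (hf' : MDifferentiableAt I 𝓘(ℝ, F') f' x) (ξ : TangentSpace I x) :
    mvfderiv I (fun y => (f y, f' y)) x ξ = (mvfderiv I f x ξ, mvfderiv I f' x ξ) := by
  have h := hf.prodMk_space hf'
  refine Prod.ext ?_ ?_
  · have := mvfderiv_fderiv_comp (h := (Prod.fst : F × F' → F)) differentiableAt_fst h ξ
    rw [fderiv_fst] at this
    exact this.symm
  · have := mvfderiv_fderiv_comp (h := (Prod.snd : F × F' → F')) differentiableAt_snd h ξ
    rw [fderiv_snd] at this
    exact this.symm

theorem mvfderiv_clm_apply {A : N → F →L[ℝ] F'} {f : N → F}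
    (hA : MDifferentiableAt I 𝓘(ℝ, F →L[ℝ] F') A x) (hf : MDifferentiableAt I 𝓘(ℝ, F) f x)
    (ξ : TangentSpace I x) :
    mvfderiv I (fun y => A y (f y)) x ξ = mvfderiv I A x ξ (f x) + A x (mvfderiv I f x ξ) := by
  have h := mvfderiv_fderiv_comp (h := fun p : (F →L[ℝ] F') × F => p.1 p.2)
    (f := fun y => (A y, f y)) (by fun_prop) (hA.prodMk_space hf) ξ
  rw [mvfderiv_prodMk hA hf] at h
  refine h.trans ?_
  rw [fderiv_clm_apply (by fun_prop) (by fun_prop)]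
  simp [fderiv_fst, fderiv_snd, add_comm]

/-- A bilinear form evaluated on two functions, differentiated. -/
theorem mvfderiv_clm_apply₂ {A : N → F →L[ℝ] F' →L[ℝ] F''} {f : N → F} {f' : N → F'}
    (hA : MDifferentiableAt I 𝓘(ℝ, F →L[ℝ] F' →L[ℝ] F'') A x)
    (hf : MDifferentiableAt I 𝓘(ℝ, F) f x) (hf' : MDifferentiableAt I 𝓘(ℝ, F') f' x)
    (ξ : TangentSpace I x) :
    mvfderiv I (fun y => A y (f y) (f' y)) x ξ =
      mvfderiv I A x ξ (f x) (f' x) + A x (mvfderiv I f x ξ) (f' x)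
        + A x (f x) (mvfderiv I f' x ξ) := by
  rw [mvfderiv_clm_apply (hA.clm_apply hf) hf', mvfderiv_clm_apply hA hf]
  rfl

variable [IsManifold I ∞ N]

theorem mdifferentiableAt_mvfderiv_field {Φ : N → F} (hΦ : ContMDiffAt I 𝓘(ℝ, F) ∞ Φ x)
    {X : ∀ y : N, TangentSpace I y}
    (hX : MDifferentiableAt I I.tangent (fun y => (⟨y, X y⟩ : TangentBundle I N)) x) :
    MDifferentiableAt I 𝓘(ℝ, F) (fun y => mvfderiv I Φ y (X y)) x := by
  have h1 := (hΦ.mfderiv_const (m := 1) (by norm_cast)).mdifferentiableAt one_ne_zero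
  have h2 := MDifferentiableAt.clm_apply_of_inCoordinates (b₁ := id) (b₂ := Φ) (IM := I) (IB₁ := I)
    (IB₂ := 𝓘(ℝ, F)) (E₁ := TangentSpace I) (E₂ := TangentSpace 𝓘(ℝ, F)) (F₁ := E) (F₂ := F)
    (v := X) h1 hX (hΦ.mdifferentiableAt (by simp))
  exact ((contMDiff_snd_tangentBundle_modelSpace F 𝓘(ℝ, F)).contMDiffAt.mdifferentiableAt
    one_ne_zero).comp x h2


/-- The tangent space at x is the model space through the preferred chart at x, so that chart has
the identity as its derivative there. This is why chart components at a base point coincide with the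
vectors themselves. -/
theorem mvfderiv_extChartAt_self (ξ : TangentSpace I x) :
    mvfderiv I (extChartAt I x) x ξ = ξ :=
  congrArg (fun L : E →L[ℝ] E => L ξ) (mfderiv_extChartAt_self (I := I) (x := x))

theorem mvfderiv_comp_extChartAt {f : E → F} (hf : DifferentiableAt ℝ f (extChartAt I x x))
    (ξ : TangentSpace I x) :
    mvfderiv I (fun y => f (extChartAt I x y)) x ξ = fderiv ℝ f (extChartAt I x x) ξ := by
  rw [mvfderiv_fderiv_comp hf (mdifferentiableAt_extChartAt (mem_chart_source H x)),
    mvfderiv_extChartAt_self]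

variable (I) in
/-- The coordinate expression of the vector field `Z` in the chart at `x`. -/
def chartRep (x : N) (Z : ∀ y : N, TangentSpace I y) : E → E := fun b =>
  mpullbackWithin 𝓘(ℝ, E) I (extChartAt I x).symm Z (range I) b

theorem chartRep_apply (Z : ∀ y : N, TangentSpace I y) {y : N}
    (hy : y ∈ (extChartAt I x).source) :
    chartRep I x Z (extChartAt I x y) =
      mvfderiv I (extChartAt I x) y (Z y) := by
  rw [chartRep, mpullbackWithin_apply]
  have hi := isInvertible_mfderivWithin_extChartAt_symm ((extChartAt I x).map_source hy)
  have h1 := mfderivWithin_extChartAt_symm_comp_mfderiv_extChartAt' hy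
  obtain ⟨L, hL⟩ := hi
  rw [← hL, ContinuousLinearMap.inverse_equiv]
  rw [← hL] at h1
  apply L.injective
  change L (L.symm _) = _
  rw [L.apply_symm_apply]
  rw [(extChartAt I x).left_inv hy]
  exact (congrArg (fun L : E →L[ℝ] E => L (Z y)) h1).symm

variable [I.Boundaryless]

theorem contDiffAt_comp_extChartAt_symm {Φ : N → F} {m : WithTop ℕ∞} (hm : m ≤ ∞) {x₀ : N}
    (hx : x ∈ (extChartAt I x₀).source) (hΦ : ContMDiffAt I 𝓘(ℝ, F) m Φ x) :
    ContDiffAt ℝ m (Φ ∘ (extChartAt I x₀).symm) (extChartAt I x₀ x) := by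
  rw [← contMDiffAt_iff_contDiffAt]
  refine ContMDiffAt.comp _ (by rwa [(extChartAt I x₀).left_inv hx]) ?_
  exact (contMDiffOn_extChartAt_symm (n := ∞) x₀).contMDiffAt
    (extChartAt_target_mem_nhds' ((extChartAt I x₀).map_source hx)) |>.of_le hm

theorem mvfderiv_eq_fderiv_extChartAt {Φ : N → F} {x₀ : N} (hx : x ∈ (extChartAt I x₀).source)
    (hΦ : ContMDiffAt I 𝓘(ℝ, F) 1 Φ x) (ξ : TangentSpace I x) :
    mvfderiv I Φ x ξ = fderiv ℝ (Φ ∘ (extChartAt I x₀).symm) (extChartAt I x₀ x)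
      (mvfderiv I (extChartAt I x₀) x ξ) := by
  have h1 := contDiffAt_comp_extChartAt_symm (m := 1) (by norm_cast) hx hΦ
  rw [← mvfderiv_fderiv_comp (h1.differentiableAt one_ne_zero)
    (mdifferentiableAt_extChartAt (by rwa [← extChartAt_source I]))]
  apply mvfderiv_congr
  filter_upwards [(isOpen_extChartAt_source x₀).mem_nhds hx] with y hy
  simp only [Function.comp_apply, (extChartAt I x₀).left_inv hy]

theorem eventually_mvfderiv_eq_fderiv {Φ : N → F} (hΦ : ContMDiffAt I 𝓘(ℝ, F) ∞ Φ x)  :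
    ∀ᶠ y in 𝓝 x, ∀ ξ : TangentSpace I y, mvfderiv I Φ y ξ =
      fderiv ℝ (Φ ∘ (extChartAt I x).symm) (extChartAt I x y)
        (mvfderiv I (extChartAt I x) y ξ) := by
  have h1 : ∀ᶠ y in 𝓝 x, ContMDiffAt I 𝓘(ℝ, F) 1 Φ y :=
    (contMDiffAt_iff_contMDiffAt_nhds (by simp)).1 (hΦ.of_le (by norm_cast))
  filter_upwards [h1, extChartAt_source_mem_nhds (I := I) x] with y hy hy' ξ
  exact mvfderiv_eq_fderiv_extChartAt hy' hy ξ

variable [CompleteSpace E]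

/-- The differential of a smooth map `Φ` applied to a Lie bracket. -/
theorem mvfderiv_mlieBracket {Φ : N → F} (hΦ : ContMDiffAt I 𝓘(ℝ, F) ∞ Φ x)
    {X Y : ∀ y : N, TangentSpace I y}
    (hX : MDifferentiableAt I I.tangent (fun y => (⟨y, X y⟩ : TangentBundle I N)) x)
    (hY : MDifferentiableAt I I.tangent (fun y => (⟨y, Y y⟩ : TangentBundle I N)) x) :
    mvfderiv I Φ x (mlieBracket I X Y x) =
      mvfderiv I (fun y => mvfderiv I Φ y (Y y)) x (X x)
        - mvfderiv I (fun y => mvfderiv I Φ y (X y)) x (Y x) := by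
  set φ := extChartAt I x with hφ
  have hsrc : x ∈ φ.source := mem_extChartAt_source x
  have hd : ∀ Z : ∀ y : N, TangentSpace I y,
      MDifferentiableAt I I.tangent (fun y => (⟨y, Z y⟩ : TangentBundle I N)) x →
      DifferentiableAt ℝ (chartRep I x Z) (φ x) := by
    intro Z hZ
    have := MDifferentiableWithinAt.differentiableWithinAt_mpullbackWithin_vectorField
      (s := univ) hZ.mdifferentiableWithinAt
    change DifferentiableWithinAt ℝ (chartRep I x Z) _ _ at this
    rwa [I.range_eq_univ, preimage_univ, univ_inter, differentiableWithinAt_univ] at this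
  have hx0 : ∀ Z : ∀ y : N, TangentSpace I y,
      (chartRep I x Z) (φ x) = Z x := fun Z =>
    (chartRep_apply Z hsrc).trans (mvfderiv_extChartAt_self (Z x))
  set ψ : E → F := Φ ∘ φ.symm with hψ
  have hψd : ContDiffAt ℝ ∞ ψ (φ x) := contDiffAt_comp_extChartAt_symm le_rfl hsrc hΦ
  -- In the chart, differentiating dΦ(Z) gives a second derivative of Φ plus dΦ applied to the
  -- derivative of the components of Z. The second derivative is symmetric and cancels in the
  -- commutator.
  have key : ∀ Z : ∀ y : N, TangentSpace I y, ∀ W : TangentSpace I x,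
      MDifferentiableAt I I.tangent (fun y => (⟨y, Z y⟩ : TangentBundle I N)) x →
      mvfderiv I (fun y => mvfderiv I Φ y (Z y)) x W =
        fderiv ℝ (fderiv ℝ ψ) (φ x) W (Z x) + fderiv ℝ ψ (φ x)
          (fderiv ℝ (chartRep I x Z) (φ x) W) := by
    intro Z W hZ
    have hev : (fun y => mvfderiv I Φ y (Z y)) =ᶠ[𝓝 x] fun y => (fun b => fderiv ℝ ψ b
        ((chartRep I x Z) b)) (φ y) := by
      filter_upwards [eventually_mvfderiv_eq_fderiv hΦ, extChartAt_source_mem_nhds (I := I) x]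
        with y hy hy'
      rw [hy, ← chartRep_apply Z hy']
    have h2 : DifferentiableAt ℝ (fderiv ℝ ψ) (φ x) :=
      (hψd.fderiv_right (m := 1) (by norm_cast)).differentiableAt one_ne_zero
    rw [mvfderiv_congr hev, mvfderiv_comp_extChartAt (h2.clm_apply (hd Z hZ)),
      fderiv_clm_apply h2 (hd Z hZ)]
    rw [hx0]
    exact add_comm _ _
  have hb : (mlieBracket I X Y x : E) =
      fderiv ℝ (chartRep I x Y) (φ x) (X x)
        - fderiv ℝ (chartRep I x X) (φ x) (Y x) := by
    -- The manifold bracket is the bracket of the chart expressions, carried back by the derivative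
    -- of the chart, which is the identity at its own base point.
    have h1 : (mlieBracket I X Y x : E) =
        lieBracketWithin ℝ (chartRep I x X) (chartRep I x Y) (range I) (φ x) := by
      rw [← mlieBracketWithin_univ, mlieBracketWithin_apply, mfderiv_extChartAt_self,
        preimage_univ, univ_inter]
      erw [ContinuousLinearMap.inverse_id]
      rfl
    rw [h1, I.range_eq_univ, lieBracketWithin_univ, lieBracket_eq]
    simp only [hx0]
    rfl
  rw [key Y (X x) hY, key X (Y x) hX]
  have hsymm : fderiv ℝ (fderiv ℝ ψ) (φ x) (X x) (Y x) = fderiv ℝ (fderiv ℝ ψ) (φ x) (Y x) (X x) :=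
    (hψd.isSymmSndFDerivAt (by simpa using ENat.LEInfty.out)).eq _ _
  rw [mvfderiv_eq_fderiv_extChartAt hsrc (hΦ.of_le (by norm_cast)), mvfderiv_extChartAt_self]
  rw [hsymm]
  erw [hb]
  rw [map_sub]
  abel

end Calculus

/-! ### The Koszul formula for pullback metrics -/

section LeviCivita

variable {E : Type*} [NormedAddCommGroup E] [NormedSpace ℝ E]
  {H : Type*} [TopologicalSpace H] {I : ModelWithCorners ℝ E H}
  {N : Type*} [TopologicalSpace N] [ChartedSpace H N] [IsManifold I ∞ N]
  {F : Type*} [NormedAddCommGroup F] [NormedSpace ℝ F] {x : N}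

/-- A vector field is differentiable at `x` if and only if its coordinate expression is. -/
theorem mdifferentiableAt_field_iff (x₀ : N) {X : ∀ y : N, TangentSpace I y}
    (hx : x ∈ (extChartAt I x₀).source) :
    MDifferentiableAt I I.tangent (fun y => (⟨y, X y⟩ : TangentBundle I N)) x ↔
      MDifferentiableAt I 𝓘(ℝ, E) (fun y => mvfderiv I (extChartAt I x₀) y (X y)) x := by
  rw [extChartAt_source] at hx
  refine (Trivialization.mdifferentiableAt_section_iff I (trivializationAt E (TangentSpace I) x₀) X
    (by simpa using hx)).trans ?_
  apply Filter.EventuallyEq.mdifferentiableAt_iff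
  filter_upwards [(chartAt H x₀).open_source.mem_nhds hx] with y hy
  have h1 := TangentBundle.continuousLinearMapAt_trivializationAt (I := I) hy
  have h2 : (mvfderiv I (extChartAt I x₀) y (X y)) =
    (trivializationAt E (TangentSpace I) x₀).continuousLinearMapAt ℝ y (X y) :=
    (congrArg (fun L : E →L[ℝ] E => L (X y)) h1).symm
  rw [h2, Trivialization.continuousLinearMapAt_apply, Trivialization.coe_linearMapAt_of_mem]
  simpa using hy

variable [I.Boundaryless]

/-- A vector field which is mapped to a differentiable function by the differential of an immersion
is differentiable. -/
theorem mdifferentiableAt_of_immersion [FiniteDimensional ℝ E] [FiniteDimensional ℝ F] {Φ : N → F}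
    (hΦ : ContMDiffAt I 𝓘(ℝ, F) ∞ Φ x) (hinj : Function.Injective (mvfderiv I Φ x))
    {X : ∀ y : N, TangentSpace I y} {f : N → F} (hf : MDifferentiableAt I 𝓘(ℝ, F) f x)
    (hXf : ∀ᶠ y in 𝓝 x, mvfderiv I Φ y (X y) = f y) :
    MDifferentiableAt I I.tangent (fun y => (⟨y, X y⟩ : TangentBundle I N)) x := by
  have hsrc := mem_extChartAt_source (I := I) x
  rw [mdifferentiableAt_field_iff x hsrc]
  set φ := extChartAt I x with hφ
  set ψ := Φ ∘ φ.symm with hψ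
  have hψd : ContDiffAt ℝ ∞ ψ (φ x) := contDiffAt_comp_extChartAt_symm le_rfl hsrc hΦ
  have hD : ∀ ξ : TangentSpace I x, fderiv ℝ ψ (φ x) ξ = mvfderiv I Φ x ξ := by
    intro ξ
    rw [mvfderiv_eq_fderiv_extChartAt hsrc (hΦ.of_le (by norm_cast)), mvfderiv_extChartAt_self]
  -- A left inverse L of the derivative at x alone suffices: L ∘ dψ is the identity at x, hence
  -- invertible nearby, and X is recovered as the inverse of L ∘ dψ applied to L f, which is
  -- differentiable.
  obtain ⟨L₀, hL₀⟩ := LinearMap.exists_leftInverse_of_injective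
    ((fderiv ℝ ψ (φ x) : E →L[ℝ] F) : E →ₗ[ℝ] F) (by
      rw [LinearMap.ker_eq_bot]
      intro a b hab
      apply hinj
      have : fderiv ℝ ψ (φ x) a = fderiv ℝ ψ (φ x) b := hab
      exact (hD a).symm.trans (this.trans (hD b)))
  let L : F →L[ℝ] E := LinearMap.toContinuousLinearMap L₀
  have hL : L ∘L fderiv ℝ ψ (φ x) = ContinuousLinearMap.id ℝ E := by
    ext ξ
    exact LinearMap.congr_fun hL₀ ξ
  let A : E → E →L[ℝ] E := fun b => L ∘L fderiv ℝ ψ b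
  have hAd : DifferentiableAt ℝ A (φ x) := by
    have h2 : DifferentiableAt ℝ (fderiv ℝ ψ) (φ x) :=
      (hψd.fderiv_right (m := 1) (by norm_cast)).differentiableAt one_ne_zero
    exact (differentiableAt_const L).clm_comp h2
  have hAx : A (φ x) = (ContinuousLinearEquiv.refl ℝ E : E →L[ℝ] E) := hL
  have hinv : DifferentiableAt ℝ (fun b => (A b).inverse) (φ x) := by
    refine DifferentiableAt.comp (g := ContinuousLinearMap.inverse) (φ x) ?_ hAd
    rw [hAx]
    exact (contDiffAt_map_inverse (n := 1) _).differentiableAt one_ne_zero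
  have hmφ : MDifferentiableAt I 𝓘(ℝ, E) φ x := mdifferentiableAt_extChartAt (mem_chart_source H x)
  have hm := (mdifferentiableAt_fderiv_comp hinv hmφ).clm_apply
    (mdifferentiableAt_fderiv_comp L.differentiableAt hf)
  refine hm.congr_of_eventuallyEq ?_
  have hopen : ∀ᶠ y in 𝓝 x, A (φ y) ∈ range ((↑) : (E ≃L[ℝ] E) → E →L[ℝ] E) := by
    have hc : ContinuousAt (fun y => A (φ y)) x :=
      ContinuousAt.comp (g := A) hAd.continuousAt (continuousAt_extChartAt x)
    exact hc.eventually (ContinuousLinearEquiv.isOpen.mem_nhds ⟨_, hAx.symm⟩)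
  filter_upwards [hopen, hXf, eventually_mvfderiv_eq_fderiv hΦ] with y hy hXy hd
  obtain ⟨Λ, hΛ⟩ := hy
  rw [← hXy, hd, ← hΛ, ContinuousLinearMap.inverse_equiv]
  change _ = Λ.symm (A (φ y) _)
  rw [← hΛ]
  exact (Λ.symm_apply_apply _).symm

variable [CompleteSpace E] {g : ∀ x : N, TangentSpace I x → TangentSpace I x → ℝ}
  {S : F → F →L[ℝ] F →L[ℝ] ℝ} {Φ : N → F} {X Y Z : ∀ y : N, TangentSpace I y}

/-- The Koszul expression of a metric which is the pullback of a field `S` of bilinear forms on a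
vector space. -/
theorem koszul_eq_of_pullback (hΦ : ContMDiffAt I 𝓘(ℝ, F) ∞ Φ x)
    (hS : DifferentiableAt ℝ S (Φ x)) (hsymm : ∀ a b, S (Φ x) a b = S (Φ x) b a)
    (hg : ∀ᶠ y in 𝓝 x, ∀ u w, g y u w = S (Φ y) (mvfderiv I Φ y u) (mvfderiv I Φ y w))
    (hX : MDifferentiableAt I I.tangent (fun y => (⟨y, X y⟩ : TangentBundle I N)) x)
    (hY : MDifferentiableAt I I.tangent (fun y => (⟨y, Y y⟩ : TangentBundle I N)) x)
    (hZ : MDifferentiableAt I I.tangent (fun y => (⟨y, Z y⟩ : TangentBundle I N)) x) :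
    koszul g X Y Z x =
      fderiv ℝ S (Φ x) (mvfderiv I Φ x (X x)) (mvfderiv I Φ x (Y x)) (mvfderiv I Φ x (Z x))
      + fderiv ℝ S (Φ x) (mvfderiv I Φ x (Y x)) (mvfderiv I Φ x (Z x)) (mvfderiv I Φ x (X x))
      - fderiv ℝ S (Φ x) (mvfderiv I Φ x (Z x)) (mvfderiv I Φ x (X x)) (mvfderiv I Φ x (Y x))
      + 2 * S (Φ x) (mvfderiv I (fun y => mvfderiv I Φ y (Y y)) x (X x)) (mvfderiv I Φ x (Z x)) := by
  have hΦd : MDifferentiableAt I 𝓘(ℝ, F) Φ x := hΦ.mdifferentiableAt (by simp)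
  have hSd : MDifferentiableAt I 𝓘(ℝ, F →L[ℝ] F →L[ℝ] ℝ) (fun y => S (Φ y)) x :=
    mdifferentiableAt_fderiv_comp hS hΦd
  have key : ∀ U V : ∀ y : N, TangentSpace I y,
      MDifferentiableAt I I.tangent (fun y => (⟨y, U y⟩ : TangentBundle I N)) x →
      MDifferentiableAt I I.tangent (fun y => (⟨y, V y⟩ : TangentBundle I N)) x →
      ∀ ξ : TangentSpace I x, mvfderiv I (fun y => g y (U y) (V y)) x ξ =
        fderiv ℝ S (Φ x) (mvfderiv I Φ x ξ) (mvfderiv I Φ x (U x)) (mvfderiv I Φ x (V x))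
        + S (Φ x) (mvfderiv I (fun y => mvfderiv I Φ y (U y)) x ξ) (mvfderiv I Φ x (V x))
        + S (Φ x) (mvfderiv I Φ x (U x)) (mvfderiv I (fun y => mvfderiv I Φ y (V y)) x ξ) := by
    intro U V hU hV ξ
    have hev : (fun y => g y (U y) (V y)) =ᶠ[𝓝 x]
        fun y => S (Φ y) (mvfderiv I Φ y (U y)) (mvfderiv I Φ y (V y)) := by
      filter_upwards [hg] with y hy using hy _ _
    rw [mvfderiv_congr hev, mvfderiv_clm_apply₂ hSd
      (mdifferentiableAt_mvfderiv_field hΦ hU) (mdifferentiableAt_mvfderiv_field hΦ hV),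
      mvfderiv_fderiv_comp hS hΦd]
  have hgx := hg.self_of_nhds
  rw [koszul, key Y Z hY hZ, key Z X hZ hX, key X Y hX hY, hgx, hgx, hgx,
    mvfderiv_mlieBracket hΦ hX hY, mvfderiv_mlieBracket hΦ hY hZ, mvfderiv_mlieBracket hΦ hZ hX]
  -- Each bracket contributes a difference of derivatives of dΦ(·). By the symmetry of S these
  -- cancel against the derivatives of the three scalar products, except for two equal terms in X(dΦ
  -- Y).
  simp only [map_sub, sub_apply]
  rw [hsymm (mvfderiv I Φ x (Y x)), hsymm (mvfderiv I Φ x (Z x)), hsymm (mvfderiv I Φ x (X x))]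
  ring

variable [FiniteDimensional ℝ E]

/-- The Levi-Civita connection satisfies the Koszul formula. -/
theorem two_mul_leviCivita (hΦ : ContMDiffAt I 𝓘(ℝ, F) ∞ Φ x)
    (hS : DifferentiableAt ℝ S (Φ x)) (hsymm : ∀ a b, S (Φ x) a b = S (Φ x) b a)
    (hg : ∀ᶠ y in 𝓝 x, ∀ u w, g y u w = S (Φ y) (mvfderiv I Φ y u) (mvfderiv I Φ y w))
    (hnd : ∀ u, (∀ w, g x u w = 0) → u = 0)
    (hX : MDifferentiableAt I I.tangent (fun y => (⟨y, X y⟩ : TangentBundle I N)) x)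
    (hY : MDifferentiableAt I I.tangent (fun y => (⟨y, Y y⟩ : TangentBundle I N)) x)
    (hZ : MDifferentiableAt I I.tangent (fun y => (⟨y, Z y⟩ : TangentBundle I N)) x) :
    2 * g x (leviCivita g X Y x) (Z x) = koszul g X Y Z x := by
  let D : E →L[ℝ] F := mvfderiv I Φ x
  have hgx := hg.self_of_nhds
  let G : E →ₗ[ℝ] Dual ℝ E := LinearMap.mk₂ ℝ (fun u w => S (Φ x) (D u) (D w))
    (by simp) (by simp) (by simp) (by simp)
  have hGi : Function.Injective G := by
    rw [← LinearMap.ker_eq_bot, LinearMap.ker_eq_bot']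
    intro u hu
    refine hnd u fun w => ?_
    exact (hgx u w).trans (LinearMap.congr_fun hu w)
  have hGs : Function.Surjective G :=
    (LinearMap.injective_iff_surjective_of_finrank_eq_finrank
      (Subspace.dual_finrank_eq).symm).1 hGi
  -- The pullback expression depends on Z only through Z x, linearly. Half of it is a covector at x,
  -- which the nondegenerate metric represents by a vector w; this witness makes the choice in
  -- `leviCivita` meaningful.
  let R : E →L[ℝ] ℝ := (1 / 2 : ℝ) • ((fderiv ℝ S (Φ x) (D (X x)) (D (Y x))) ∘L D
    + ((fderiv ℝ S (Φ x) (D (Y x))).flip (D (X x))) ∘L D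
    - (((fderiv ℝ S (Φ x)).flip (D (X x))).flip (D (Y x))) ∘L D
    + (2 : ℝ) • (S (Φ x) (mvfderiv I (fun y => mvfderiv I Φ y (Y y)) x (X x))) ∘L D)
  obtain ⟨w, hw⟩ := hGs R.toLinearMap
  have hex : ∃ w : TangentSpace I x, ∀ Z : ∀ x : N, TangentSpace I x,
      MDifferentiableAt I I.tangent (fun y => (⟨y, Z y⟩ : TangentBundle I N)) x →
      2 * g x w (Z x) = koszul g X Y Z x := by
    refine ⟨w, fun Z hZ => ?_⟩
    rw [koszul_eq_of_pullback hΦ hS hsymm hg hX hY hZ]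
    have h1 : S (Φ x) (D w) (D (Z x)) = R (Z x) := LinearMap.congr_fun hw (Z x)
    rw [(hgx w (Z x)).trans h1]
    change 2 * ((1 / 2 : ℝ) * (fderiv ℝ S (Φ x) (D (X x)) (D (Y x)) (D (Z x))
      + fderiv ℝ S (Φ x) (D (Y x)) (D (Z x)) (D (X x))
      - fderiv ℝ S (Φ x) (D (Z x)) (D (X x)) (D (Y x))
      + 2 * S (Φ x) (mvfderiv I (fun y => mvfderiv I Φ y (Y y)) x (X x)) (D (Z x)))) = _
    rw [← mul_assoc]
    norm_num
    rfl
  exact Classical.epsilon_spec hex Z hZ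

/-- Linearity is not built into a connection defined by choice. Here the Koszul expression with
second field zero vanishes against every vector, and nondegeneracy concludes. -/
theorem leviCivita_zero_right (hΦ : ContMDiffAt I 𝓘(ℝ, F) ∞ Φ x)
    (hS : DifferentiableAt ℝ S (Φ x)) (hsymm : ∀ a b, S (Φ x) a b = S (Φ x) b a)
    (hg : ∀ᶠ y in 𝓝 x, ∀ u w, g y u w = S (Φ y) (mvfderiv I Φ y u) (mvfderiv I Φ y w))
    (hnd : ∀ u, (∀ w, g x u w = 0) → u = 0)
    (hX : MDifferentiableAt I I.tangent (fun y => (⟨y, X y⟩ : TangentBundle I N)) x) :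
    leviCivita g X (fun _ => 0) x = 0 := by
  have h0 : MDifferentiableAt I I.tangent (fun y => (⟨y, 0⟩ : TangentBundle I N)) x :=
    mdifferentiableAt_zeroSection ℝ (TangentSpace I)
  refine hnd _ fun w => ?_
  have hw := FiberBundle.mdifferentiableAt_extend I E (V := TangentSpace I) w
  have h := two_mul_leviCivita hΦ hS hsymm hg hnd hX h0 hw
  rw [koszul_eq_of_pullback hΦ hS hsymm hg hX h0 hw, FiberBundle.extend_apply_self] at h
  have hz : (fun y => mvfderiv I Φ y (0 : TangentSpace I y)) = fun _ => 0 := by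
    funext y
    exact map_zero _
  rw [hz, mvfderiv_const] at h
  simpa using h

end LeviCivita

/-! ### Christoffel symbols of a field of bilinear forms on a vector space -/

section Christoffel

variable {E : Type*} [NormedAddCommGroup E] [NormedSpace ℝ E]
  (G : E → E →L[ℝ] E →L[ℝ] ℝ)

theorem _root_.ContDiffAt.clm_flip {A B C D : Type*} [NormedAddCommGroup A] [NormedSpace ℝ A]
    [NormedAddCommGroup B] [NormedSpace ℝ B] [NormedAddCommGroup C] [NormedSpace ℝ C]
    [NormedAddCommGroup D] [NormedSpace ℝ D] {f : D → A →L[ℝ] B →L[ℝ] C} {d : D}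
    {m : WithTop ℕ∞} (hf : ContDiffAt ℝ m f d) : ContDiffAt ℝ m (fun z => (f z).flip) d :=
  (ContinuousLinearMap.flipₗᵢ ℝ A B C).contDiff.contDiffAt.comp d hf

section Postcomp

variable {V W : Type*} [NormedAddCommGroup V] [NormedSpace ℝ V] [NormedAddCommGroup W]
  [NormedSpace ℝ W]

/-- The composition of a bilinear map with a linear map. -/
def postcomp (A : V →L[ℝ] W) (B : E →L[ℝ] E →L[ℝ] V) : E →L[ℝ] E →L[ℝ] W :=
  (ContinuousLinearMap.compL ℝ E V W A) ∘L B

theorem postcomp_apply (A : V →L[ℝ] W) (B : E →L[ℝ] E →L[ℝ] V) (a b : E) :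
    postcomp A B a b = A (B a b) := rfl

theorem _root_.ContDiffAt.postcomp {A : E → V →L[ℝ] W} {B : E → E →L[ℝ] E →L[ℝ] V} {y : E}
    {m : WithTop ℕ∞} (hA : ContDiffAt ℝ m A y) (hB : ContDiffAt ℝ m B y) :
    ContDiffAt ℝ m (fun z => NullCong.postcomp (A z) (B z)) y := by
  have h : ContDiffAt ℝ m (fun z => ContinuousLinearMap.compL ℝ E V W (A z)) y :=
    (ContinuousLinearMap.compL ℝ E V W).contDiff.contDiffAt.comp y hA
  exact h.clm_comp hB

end Postcomp

variable (E) in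
/-- Exchanging the arguments of a bilinear form, as a continuous linear map. -/
def flipForm : (E →L[ℝ] E →L[ℝ] ℝ) →L[ℝ] (E →L[ℝ] E →L[ℝ] ℝ) :=
  ((ContinuousLinearMap.flipₗᵢ ℝ E E ℝ).toContinuousLinearEquiv : _ →L[ℝ] _)

/-- Twice the Christoffel symbols of the first kind of a field `G` of bilinear forms. -/
def christoffelLower (y : E) : E →L[ℝ] E →L[ℝ] E →L[ℝ] ℝ :=
  fderiv ℝ G y + (flipForm E ∘L fderiv ℝ G y).flip - flipForm E ∘L (fderiv ℝ G y).flip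

/-- The Christoffel symbols of a field `G` of nondegenerate bilinear forms. -/
def christoffel (y : E) : E →L[ℝ] E →L[ℝ] E :=
  postcomp ((1 / 2 : ℝ) • (G y).inverse) (christoffelLower G y)

/-- The curvature tensor in terms of the Christoffel symbols `Γ`. -/
def chartCurvature (Γ : E → E →L[ℝ] E →L[ℝ] E) (y a b c : E) : E :=
  fderiv ℝ Γ y a b c - fderiv ℝ Γ y b a c + Γ y a (Γ y b c) - Γ y b (Γ y a c)

variable {G} {y : E}

theorem christoffelLower_apply (a b c : E) : christoffelLower G y a b c =
    fderiv ℝ G y a b c + fderiv ℝ G y b c a - fderiv ℝ G y c a b := rfl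

variable [FiniteDimensional ℝ E]

theorem exists_equiv_of_nondegenerate (B : E →L[ℝ] E →L[ℝ] ℝ)
    (h : ∀ u, (∀ w, B u w = 0) → u = 0) : ∃ e : E ≃L[ℝ] (E →L[ℝ] ℝ), (e : E →L[ℝ] E →L[ℝ] ℝ) = B := by
  have hinj : Function.Injective (B : E →ₗ[ℝ] (E →L[ℝ] ℝ)) := by
    rw [← LinearMap.ker_eq_bot, LinearMap.ker_eq_bot']
    intro u hu
    exact h u fun w => DFunLike.congr_fun hu w
  have hdim : finrank ℝ E = finrank ℝ (E →L[ℝ] ℝ) := by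
    rw [← LinearEquiv.finrank_eq (LinearMap.toContinuousLinearMap : (E →ₗ[ℝ] ℝ) ≃ₗ[ℝ] (E →L[ℝ] ℝ))]
    exact Subspace.dual_finrank_eq.symm
  exact ⟨(LinearEquiv.ofInjectiveOfFinrankEq (B : E →ₗ[ℝ] (E →L[ℝ] ℝ)) hinj hdim).toContinuousLinearEquiv, by
    ext; rfl⟩

theorem two_mul_christoffel (h : ∀ u, (∀ w, G y u w = 0) → u = 0) (a b c : E) :
    2 * G y (christoffel G y a b) c =
      fderiv ℝ G y a b c + fderiv ℝ G y b c a - fderiv ℝ G y c a b := by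
  rw [← christoffelLower_apply]
  obtain ⟨e, he⟩ := exists_equiv_of_nondegenerate (G y) h
  have : christoffel G y a b = (1 / 2 : ℝ) • e.symm (christoffelLower G y a b) := by
    rw [christoffel, postcomp_apply, ← he, ContinuousLinearMap.inverse_equiv]
    rfl
  rw [this, ← he]
  simp

/-- Nondegeneracy makes G y an invertible map from E to its dual, and inversion of continuous linear
maps is smooth at an invertible one. -/
theorem contDiffAt_christoffel (hG : ContDiffAt ℝ ∞ G y) (h : ∀ u, (∀ w, G y u w = 0) → u = 0) :
    ContDiffAt ℝ ∞ (christoffel G) y := by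
  obtain ⟨e, he⟩ := exists_equiv_of_nondegenerate (G y) h
  have hD : ContDiffAt ℝ ∞ (fderiv ℝ G) y := hG.fderiv_right (m := ∞) (by norm_cast)
  have hinv : ContDiffAt ℝ ∞ (fun z => (G z).inverse) y := by
    refine ContDiffAt.comp (g := ContinuousLinearMap.inverse) y ?_ hG
    rw [← he]
    exact contDiffAt_map_inverse _
  have hlow : ContDiffAt ℝ ∞ (christoffelLower G) y := by
    have hc : ContDiffAt ℝ ∞ (fun _ : E => flipForm E) y := contDiffAt_const
    have h1 := (hc.clm_comp hD).clm_flip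
    have h2 := hc.clm_comp hD.clm_flip
    exact (hD.add h1).sub h2
  exact (hinv.const_smul (1 / 2 : ℝ)).postcomp hlow

/-- Metric compatibility of the Christoffel symbols. -/
theorem fderiv_eq_christoffel (h : ∀ u, (∀ w, G y u w = 0) → u = 0)
    (hd : DifferentiableAt ℝ G y) (hsymm : ∀ᶠ z in 𝓝 y, ∀ a b, G z a b = G z b a) (a b c : E) :
    fderiv ℝ G y a b c = G y (christoffel G y a b) c + G y b (christoffel G y a c) := by
  -- The derivative inherits symmetry in the last two slots, which requires G to be symmetric near y
  -- and not only at y.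
  have hD : ∀ a b c, fderiv ℝ G y a b c = fderiv ℝ G y a c b := by
    intro a b c
    have h1 : ∀ b c, fderiv ℝ (fun z => G z b c) y a = fderiv ℝ G y a b c := by
      intro b c
      rw [fderiv_clm_apply (hd.clm_apply (differentiableAt_const b)) (differentiableAt_const c),
        fderiv_clm_apply hd (differentiableAt_const b)]
      simp
    rw [← h1, ← h1]
    have : (fun z => G z b c) =ᶠ[𝓝 y] fun z => G z c b := by
      filter_upwards [hsymm] with z hz using hz b c
    rw [this.fderiv_eq]
  have h1 := two_mul_christoffel h a b c
  have h2 := two_mul_christoffel h a c b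
  rw [hsymm.self_of_nhds b]
  have := hD a b c
  have := hD c a b
  have := hD b a c
  linarith

end Christoffel

/-! ### The Lorentzian metric in a chart of the base -/

section Chart

variable {n : ℕ} {M : Type*} [TopologicalSpace M] [ChartedSpace (EuclideanSpace ℝ (Fin n)) M]
  [IsManifold (𝓡 n) ∞ M]

local notation "𝔼" n => EuclideanSpace ℝ (Fin n)

/-- In the orthonormal basis, pairing with a basis vector returns the corresponding coefficient of u
up to sign. -/
theorem LorentzMetric.nondegenerate (g : LorentzMetric n M) (p : M) (u : TangentSpace (𝓡 n) p)
    (hu : ∀ w, g.val p u w = 0) : u = 0 := by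
  obtain ⟨b, hb⟩ := g.signature p
  rw [← b.sum_repr u]
  refine Finset.sum_eq_zero fun j _ => ?_
  have h1 := hu (b j)
  rw [← b.sum_repr u] at h1
  simp only [map_sum, map_smul, sum_apply, smul_apply, hb,
    smul_eq_mul, mul_ite, mul_zero] at h1
  rw [Finset.sum_ite_eq' Finset.univ j] at h1
  simp only [Finset.mem_univ, if_true] at h1
  have h2 : b.repr u j = 0 := by
    split_ifs at h1 <;> simpa using h1
  rw [h2, zero_smul]

/-- The value at `q` of the vector field which is constant in the chart at `p₀`. -/
def chartVec (p₀ q : M) : (𝔼 n) →L[ℝ] TangentSpace (𝓡 n) q :=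
  (trivializationAt (𝔼 n) (TangentSpace (𝓡 n)) p₀).symmL ℝ q

/-- Links the two descriptions of the components of a tangent vector: derivatives of the chart, used
for computation, and the trivialization, in which `extend`, `connector` and `chartVec` are phrased.
-/
theorem mvfderiv_extChartAt_eq {p₀ q : M} (hq : q ∈ (extChartAt (𝓡 n) p₀).source)
    (u : TangentSpace (𝓡 n) q) : mvfderiv (𝓡 n) (extChartAt (𝓡 n) p₀) q u =
      (trivializationAt (𝔼 n) (TangentSpace (𝓡 n)) p₀).continuousLinearMapAt ℝ q u := by
  rw [extChartAt_source] at hq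
  exact (congrArg (fun L : (𝔼 n) →L[ℝ] (𝔼 n) => L u)
    (TangentBundle.continuousLinearMapAt_trivializationAt (I := 𝓡 n) hq)).symm

theorem chartVec_mvfderiv {p₀ q : M} (hq : q ∈ (extChartAt (𝓡 n) p₀).source)
    (u : TangentSpace (𝓡 n) q) : chartVec p₀ q (mvfderiv (𝓡 n) (extChartAt (𝓡 n) p₀) q u) = u := by
  rw [mvfderiv_extChartAt_eq hq]
  exact Trivialization.symmL_continuousLinearMapAt _ (by simpa using hq) u

theorem mvfderiv_chartVec {p₀ q : M} (hq : q ∈ (extChartAt (𝓡 n) p₀).source) (a : 𝔼 n) :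
    mvfderiv (𝓡 n) (extChartAt (𝓡 n) p₀) q (chartVec p₀ q a) = a := by
  rw [mvfderiv_extChartAt_eq hq]
  exact Trivialization.continuousLinearMapAt_symmL _ (by simpa using hq) a

theorem contMDiffAt_field_iff (p₀ : M) {X : ∀ q : M, TangentSpace (𝓡 n) q}
    {q : M} (hq : q ∈ (extChartAt (𝓡 n) p₀).source) :
    ContMDiffAt (𝓡 n) (𝓡 n).tangent ∞ (fun y => (⟨y, X y⟩ : TangentBundle (𝓡 n) M)) q ↔
      ContMDiffAt (𝓡 n) 𝓘(ℝ, 𝔼 n) ∞ (fun y => mvfderiv (𝓡 n) (extChartAt (𝓡 n) p₀) y (X y)) q := by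
  refine (Trivialization.contMDiffAt_section_iff (trivializationAt (𝔼 n) (TangentSpace (𝓡 n)) p₀)
    (by simpa using hq)).trans ?_
  apply Filter.EventuallyEq.contMDiffAt_iff
  filter_upwards [(isOpen_extChartAt_source p₀).mem_nhds hq] with y hy
  rw [mvfderiv_extChartAt_eq hy, Trivialization.continuousLinearMapAt_apply,
    Trivialization.coe_linearMapAt_of_mem]
  simpa using hy

theorem contMDiffAt_chartVec {p₀ q : M} (hq : q ∈ (extChartAt (𝓡 n) p₀).source) (a : 𝔼 n) :
    ContMDiffAt (𝓡 n) (𝓡 n).tangent ∞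
      (fun y => (⟨y, chartVec p₀ y a⟩ : TangentBundle (𝓡 n) M)) q := by
  rw [contMDiffAt_field_iff p₀ hq]
  refine contMDiffAt_const (c := a) |>.congr_of_eventuallyEq ?_
  filter_upwards [(isOpen_extChartAt_source p₀).mem_nhds hq] with y hy
  exact mvfderiv_chartVec hy a

/-- The expression of the metric in the chart at `p₀`. -/
def chartMetric (g : LorentzMetric n M) (p₀ : M) (y : 𝔼 n) : (𝔼 n) →L[ℝ] (𝔼 n) →L[ℝ] ℝ :=
  let q := (extChartAt (𝓡 n) p₀).symm y
  let A : (𝔼 n) →L[ℝ] (𝔼 n) →L[ℝ] ℝ := g.val q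
  let L : (𝔼 n) →L[ℝ] (𝔼 n) := chartVec p₀ q
  A.bilinearComp L L

variable (g : LorentzMetric n M) {p₀ q : M}

theorem chartMetric_apply (y a b : 𝔼 n) : chartMetric g p₀ y a b =
    g.val ((extChartAt (𝓡 n) p₀).symm y) (chartVec p₀ _ a) (chartVec p₀ _ b) := rfl

theorem chartMetric_mvfderiv (hq : q ∈ (extChartAt (𝓡 n) p₀).source) (u w : TangentSpace (𝓡 n) q) :
    chartMetric g p₀ (extChartAt (𝓡 n) p₀ q) (mvfderiv (𝓡 n) (extChartAt (𝓡 n) p₀) q u)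
      (mvfderiv (𝓡 n) (extChartAt (𝓡 n) p₀) q w) = g.val q u w := by
  rw [chartMetric_apply, (extChartAt (𝓡 n) p₀).left_inv hq, chartVec_mvfderiv hq,
    chartVec_mvfderiv hq]

theorem chartMetric_symm (y a b : 𝔼 n) : chartMetric g p₀ y a b = chartMetric g p₀ y b a :=
  g.symm _ _ _

theorem chartMetric_nondegenerate {y : 𝔼 n} (hy : y ∈ (extChartAt (𝓡 n) p₀).target) (a : 𝔼 n)
    (ha : ∀ b, chartMetric g p₀ y a b = 0) : a = 0 := by
  have hq := (extChartAt (𝓡 n) p₀).map_target hy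
  rw [← mvfderiv_chartVec hq a]
  have : chartVec p₀ ((extChartAt (𝓡 n) p₀).symm y) a = 0 := by
    refine g.nondegenerate _ _ fun w => ?_
    rw [← chartVec_mvfderiv hq w]
    exact ha _
  rw [this, map_zero]

/-- In finite dimension a form-valued map is smooth once its values on fixed vectors are. These
values are scalar products of smooth fields that are constant in the chart. -/
theorem contDiffAt_chartMetric {y : 𝔼 n} (hy : y ∈ (extChartAt (𝓡 n) p₀).target) :
    ContDiffAt ℝ ∞ (chartMetric g p₀) y := by
  have hq := (extChartAt (𝓡 n) p₀).map_target hy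
  suffices h : ContDiffOn ℝ ∞ (chartMetric g p₀) (extChartAt (𝓡 n) p₀).target from
    h.contDiffAt ((isOpen_extChartAt_target p₀).mem_nhds hy)
  rw [contDiffOn_clm_apply]
  intro a
  rw [contDiffOn_clm_apply]
  intro b
  rw [← contMDiffOn_iff_contDiffOn]
  have h1 : ContMDiffOn (𝓡 n) 𝓘(ℝ, ℝ) ∞ (fun q => g.val q (chartVec p₀ q a) (chartVec p₀ q b))
      (extChartAt (𝓡 n) p₀).source := by
    intro q hq
    have : ContMDiffAt (𝓡 n) ((𝓡 n).prod 𝓘(ℝ)) ∞ (fun q : M =>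
        TotalSpace.mk' ℝ (E := Bundle.Trivial M ℝ) q (g.val q (chartVec p₀ q a) (chartVec p₀ q b)))
        q := by
      apply ContMDiffAt.clm_bundle_apply₂ (F₁ := 𝔼 n) (F₂ := 𝔼 n)
      · exact g.smooth q
      · exact contMDiffAt_chartVec hq a
      · exact contMDiffAt_chartVec hq b
    simp only [contMDiffAt_totalSpace] at this
    exact this.2.contMDiffWithinAt
  exact h1.comp (contMDiffOn_extChartAt_symm p₀) fun z hz => (extChartAt (𝓡 n) p₀).map_target hz

end Chart

/-! ### Connection and curvature of the base in a chart -/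

section ChartConnection

variable {n : ℕ} {M : Type*} [TopologicalSpace M] [ChartedSpace (EuclideanSpace ℝ (Fin n)) M]
  [IsManifold (𝓡 n) ∞ M]

local notation "𝔼" n => EuclideanSpace ℝ (Fin n)

variable (g : LorentzMetric n M) {p₀ q : M} {X Y : ∀ q : M, TangentSpace (𝓡 n) q}

/-- The Christoffel symbols of the metric in the chart at `p₀`. -/
abbrev chartChristoffel (p₀ : M) : (𝔼 n) → (𝔼 n) →L[ℝ] (𝔼 n) →L[ℝ] (𝔼 n) :=
  christoffel (chartMetric g p₀)

theorem contDiffAt_chartChristoffel {y : 𝔼 n} (hy : y ∈ (extChartAt (𝓡 n) p₀).target) :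
    ContDiffAt ℝ ∞ (chartChristoffel g p₀) y :=
  contDiffAt_christoffel (contDiffAt_chartMetric g hy) (chartMetric_nondegenerate g hy)

theorem contMDiffAt_extChartAt_of_mem (hq : q ∈ (extChartAt (𝓡 n) p₀).source) :
    ContMDiffAt (𝓡 n) 𝓘(ℝ, 𝔼 n) ∞ (extChartAt (𝓡 n) p₀) q :=
  contMDiffAt_extChartAt' (by rwa [← extChartAt_source (𝓡 n)])

/-- The covariant derivative in the chart at `p₀`. -/
theorem mvfderiv_leviCivita (hq : q ∈ (extChartAt (𝓡 n) p₀).source)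
    (hX : MDifferentiableAt (𝓡 n) (𝓡 n).tangent (fun y => (⟨y, X y⟩ : TangentBundle (𝓡 n) M)) q)
    (hY : MDifferentiableAt (𝓡 n) (𝓡 n).tangent (fun y => (⟨y, Y y⟩ : TangentBundle (𝓡 n) M)) q) :
    mvfderiv (𝓡 n) (extChartAt (𝓡 n) p₀) q (leviCivita g.form X Y q) =
      mvfderiv (𝓡 n) (fun y => mvfderiv (𝓡 n) (extChartAt (𝓡 n) p₀) y (Y y)) q (X q)
      + chartChristoffel g p₀ (extChartAt (𝓡 n) p₀ q)
        (mvfderiv (𝓡 n) (extChartAt (𝓡 n) p₀) q (X q))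
        (mvfderiv (𝓡 n) (extChartAt (𝓡 n) p₀) q (Y q)) := by
  have hy := (extChartAt (𝓡 n) p₀).map_source hq
  have hΦ := contMDiffAt_extChartAt_of_mem hq
  have hS : DifferentiableAt ℝ (chartMetric g p₀) (extChartAt (𝓡 n) p₀ q) :=
    (contDiffAt_chartMetric g hy).differentiableAt (by simp)
  have hsymm := chartMetric_symm g (p₀ := p₀) (extChartAt (𝓡 n) p₀ q)
  have hg : ∀ᶠ y in 𝓝 q, ∀ u w : TangentSpace (𝓡 n) y, g.form y u w =
      chartMetric g p₀ (extChartAt (𝓡 n) p₀ y) (mvfderiv (𝓡 n) (extChartAt (𝓡 n) p₀) y u)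
        (mvfderiv (𝓡 n) (extChartAt (𝓡 n) p₀) y w) := by
    filter_upwards [(isOpen_extChartAt_source p₀).mem_nhds hq] with y hy u w
    exact (chartMetric_mvfderiv g hy u w).symm
  -- The vector identity is tested against every b: the Koszul expression in the chart and the
  -- defining relation of the Christoffel symbols share the same derivatives of the metric.
  rw [← sub_eq_zero]
  refine chartMetric_nondegenerate g hy _ fun b => ?_
  have hZ := FiberBundle.mdifferentiableAt_extend (𝓡 n) (𝔼 n) (V := TangentSpace (𝓡 n))
    (chartVec p₀ q b)
  have h1 := two_mul_leviCivita hΦ hS hsymm hg (g.nondegenerate q) hX hY hZ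
  rw [koszul_eq_of_pullback hΦ hS hsymm hg hX hY hZ, hg.self_of_nhds,
    FiberBundle.extend_apply_self, mvfderiv_chartVec hq] at h1
  have h2 := two_mul_christoffel (chartMetric_nondegenerate g hy)
    (mvfderiv (𝓡 n) (extChartAt (𝓡 n) p₀) q (X q))
    (mvfderiv (𝓡 n) (extChartAt (𝓡 n) p₀) q (Y q)) b
  rw [map_sub, map_add, sub_apply, add_apply]
  linarith

/-- The extension is constant in the trivialization at p. Having this on the whole chart domain, and
not only at p, allows it to be differentiated. -/
theorem mvfderiv_extend (p : M) (hq : q ∈ (extChartAt (𝓡 n) p).source) (z : TangentSpace (𝓡 n) p) :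
    mvfderiv (𝓡 n) (extChartAt (𝓡 n) p) q (FiberBundle.extend (𝔼 n) z q) =
      mvfderiv (𝓡 n) (extChartAt (𝓡 n) p) p z := by
  have h1 : FiberBundle.extend (𝔼 n) z q =
      chartVec p q (mvfderiv (𝓡 n) (extChartAt (𝓡 n) p) p z) := by
    rw [mvfderiv_extChartAt_eq (mem_extChartAt_source p), Trivialization.continuousLinearMapAt_apply,
      Trivialization.coe_linearMapAt_of_mem _ (by simp), chartVec, Trivialization.symmL_apply]
    · rfl
    · simpa using hq
  rw [h1, mvfderiv_chartVec hq]

theorem mdifferentiableAt_extend_of_mem (p : M) (hq : q ∈ (extChartAt (𝓡 n) p).source)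
    (z : TangentSpace (𝓡 n) p) : MDifferentiableAt (𝓡 n) (𝓡 n).tangent
      (fun y => (⟨y, FiberBundle.extend (𝔼 n) z y⟩ : TangentBundle (𝓡 n) M)) q := by
  rw [mdifferentiableAt_field_iff p hq]
  refine (mdifferentiableAt_const (c := mvfderiv (𝓡 n) (extChartAt (𝓡 n) p) p z)).congr_of_eventuallyEq ?_
  filter_upwards [(isOpen_extChartAt_source p).mem_nhds hq] with y hy
  exact mvfderiv_extend p hy z

theorem mvfderiv_mvfderiv_extend (p : M) (hq : q ∈ (extChartAt (𝓡 n) p).source)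
    (z : TangentSpace (𝓡 n) p) (ξ : TangentSpace (𝓡 n) q) :
    mvfderiv (𝓡 n) (fun y => mvfderiv (𝓡 n) (extChartAt (𝓡 n) p) y (FiberBundle.extend (𝔼 n) z y)) q ξ
      = 0 := by
  have : (fun y => mvfderiv (𝓡 n) (extChartAt (𝓡 n) p) y (FiberBundle.extend (𝔼 n) z y)) =ᶠ[𝓝 q]
      fun _ => mvfderiv (𝓡 n) (extChartAt (𝓡 n) p) p z := by
    filter_upwards [(isOpen_extChartAt_source p).mem_nhds hq] with y hy
    exact mvfderiv_extend p hy z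
  rw [mvfderiv_congr this, mvfderiv_const, zero_apply]

/-- The covariant derivative of constant fields in a chart is given by the Christoffel symbols. -/
theorem mvfderiv_leviCivita_extend (p : M) (hq : q ∈ (extChartAt (𝓡 n) p).source)
    (y z : TangentSpace (𝓡 n) p) : mvfderiv (𝓡 n) (extChartAt (𝓡 n) p) q
        (leviCivita g.form (FiberBundle.extend (𝔼 n) y) (FiberBundle.extend (𝔼 n) z) q) =
      chartChristoffel g p (extChartAt (𝓡 n) p q)
        (mvfderiv (𝓡 n) (extChartAt (𝓡 n) p) p y) (mvfderiv (𝓡 n) (extChartAt (𝓡 n) p) p z) := by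
  rw [mvfderiv_leviCivita g hq (mdifferentiableAt_extend_of_mem p hq y)
    (mdifferentiableAt_extend_of_mem p hq z), mvfderiv_mvfderiv_extend p hq, mvfderiv_extend p hq,
    mvfderiv_extend p hq, zero_add]

/-- The inner covariant derivative has components Γ(y, z) near p with y and z constant, so the outer
one differentiates Γ and adds a quadratic term. -/
theorem mvfderiv_leviCivita_leviCivita_extend (p : M) (x y z : TangentSpace (𝓡 n) p) :
    mvfderiv (𝓡 n) (extChartAt (𝓡 n) p) p
      (leviCivita g.form (FiberBundle.extend (𝔼 n) x)
        (leviCivita g.form (FiberBundle.extend (𝔼 n) y) (FiberBundle.extend (𝔼 n) z)) p) =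
      fderiv ℝ (chartChristoffel g p) (extChartAt (𝓡 n) p p)
        (mvfderiv (𝓡 n) (extChartAt (𝓡 n) p) p x) (mvfderiv (𝓡 n) (extChartAt (𝓡 n) p) p y)
        (mvfderiv (𝓡 n) (extChartAt (𝓡 n) p) p z)
      + chartChristoffel g p (extChartAt (𝓡 n) p p) (mvfderiv (𝓡 n) (extChartAt (𝓡 n) p) p x)
        (chartChristoffel g p (extChartAt (𝓡 n) p p) (mvfderiv (𝓡 n) (extChartAt (𝓡 n) p) p y)
          (mvfderiv (𝓡 n) (extChartAt (𝓡 n) p) p z)) := by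
  have hp := mem_extChartAt_source (I := 𝓡 n) p
  set φ := extChartAt (𝓡 n) p
  set V := leviCivita g.form (FiberBundle.extend (𝔼 n) y) (FiberBundle.extend (𝔼 n) z) with hV
  set a := mvfderiv (𝓡 n) φ p y
  set b := mvfderiv (𝓡 n) φ p z
  have hev : (fun q => mvfderiv (𝓡 n) φ q (V q)) =ᶠ[𝓝 p] fun q =>
      (fun w => chartChristoffel g p w a b) (φ q) := by
    filter_upwards [(isOpen_extChartAt_source p).mem_nhds hp] with q hq
    exact mvfderiv_leviCivita_extend g p hq y z
  have hΓ : DifferentiableAt ℝ (chartChristoffel g p) (φ p) :=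
    (contDiffAt_chartChristoffel g (mem_extChartAt_target p)).differentiableAt (by simp)
  have hd : DifferentiableAt ℝ (fun w => chartChristoffel g p w a b) (φ p) :=
    (hΓ.clm_apply (differentiableAt_const a)).clm_apply (differentiableAt_const b)
  have hφ : MDifferentiableAt (𝓡 n) 𝓘(ℝ, 𝔼 n) φ p :=
    (contMDiffAt_extChartAt_of_mem hp).mdifferentiableAt (by simp)
  have hVd : MDifferentiableAt (𝓡 n) (𝓡 n).tangent
      (fun q => (⟨q, V q⟩ : TangentBundle (𝓡 n) M)) p := by
    rw [mdifferentiableAt_field_iff p hp]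
    exact (mdifferentiableAt_fderiv_comp hd hφ).congr_of_eventuallyEq hev
  rw [mvfderiv_leviCivita g hp (mdifferentiableAt_extend_of_mem p hp x) hVd, mvfderiv_congr hev,
    mvfderiv_fderiv_comp hd hφ, hV, mvfderiv_leviCivita_extend g p hp,
    FiberBundle.extend_apply_self,
    fderiv_clm_apply (hΓ.clm_apply (differentiableAt_const a)) (differentiableAt_const b),
    fderiv_clm_apply hΓ (differentiableAt_const a)]
  simp
  rfl

/-- The curvature tensor in the chart at the base point. -/
theorem mvfderiv_curvature (p : M) (x y z : TangentSpace (𝓡 n) p) :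
    mvfderiv (𝓡 n) (extChartAt (𝓡 n) p) p (curvature g.form p x y z) =
      chartCurvature (chartChristoffel g p) (extChartAt (𝓡 n) p p)
        (mvfderiv (𝓡 n) (extChartAt (𝓡 n) p) p x) (mvfderiv (𝓡 n) (extChartAt (𝓡 n) p) p y)
        (mvfderiv (𝓡 n) (extChartAt (𝓡 n) p) p z) := by
  have hp := mem_extChartAt_source (I := 𝓡 n) p
  set W := mlieBracket (𝓡 n) (FiberBundle.extend (𝔼 n) x) (FiberBundle.extend (𝔼 n) y) with hW
  -- Fields with constant components commute. The bracket must vanish near p, not just at p, to be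
  -- known differentiable, after which the last term of the curvature is zero.
  have hWz : ∀ q ∈ (extChartAt (𝓡 n) p).source, mvfderiv (𝓡 n) (extChartAt (𝓡 n) p) q (W q) = 0 := by
    intro q hq
    rw [hW, mvfderiv_mlieBracket (contMDiffAt_extChartAt_of_mem hq)
      (mdifferentiableAt_extend_of_mem p hq x) (mdifferentiableAt_extend_of_mem p hq y),
      mvfderiv_mvfderiv_extend p hq, mvfderiv_mvfderiv_extend p hq, sub_zero]
  have hWd : MDifferentiableAt (𝓡 n) (𝓡 n).tangent
      (fun q => (⟨q, W q⟩ : TangentBundle (𝓡 n) M)) p := by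
    rw [mdifferentiableAt_field_iff p hp]
    refine (mdifferentiableAt_const (c := (0 : 𝔼 n))).congr_of_eventuallyEq ?_
    filter_upwards [(isOpen_extChartAt_source p).mem_nhds hp] with q hq using hWz q hq
  have hWp : W p = 0 := by
    rw [← chartVec_mvfderiv hp (W p), hWz p hp, map_zero]
  have h3 : mvfderiv (𝓡 n) (extChartAt (𝓡 n) p) p
      (leviCivita g.form W (FiberBundle.extend (𝔼 n) z) p) = 0 := by
    rw [mvfderiv_leviCivita g hp hWd (mdifferentiableAt_extend_of_mem p hp z), hWp]
    simp
  rw [curvature, curvatureField, map_sub, map_sub, h3, mvfderiv_leviCivita_leviCivita_extend,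
    mvfderiv_leviCivita_leviCivita_extend, chartCurvature]
  abel

end ChartConnection

/-! ### The Sasaki metric on a vector space with given metric and Christoffel symbols -/

section SasakiForm

variable {E F V W U : Type*} [NormedAddCommGroup E] [NormedSpace ℝ E] [NormedAddCommGroup F]
  [NormedSpace ℝ F] [NormedAddCommGroup V] [NormedSpace ℝ V] [NormedAddCommGroup W]
  [NormedSpace ℝ W] [NormedAddCommGroup U] [NormedSpace ℝ U]

/-- The pullback of a bilinear map by two linear maps. -/
def pullForm (B : V →L[ℝ] W →L[ℝ] ℝ) (L : E →L[ℝ] V) (L' : F →L[ℝ] W) : E →L[ℝ] F →L[ℝ] ℝ :=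
  ((B ∘L L).flip ∘L L').flip

theorem _root_.ContDiffAt.pullForm {B : U → V →L[ℝ] W →L[ℝ] ℝ} {L : U → E →L[ℝ] V}
    {L' : U → F →L[ℝ] W} {u : U} {m : WithTop ℕ∞} (hB : ContDiffAt ℝ m B u)
    (hL : ContDiffAt ℝ m L u) (hL' : ContDiffAt ℝ m L' u) :
    ContDiffAt ℝ m (fun z => NullCong.pullForm (B z) (L z) (L' z)) u := by
  have h1 := (hB.clm_comp hL).clm_flip
  exact (h1.clm_comp hL').clm_flip

/-- The vertical component of a vector tangent to the tangent bundle, in terms of the Christoffel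
symbols `Γ`. -/
def vertComp (Γ : E → E →L[ℝ] E →L[ℝ] E) (z : E × E) : E × E →L[ℝ] E :=
  ContinuousLinearMap.snd ℝ E E + (Γ z.1).flip z.2 ∘L ContinuousLinearMap.fst ℝ E E

theorem vertComp_apply (Γ : E → E →L[ℝ] E →L[ℝ] E) (z a : E × E) :
    vertComp Γ z a = a.2 + Γ z.1 a.1 z.2 := rfl

/-- The Sasaki metric in terms of the metric `G` and the Christoffel symbols `Γ`. -/
def sasakiForm (G : E → E →L[ℝ] E →L[ℝ] ℝ) (Γ : E → E →L[ℝ] E →L[ℝ] E) (z : E × E) :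
    E × E →L[ℝ] E × E →L[ℝ] ℝ :=
  pullForm (G z.1) (ContinuousLinearMap.fst ℝ E E) (ContinuousLinearMap.fst ℝ E E)
    + pullForm (G z.1) (vertComp Γ z) (vertComp Γ z)

theorem sasakiForm_apply (G : E → E →L[ℝ] E →L[ℝ] ℝ) (Γ : E → E →L[ℝ] E →L[ℝ] E) (z a b : E × E) :
    sasakiForm G Γ z a b = G z.1 a.1 b.1 + G z.1 (vertComp Γ z a) (vertComp Γ z b) := rfl

theorem contDiffAt_sasakiForm {G : E → E →L[ℝ] E →L[ℝ] ℝ} {Γ : E → E →L[ℝ] E →L[ℝ] E} {z : E × E}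
    {m : WithTop ℕ∞} (hG : ContDiffAt ℝ m G z.1) (hΓ : ContDiffAt ℝ m Γ z.1) :
    ContDiffAt ℝ m (sasakiForm G Γ) z := by
  have h1 : ContDiffAt ℝ m (fun z : E × E => G z.1) z := hG.comp z contDiffAt_fst
  have h2 : ContDiffAt ℝ m (fun z : E × E => Γ z.1) z := hΓ.comp z contDiffAt_fst
  have h3 : ContDiffAt ℝ m (vertComp Γ) z :=
    contDiffAt_const.add ((h2.clm_flip.clm_apply contDiffAt_snd).clm_comp contDiffAt_const)
  exact (h1.pullForm contDiffAt_const contDiffAt_const).add (h1.pullForm h3 h3)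

end SasakiForm

/-! ### The tangent bundle, its connector and its Sasaki metric in a chart -/

section ChartSasaki

variable {n : ℕ} {M : Type*} [TopologicalSpace M] [ChartedSpace (EuclideanSpace ℝ (Fin n)) M]
  [IsManifold (𝓡 n) ∞ M]

local notation "𝔼" n => EuclideanSpace ℝ (Fin n)

variable (g : LorentzMetric n M) {p₀ : M} {v : TangentBundle (𝓡 n) M}

/-- The fibre coordinate of the chart of `TM` induced by the chart at `p₀`. -/
def fibreCoord (p₀ : M) (v : TangentBundle (𝓡 n) M) : 𝔼 n :=
  mvfderiv (𝓡 n) (extChartAt (𝓡 n) p₀) v.proj v.2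

/-- The chart of `TM` induced by the chart at `p₀`. -/
def tmChart (p₀ : M) (v : TangentBundle (𝓡 n) M) : (𝔼 n) × (𝔼 n) :=
  (extChartAt (𝓡 n) p₀ v.proj, fibreCoord p₀ v)

theorem fibreCoord_eq (hv : v.proj ∈ (extChartAt (𝓡 n) p₀).source) : fibreCoord p₀ v =
    (trivializationAt (𝔼 n) (TangentSpace (𝓡 n)) p₀ v).2 := by
  rw [fibreCoord, mvfderiv_extChartAt_eq hv, Trivialization.continuousLinearMapAt_apply,
    Trivialization.coe_linearMapAt_of_mem _ (by simpa using hv)]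

theorem eventually_proj_mem (hv : v.proj ∈ (extChartAt (𝓡 n) p₀).source) :
    ∀ᶠ w : TangentBundle (𝓡 n) M in 𝓝 v, w.proj ∈ (extChartAt (𝓡 n) p₀).source :=
  (FiberBundle.continuous_proj (𝔼 n) (TangentSpace (𝓡 n))).continuousAt.eventually
    ((isOpen_extChartAt_source p₀).mem_nhds hv)

/-- Identifies the explicit coordinates with the chart of the bundle manifold TM, from which they
inherit smoothness and an injective derivative. -/
theorem tmChart_eq (hv : v.proj ∈ (extChartAt (𝓡 n) p₀).source) :
    tmChart p₀ v = extChartAt (𝓡 n).tangent (⟨p₀, 0⟩ : TangentBundle (𝓡 n) M) v := by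
  rw [tmChart, fibreCoord_eq hv, ModelWithCorners.tangent, FiberBundle.extChartAt]
  simp only [PartialEquiv.coe_trans, Function.comp_apply, PartialEquiv.prod_coe]
  refine Prod.ext ?_ rfl
  change _ = extChartAt (𝓡 n) p₀ (trivializationAt (𝔼 n) (TangentSpace (𝓡 n)) p₀ v).1
  rw [Trivialization.coe_fst']
  simpa using hv

theorem mem_extChartAt_tangent_source (hv : v.proj ∈ (extChartAt (𝓡 n) p₀).source) :
    v ∈ (extChartAt (𝓡 n).tangent (⟨p₀, 0⟩ : TangentBundle (𝓡 n) M)).source := by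
  rw [extChartAt_source] at hv ⊢
  exact (TangentBundle.mem_chart_source_iff v ⟨p₀, 0⟩).2 hv

theorem eventually_tmChart_eq (hv : v.proj ∈ (extChartAt (𝓡 n) p₀).source) :
    tmChart p₀ =ᶠ[𝓝 v] extChartAt (𝓡 n).tangent (⟨p₀, 0⟩ : TangentBundle (𝓡 n) M) := by
  filter_upwards [eventually_proj_mem hv] with w hw using tmChart_eq hw

theorem contMDiffAt_tmChart (hv : v.proj ∈ (extChartAt (𝓡 n) p₀).source) :
    ContMDiffAt (𝓡 n).tangent 𝓘(ℝ, (𝔼 n) × (𝔼 n)) ∞ (tmChart p₀) v := by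
  refine ContMDiffAt.congr_of_eventuallyEq ?_ (eventually_tmChart_eq hv)
  apply contMDiffAt_extChartAt'
  have := mem_extChartAt_tangent_source hv
  rwa [extChartAt_source] at this

theorem mvfderiv_tmChart_injective (hv : v.proj ∈ (extChartAt (𝓡 n) p₀).source) :
    Function.Injective (mvfderiv (𝓡 n).tangent (tmChart p₀) v) := by
  intro ξ ζ h
  rw [mvfderiv_congr (eventually_tmChart_eq hv), mvfderiv_congr (eventually_tmChart_eq hv)] at h
  exact (isInvertible_mfderiv_extChartAt (mem_extChartAt_tangent_source hv)).bijective.1 h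

theorem mdifferentiableAt_fibreCoord (hv : v.proj ∈ (extChartAt (𝓡 n) p₀).source) :
    MDifferentiableAt (𝓡 n).tangent 𝓘(ℝ, 𝔼 n) (fibreCoord p₀) v :=
  mdifferentiableAt_fderiv_comp (h := Prod.snd) differentiableAt_snd
    ((contMDiffAt_tmChart hv).mdifferentiableAt (by simp))

theorem mvfderiv_extChartAt_proj (hv : v.proj ∈ (extChartAt (𝓡 n) p₀).source)
    (ξ : TangentSpace (𝓡 n).tangent v) :
    mvfderiv (𝓡 n).tangent (fun w : TangentBundle (𝓡 n) M => extChartAt (𝓡 n) p₀ w.proj) v ξ =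
      mvfderiv (𝓡 n) (extChartAt (𝓡 n) p₀) v.proj
        (mfderiv (𝓡 n).tangent (𝓡 n) TotalSpace.proj v ξ) :=
  mfderiv_comp_apply v ((contMDiffAt_extChartAt_of_mem hv).mdifferentiableAt (by simp))
    (mdifferentiableAt_proj (TangentSpace (𝓡 n))) ξ

theorem mvfderiv_tmChart (hv : v.proj ∈ (extChartAt (𝓡 n) p₀).source)
    (ξ : TangentSpace (𝓡 n).tangent v) :
    mvfderiv (𝓡 n).tangent (tmChart p₀) v ξ =
      (mvfderiv (𝓡 n) (extChartAt (𝓡 n) p₀) v.proj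
        (mfderiv (𝓡 n).tangent (𝓡 n) TotalSpace.proj v ξ),
        mvfderiv (𝓡 n).tangent (fibreCoord p₀) v ξ) := by
  rw [← mvfderiv_extChartAt_proj hv]
  refine mvfderiv_prodMk ?_ (mdifferentiableAt_fibreCoord hv) ξ
  exact MDifferentiableAt.comp v ((contMDiffAt_extChartAt_of_mem hv).mdifferentiableAt (by simp))
    (mdifferentiableAt_proj (TangentSpace (𝓡 n)))

/-- The connector in the chart at `p₀`. -/
theorem mvfderiv_connector (hv : v.proj ∈ (extChartAt (𝓡 n) p₀).source)
    (ξ : TangentSpace (𝓡 n).tangent v) :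
    mvfderiv (𝓡 n) (extChartAt (𝓡 n) p₀) v.proj (connector g v ξ) =
      vertComp (chartChristoffel g p₀) (tmChart p₀ v)
        (mvfderiv (𝓡 n).tangent (tmChart p₀) v ξ) := by
  set q := v.proj with hq
  set φ := extChartAt (𝓡 n) p₀ with hφ
  set φ' := extChartAt (𝓡 n) q with hφ'
  have hq' : q ∈ φ'.source := mem_extChartAt_source q
  -- The connector is defined in the chart at the base point q of v, but is wanted in the chart at
  -- p₀. The change of coordinates τ yields the same second-derivative term in the fibre coordinate
  -- (`h1`) and in the field constant in the chart at q (`h2`), which makes the two expressions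
  -- agree.
  set τ : (𝔼 n) → 𝔼 n := φ ∘ φ'.symm with hτ
  have hτd : ContDiffAt ℝ ∞ τ (φ' q) :=
    contDiffAt_comp_extChartAt_symm le_rfl hq' (contMDiffAt_extChartAt_of_mem hv)
  have hτd' : DifferentiableAt ℝ (fderiv ℝ τ) (φ' q) :=
    (hτd.fderiv_right (m := 1) (by norm_cast)).differentiableAt one_ne_zero
  set u := mfderiv (𝓡 n).tangent (𝓡 n) TotalSpace.proj v ξ with hu
  have htrans : ∀ᶠ y in 𝓝 q, ∀ ζ : TangentSpace (𝓡 n) y,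
      mvfderiv (𝓡 n) φ y ζ = fderiv ℝ τ (φ' y) (mvfderiv (𝓡 n) φ' y ζ) :=
    eventually_mvfderiv_eq_fderiv (contMDiffAt_extChartAt_of_mem hv)
  have hfib : (fun w : TangentBundle (𝓡 n) M =>
      (trivializationAt (𝔼 n) (TangentSpace (𝓡 n)) v.proj w).2) =ᶠ[𝓝 v] fibreCoord q := by
    filter_upwards [eventually_proj_mem hq'] with w hw using (fibreCoord_eq hw).symm
  have hφm : MDifferentiableAt (𝓡 n) 𝓘(ℝ, 𝔼 n) φ' q :=
    (contMDiffAt_extChartAt_of_mem hq').mdifferentiableAt (by simp)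
  have hφv : MDifferentiableAt (𝓡 n).tangent 𝓘(ℝ, 𝔼 n)
      (fun w : TangentBundle (𝓡 n) M => φ' w.proj) v :=
    MDifferentiableAt.comp v hφm (mdifferentiableAt_proj (TangentSpace (𝓡 n)))
  have h1 : mvfderiv (𝓡 n).tangent (fibreCoord p₀) v ξ =
      fderiv ℝ (fderiv ℝ τ) (φ' q) (mvfderiv (𝓡 n) φ' q u) (fibreCoord q v)
        + fderiv ℝ τ (φ' q) (mvfderiv (𝓡 n).tangent (fibreCoord q) v ξ) := by
    have hev : fibreCoord p₀ =ᶠ[𝓝 v] fun w => fderiv ℝ τ (φ' w.proj) (fibreCoord q w) := by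
      have hc : ContinuousAt (TotalSpace.proj : TangentBundle (𝓡 n) M → M) v :=
        (FiberBundle.continuous_proj (𝔼 n) (TangentSpace (𝓡 n))).continuousAt
      have := hc.eventually htrans
      filter_upwards [this] with w hw using hw w.2
    have hA : MDifferentiableAt (𝓡 n).tangent 𝓘(ℝ, (𝔼 n) →L[ℝ] 𝔼 n)
        (fun w : TangentBundle (𝓡 n) M => fderiv ℝ τ (φ' w.proj)) v :=
      mdifferentiableAt_fderiv_comp (f := fun w : TangentBundle (𝓡 n) M => φ' w.proj) hτd' hφv
    rw [mvfderiv_congr hev, mvfderiv_clm_apply hA (mdifferentiableAt_fibreCoord hq'),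
      mvfderiv_fderiv_comp (f := fun w : TangentBundle (𝓡 n) M => φ' w.proj) hτd' hφv,
      mvfderiv_extChartAt_proj hq']
  have h2 : mvfderiv (𝓡 n)
      (fun y => mvfderiv (𝓡 n) φ y (FiberBundle.extend (𝔼 n) v.2 y)) q u =
      fderiv ℝ (fderiv ℝ τ) (φ' q) (mvfderiv (𝓡 n) φ' q u) (fibreCoord q v) := by
    have hev : (fun y => mvfderiv (𝓡 n) φ y (FiberBundle.extend (𝔼 n) v.2 y)) =ᶠ[𝓝 q]
        fun y => fderiv ℝ τ (φ' y) (fibreCoord q v) := by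
      filter_upwards [htrans, (isOpen_extChartAt_source q).mem_nhds hq'] with y hy hy'
      rw [hy, mvfderiv_extend q hy']
      rfl
    rw [mvfderiv_congr hev, mvfderiv_clm_apply (mdifferentiableAt_fderiv_comp hτd' hφm)
      mdifferentiableAt_const, mvfderiv_fderiv_comp hτd' hφm, mvfderiv_const]
    simp
  rw [connector, map_add, mvfderiv_congr hfib, mvfderiv_leviCivita g hv
    (FiberBundle.mdifferentiableAt_extend (𝓡 n) (𝔼 n) (V := TangentSpace (𝓡 n)) _)
    (FiberBundle.mdifferentiableAt_extend (𝓡 n) (𝔼 n) (V := TangentSpace (𝓡 n)) _),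
    FiberBundle.extend_apply_self, FiberBundle.extend_apply_self, vertComp_apply,
    mvfderiv_tmChart hv, h1, h2]
  have h3 : mvfderiv (𝓡 n) φ q ((trivializationAt (𝔼 n) (TangentSpace (𝓡 n)) q).symm q
      (mvfderiv (𝓡 n).tangent (fibreCoord q) v ξ)) =
      fderiv ℝ τ (φ' q) (mvfderiv (𝓡 n).tangent (fibreCoord q) v ξ) := by
    rw [htrans.self_of_nhds]
    have := mvfderiv_chartVec hq' (mvfderiv (𝓡 n).tangent (fibreCoord q) v ξ)
    rw [chartVec, Trivialization.symmL_apply _ (by simp)] at this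
    rw [this]
  rw [h3]
  change _ + (_ + _) = _ + _ + _
  rw [← add_assoc, add_comm (fderiv ℝ τ (φ' q) _)]
  rfl

theorem sasaki_eq (hv : v.proj ∈ (extChartAt (𝓡 n) p₀).source)
    (ζ ξ : TangentSpace (𝓡 n).tangent v) :
    sasaki g v ζ ξ = sasakiForm (chartMetric g p₀) (chartChristoffel g p₀) (tmChart p₀ v)
      (mvfderiv (𝓡 n).tangent (tmChart p₀) v ζ) (mvfderiv (𝓡 n).tangent (tmChart p₀) v ξ) := by
  rw [sasakiForm_apply, ← mvfderiv_connector g hv, ← mvfderiv_connector g hv, mvfderiv_tmChart hv,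
    mvfderiv_tmChart hv, sasaki]
  rw [← chartMetric_mvfderiv g hv, ← chartMetric_mvfderiv g hv]
  rfl

theorem mvfderiv_tmChart_vlift (hv : v.proj ∈ (extChartAt (𝓡 n) p₀).source)
    (u : TangentSpace (𝓡 n) v.proj) :
    mvfderiv (𝓡 n).tangent (tmChart p₀) v (vlift v u) =
      (0, mvfderiv (𝓡 n) (extChartAt (𝓡 n) p₀) v.proj u) := by
  let γ : ℝ → TangentBundle (𝓡 n) M := fun t => ⟨v.proj, v.2 + t • u⟩
  have hγ0 : γ 0 = v := by simp only [γ, zero_smul, add_zero]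
  have hγ : MDifferentiableAt 𝓘(ℝ, ℝ) (𝓡 n).tangent γ 0 := by
    rw [mdifferentiableAt_totalSpace]
    refine ⟨mdifferentiableAt_const, ?_⟩
    have he : (fun t => (trivializationAt (𝔼 n) (TangentSpace (𝓡 n)) (γ 0).proj (γ t)).2) =
        fun t => fibreCoord v.proj v + t • mvfderiv (𝓡 n) (extChartAt (𝓡 n) v.proj) v.proj u := by
      funext t
      have := fibreCoord_eq (p₀ := v.proj) (v := γ t) (mem_extChartAt_source v.proj)
      refine this.symm.trans ?_
      rw [fibreCoord, map_add, map_smul]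
      rfl
    rw [he]
    apply DifferentiableAt.mdifferentiableAt
    fun_prop
  have h := mfderiv_comp_apply_of_eq (0 : ℝ)
    ((contMDiffAt_tmChart hv).mdifferentiableAt (by simp)) hγ hγ0 (1 : ℝ)
  refine h.symm.trans ?_
  have he : tmChart p₀ ∘ γ = fun t => (extChartAt (𝓡 n) p₀ v.proj,
      fibreCoord p₀ v + t • mvfderiv (𝓡 n) (extChartAt (𝓡 n) p₀) v.proj u) := by
    funext t
    refine Prod.ext rfl ?_
    change fibreCoord p₀ (γ t) = _
    rw [fibreCoord, map_add, map_smul]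
    rfl
  have hd : HasDerivAt (tmChart p₀ ∘ γ)
      ((0 : 𝔼 n), mvfderiv (𝓡 n) (extChartAt (𝓡 n) p₀) v.proj u) 0 := by
    rw [he]
    apply HasDerivAt.prodMk (hasDerivAt_const _ _)
    simpa using (((hasDerivAt_id (0 : ℝ)).smul_const
      (mvfderiv (𝓡 n) (extChartAt (𝓡 n) p₀) v.proj u)).const_add (fibreCoord p₀ v))
  rw [mfderiv_eq_fderiv, hd.hasFDerivAt.fderiv]
  exact ContinuousLinearMap.toSpanSingleton_apply_one (R₁ := ℝ) (M₁ := (𝔼 n) × (𝔼 n)) _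

end ChartSasaki

/-! ### Linear algebra of a null vector a and a vector k with B a k = -1 -/

section NullPair

variable {E : Type*} [NormedAddCommGroup E] [NormedSpace ℝ E] {B : E →L[ℝ] E →L[ℝ] ℝ} {a k : E}

/-- The projection onto the orthogonal complement of the span of `a` and `k`, where `a` is a null
vector with `B a k = -1`. -/
def nullPairProj (B : E →L[ℝ] E →L[ℝ] ℝ) (a k w : E) : E :=
  w + B w a • k + (B w a * B k k + B w k) • a

/-- For w + s k + t a the products with a and with k are B w a - s and B w k + s B k k - t; setting
both to zero yields the coefficients in `nullPairProj`. -/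
theorem nullPairProj_left (hsymm : ∀ u w, B u w = B w u) (haa : B a a = 0) (hak : B a k = -1)
    (w : E) : B a (nullPairProj B a k w) = 0 := by
  simp only [nullPairProj, map_add, map_smul, smul_eq_mul, haa, hak, hsymm a w]
  ring

theorem nullPairProj_right (hsymm : ∀ u w, B u w = B w u) (hak : B a k = -1)
    (w : E) : B (nullPairProj B a k w) k = 0 := by
  rw [hsymm]
  simp only [nullPairProj, map_add, map_smul, smul_eq_mul, hsymm k a, hak, hsymm k w]
  ring

theorem nullPairProj_eq_self (hsymm : ∀ u w, B u w = B w u) {w : E} (h1 : B a w = 0)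
    (h2 : B w k = 0) : nullPairProj B a k w = w := by
  rw [nullPairProj, hsymm w a, h1, h2]
  simp

/-- Being orthogonal to a and k, the vector u pairs with any w as it does with the projection of w,
so tests against the complement of a and k exhaust all tests. This is the uniqueness principle
behind the later identifications of fibre parts. -/
theorem eq_zero_of_orthogonal (hsymm : ∀ u w, B u w = B w u)
    (hnd : ∀ u, (∀ w, B u w = 0) → u = 0) (haa : B a a = 0) (hak : B a k = -1) {u : E}
    (h1 : B a u = 0) (h2 : B u k = 0) (h : ∀ w, B a w = 0 → B w k = 0 → B u w = 0) : u = 0 := by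
  refine hnd u fun w => ?_
  have := h _ (nullPairProj_left hsymm haa hak w) (nullPairProj_right hsymm hak w)
  simpa only [nullPairProj, map_add, map_smul, smul_eq_mul, hsymm u a, h1, h2, mul_zero,
    add_zero] using this

end NullPair

/-! ### The inclusion of a subset with slice charts is a smooth immersion -/

section Slice

variable {E : Type*} [NormedAddCommGroup E] [NormedSpace ℝ E]
  {H : Type*} [TopologicalSpace H] {I : ModelWithCorners ℝ E H}
  {N : Type*} [TopologicalSpace N] [ChartedSpace H N]
  {B W : Type*} [NormedAddCommGroup B] [NormedSpace ℝ B]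
  [NormedAddCommGroup W] [NormedSpace ℝ W] {S : Set N}

theorem contMDiff_subtype_val_slice
    (h : ∀ x ∈ S, ∃ e : SliceChart I B W S, x ∈ e.toHomeo.source) :
    letI := sliceChartedSpace I B W S h
    ContMDiff 𝓘(ℝ, B) I ∞ (Subtype.val : S → N) := by
  let _ := sliceChartedSpace I B W S h
  have := sliceIsManifold h
  intro x
  set e := (h x.1 x.2).choose with he
  have hx : (x : N) ∈ e.toHomeo.source := (h x.1 x.2).choose_spec
  have h0 : ((e.toHomeo x).1, (0 : W)) = e.toHomeo x :=
    Prod.ext rfl ((e.mem_iff _ hx).1 x.2).symm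
  -- By construction the preferred chart of S at x is the first component of the slice chart e; the
  -- inclusion is then this chart, followed by b ↦ (b, 0) and the inverse of e.
  have h1 : ContMDiffAt 𝓘(ℝ, B) 𝓘(ℝ, B) ∞ (fun y : S => (e.toHomeo y).1) x := by
    have := contMDiffAt_extChartAt (I := 𝓘(ℝ, B)) (n := ∞) (x := x)
    exact this
  have h2 : ContMDiffAt 𝓘(ℝ, B) 𝓘(ℝ, B × W) ∞ (fun y : S => ((e.toHomeo y).1, (0 : W))) x :=
    h1.prodMk_space contMDiffAt_const
  have h3 : ContMDiffAt 𝓘(ℝ, B × W) I ∞ e.toHomeo.symm ((e.toHomeo x).1, (0 : W)) := by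
    apply e.smooth_invFun.contMDiffAt
    rw [h0]
    exact e.toHomeo.open_target.mem_nhds (e.toHomeo.map_source hx)
  have h4 := ContMDiffAt.comp x h3 h2
  refine h4.congr_of_eventuallyEq ?_
  have hnear : ∀ᶠ y : S in 𝓝 x, (y : N) ∈ e.toHomeo.source :=
    continuous_subtype_val.continuousAt.eventually (e.toHomeo.open_source.mem_nhds hx)
  filter_upwards [hnear] with y hy
  have hy0 : ((e.toHomeo y).1, (0 : W)) = e.toHomeo y :=
    Prod.ext rfl ((e.mem_iff _ hy).1 y.2).symm
  change (y : N) = e.toHomeo.symm ((e.toHomeo y).1, (0 : W))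
  rw [hy0, e.toHomeo.left_inv hy]

/-- The first component of the slice chart, composed with the inclusion, is the preferred chart of S
at x; its derivative there is the identity, so it supplies a left inverse. -/
theorem mfderiv_subtype_val_slice_injective
    (h : ∀ x ∈ S, ∃ e : SliceChart I B W S, x ∈ e.toHomeo.source) (x : S) :
    letI := sliceChartedSpace I B W S h
    Function.Injective (mfderiv 𝓘(ℝ, B) I (Subtype.val : S → N) x) := by
  let _ := sliceChartedSpace I B W S h
  have := sliceIsManifold h
  set e := (h x.1 x.2).choose with he
  have hx : (x : N) ∈ e.toHomeo.source := (h x.1 x.2).choose_spec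
  have h1 : MDifferentiableAt I 𝓘(ℝ, B) (fun y : N => (e.toHomeo y).1) x := by
    have : ContMDiffAt I 𝓘(ℝ, B × W) ∞ e.toHomeo x :=
      e.smooth_toFun.contMDiffAt (e.toHomeo.open_source.mem_nhds hx)
    exact mdifferentiableAt_fderiv_comp (h := Prod.fst) differentiableAt_fst
      (this.mdifferentiableAt (by simp))
  have h2 : MDifferentiableAt 𝓘(ℝ, B) I (Subtype.val : S → N) x :=
    (contMDiff_subtype_val_slice h x).mdifferentiableAt (by simp)
  have h3 : ∀ ξ : TangentSpace 𝓘(ℝ, B) x,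
      mfderiv I 𝓘(ℝ, B) (fun y : N => (e.toHomeo y).1) x
        (mfderiv 𝓘(ℝ, B) I (Subtype.val : S → N) x ξ) = ξ := by
    intro ξ
    have h4 := mfderiv_comp_apply x h1 h2 ξ
    refine h4.symm.trans ?_
    exact mvfderiv_extChartAt_self ξ
  exact Function.LeftInverse.injective h3

end Slice

/-! ### The null congruence immersed in coordinates, with base and fibre parts -/

section NullChart

variable {n : ℕ} {M : Type*} [TopologicalSpace M] [ChartedSpace (EuclideanSpace ℝ (Fin n)) M]
  [IsManifold (𝓡 n) ∞ M]

local notation "𝔼" n => EuclideanSpace ℝ (Fin n)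

variable {g : LorentzMetric n M} {K : TimelikeField g} {p₀ : M} {v : nullCongruence g K}

theorem contMDiff_incl (g : LorentzMetric n M) (K : TimelikeField g) :
    ContMDiff (𝓡 (2 * n - 2)) (𝓡 n).tangent ∞ (Subtype.val : nullCongruence g K → _) :=
  contMDiff_subtype_val_slice (nullCongruence_slices g K)

theorem inclDeriv_injective (v : nullCongruence g K) : Function.Injective (inclDeriv g K v) :=
  mfderiv_subtype_val_slice_injective (nullCongruence_slices g K) v

/-- The coordinate expression of a vector field in the chart at `p₀`. -/
def fieldRep (p₀ : M) (X : ∀ q : M, TangentSpace (𝓡 n) q) (y : 𝔼 n) : 𝔼 n :=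
  mvfderiv (𝓡 n) (extChartAt (𝓡 n) p₀) ((extChartAt (𝓡 n) p₀).symm y)
    (X ((extChartAt (𝓡 n) p₀).symm y))

omit [IsManifold (𝓡 n) ∞ M] in
theorem fieldRep_apply {q : M} (hq : q ∈ (extChartAt (𝓡 n) p₀).source)
    (X : ∀ q : M, TangentSpace (𝓡 n) q) : fieldRep p₀ X (extChartAt (𝓡 n) p₀ q) =
      mvfderiv (𝓡 n) (extChartAt (𝓡 n) p₀) q (X q) := by
  rw [fieldRep, (extChartAt (𝓡 n) p₀).left_inv hq]

theorem contDiffAt_fieldRep {X : ∀ q : M, TangentSpace (𝓡 n) q} (hX : IsSmoothField X) {y : 𝔼 n}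
    (hy : y ∈ (extChartAt (𝓡 n) p₀).target) : ContDiffAt ℝ ∞ (fieldRep p₀ X) y := by
  have hq := (extChartAt (𝓡 n) p₀).map_target hy
  have h1 := (contMDiffAt_field_iff p₀ hq).1 (hX _)
  have h2 := contDiffAt_comp_extChartAt_symm le_rfl hq h1
  rwa [(extChartAt (𝓡 n) p₀).right_inv hy] at h2

/-- The coordinate expression of `∇K` at the point with coordinates `y`. -/
def covK (g : LorentzMetric n M) (K : TimelikeField g) (p₀ : M) (y : 𝔼 n) : (𝔼 n) →L[ℝ] 𝔼 n :=
  fderiv ℝ (fieldRep p₀ K.val) y + (chartChristoffel g p₀ y).flip (fieldRep p₀ K.val y)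

/-- The coefficient of the Liouville field in the horizontal lift of a vector. -/
def slope (g : LorentzMetric n M) (K : TimelikeField g) (p₀ : M) (z : (𝔼 n) × (𝔼 n)) :
    (𝔼 n) →L[ℝ] ℝ :=
  chartMetric g p₀ z.1 z.2 ∘L covK g K p₀ z.1

theorem slope_apply (g : LorentzMetric n M) (K : TimelikeField g) (p₀ : M) (z : (𝔼 n) × (𝔼 n))
    (p : 𝔼 n) : slope g K p₀ z p = chartMetric g p₀ z.1 z.2 (fderiv ℝ (fieldRep p₀ K.val) z.1 p
      + chartChristoffel g p₀ z.1 p (fieldRep p₀ K.val z.1)) := rfl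

theorem contDiffAt_slope (g : LorentzMetric n M) (K : TimelikeField g) {p₀ : M}
    {z : (𝔼 n) × (𝔼 n)} (hz : z.1 ∈ (extChartAt (𝓡 n) p₀).target) :
    ContDiffAt ℝ ∞ (slope g K p₀) z := by
  have hk := contDiffAt_fieldRep K.smooth hz
  have hc : ContDiffAt ℝ ∞ (covK g K p₀) z.1 :=
    (hk.fderiv_right (m := ∞) (by norm_cast)).add
      ((contDiffAt_chartChristoffel g hz).clm_flip.clm_apply hk)
  exact (((contDiffAt_chartMetric g hz).comp z contDiffAt_fst).clm_apply contDiffAt_snd).clm_comp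
    (hc.comp z contDiffAt_fst)

/-- The coordinates on the null congruence induced by the chart of `M` at `p₀`. -/
def nullChart (p₀ : M) (v : nullCongruence g K) : (𝔼 n) × (𝔼 n) := tmChart p₀ v.1

theorem contMDiffAt_nullChart (hv : v.1.proj ∈ (extChartAt (𝓡 n) p₀).source) :
    ContMDiffAt (𝓡 (2 * n - 2)) 𝓘(ℝ, (𝔼 n) × (𝔼 n)) ∞ (nullChart p₀) v :=
  (contMDiffAt_tmChart hv).comp v (contMDiff_incl g K v)

theorem mvfderiv_nullChart (hv : v.1.proj ∈ (extChartAt (𝓡 n) p₀).source)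
    (ξ : TangentSpace (𝓡 (2 * n - 2)) v) : mvfderiv (𝓡 (2 * n - 2)) (nullChart p₀) v ξ =
      mvfderiv (𝓡 n).tangent (tmChart p₀) v.1 (inclDeriv g K v ξ) :=
  mfderiv_comp_apply v ((contMDiffAt_tmChart hv).mdifferentiableAt (by simp))
    ((contMDiff_incl g K v).mdifferentiableAt (by simp)) ξ

/-- The target has dimension 2n while the congruence has dimension 2n - 2, so injectivity is all
that is available; it lets tangent vectors and fields be recovered from their coordinates. -/
theorem mvfderiv_nullChart_injective (hv : v.1.proj ∈ (extChartAt (𝓡 n) p₀).source) :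
    Function.Injective (mvfderiv (𝓡 (2 * n - 2)) (nullChart (g := g) (K := K) p₀) v) := by
  intro ξ ζ h
  rw [mvfderiv_nullChart hv, mvfderiv_nullChart hv] at h
  exact inclDeriv_injective v (mvfderiv_tmChart_injective hv h)

theorem eventually_null_proj_mem (hv : v.1.proj ∈ (extChartAt (𝓡 n) p₀).source) :
    ∀ᶠ w : nullCongruence g K in 𝓝 v, w.1.proj ∈ (extChartAt (𝓡 n) p₀).source :=
  continuous_subtype_val.continuousAt.eventually (eventually_proj_mem hv)

theorem nullChart_mem_target (hv : v.1.proj ∈ (extChartAt (𝓡 n) p₀).source) :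
    (nullChart p₀ v).1 ∈ (extChartAt (𝓡 n) p₀).target :=
  (extChartAt (𝓡 n) p₀).map_source hv

theorem chartMetric_null (hv : v.1.proj ∈ (extChartAt (𝓡 n) p₀).source) :
    chartMetric g p₀ (nullChart p₀ v).1 (nullChart p₀ v).2 (nullChart p₀ v).2 = 0 :=
  (chartMetric_mvfderiv g hv _ _).trans v.2.1

theorem chartMetric_null_K (hv : v.1.proj ∈ (extChartAt (𝓡 n) p₀).source) :
    chartMetric g p₀ (nullChart p₀ v).1 (nullChart p₀ v).2
      (fieldRep p₀ K.val (nullChart p₀ v).1) = -1 := by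
  change chartMetric g p₀ (extChartAt (𝓡 n) p₀ v.1.proj) _
    (fieldRep p₀ K.val (extChartAt (𝓡 n) p₀ v.1.proj)) = -1
  rw [fieldRep_apply hv]
  exact (chartMetric_mvfderiv g hv _ _).trans v.2.2

/-- The base component of a vector tangent to the null congruence. -/
def basePart (p₀ : M) (v : nullCongruence g K) (ξ : TangentSpace (𝓡 (2 * n - 2)) v) : 𝔼 n :=
  (mvfderiv (𝓡 (2 * n - 2)) (nullChart p₀) v ξ).1

/-- The fibre component, with respect to the connection, of a vector tangent to the null
congruence. -/
def fibrePart (p₀ : M) (v : nullCongruence g K) (ξ : TangentSpace (𝓡 (2 * n - 2)) v) : 𝔼 n :=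
  vertComp (chartChristoffel g p₀) (nullChart p₀ v) (mvfderiv (𝓡 (2 * n - 2)) (nullChart p₀) v ξ)

theorem inducedMetric_eq (hv : v.1.proj ∈ (extChartAt (𝓡 n) p₀).source)
    (ζ ξ : TangentSpace (𝓡 (2 * n - 2)) v) : inducedMetric g K v ζ ξ =
      sasakiForm (chartMetric g p₀) (chartChristoffel g p₀) (nullChart p₀ v)
        (mvfderiv (𝓡 (2 * n - 2)) (nullChart p₀) v ζ)
        (mvfderiv (𝓡 (2 * n - 2)) (nullChart p₀) v ξ) := by
  rw [mvfderiv_nullChart hv, mvfderiv_nullChart hv]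
  exact sasaki_eq g hv _ _

theorem inducedMetric_eq_parts (hv : v.1.proj ∈ (extChartAt (𝓡 n) p₀).source)
    (ζ ξ : TangentSpace (𝓡 (2 * n - 2)) v) : inducedMetric g K v ζ ξ =
      chartMetric g p₀ (nullChart p₀ v).1 (basePart p₀ v ζ) (basePart p₀ v ξ)
        + chartMetric g p₀ (nullChart p₀ v).1 (fibrePart p₀ v ζ) (fibrePart p₀ v ξ) :=
  inducedMetric_eq hv ζ ξ

theorem ext_parts (hv : v.1.proj ∈ (extChartAt (𝓡 n) p₀).source)
    {ζ ξ : TangentSpace (𝓡 (2 * n - 2)) v} (h1 : basePart p₀ v ζ = basePart p₀ v ξ)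
    (h2 : fibrePart p₀ v ζ = fibrePart p₀ v ξ) : ζ = ξ := by
  refine mvfderiv_nullChart_injective hv (Prod.ext h1 ?_)
  rw [fibrePart, fibrePart, vertComp_apply, vertComp_apply] at h2
  rw [basePart, basePart] at h1
  rw [h1] at h2
  exact add_right_cancel h2

theorem mvfderiv_nullChart_fst (hv : v.1.proj ∈ (extChartAt (𝓡 n) p₀).source)
    (ξ : TangentSpace (𝓡 (2 * n - 2)) v) :
    mvfderiv (𝓡 (2 * n - 2)) (fun w : nullCongruence g K => (nullChart p₀ w).1) v ξ =
      basePart p₀ v ξ := by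
  have := mvfderiv_fderiv_comp (h := (Prod.fst : (𝔼 n) × (𝔼 n) → 𝔼 n)) differentiableAt_fst
    ((contMDiffAt_nullChart hv).mdifferentiableAt (by simp)) ξ
  rw [fderiv_fst] at this
  exact this

theorem basePart_eq (hv : v.1.proj ∈ (extChartAt (𝓡 n) p₀).source)
    (ξ : TangentSpace (𝓡 (2 * n - 2)) v) : basePart p₀ v ξ =
      mvfderiv (𝓡 n) (extChartAt (𝓡 n) p₀) v.1.proj
        (mfderiv (𝓡 (2 * n - 2)) (𝓡 n) (nullProj g K) v ξ) := by
  rw [basePart, mvfderiv_nullChart hv, mvfderiv_tmChart hv]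
  exact congrArg _ (mfderiv_comp_apply v (mdifferentiableAt_proj (TangentSpace (𝓡 n)))
    ((contMDiff_incl g K v).mdifferentiableAt (by simp)) ξ).symm

theorem isVertical_iff (hv : v.1.proj ∈ (extChartAt (𝓡 n) p₀).source)
    (ξ : TangentSpace (𝓡 (2 * n - 2)) v) :
    IsVertical (𝓡 n) (nullProj g K) v ξ ↔ basePart p₀ v ξ = 0 := by
  rw [basePart_eq hv, IsVertical]
  constructor
  · intro h
    exact (congrArg (mvfderiv (𝓡 n) (extChartAt (𝓡 n) p₀) v.1.proj) h).trans (map_zero _)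
  · intro h
    rw [← chartVec_mvfderiv hv (mfderiv (𝓡 (2 * n - 2)) (𝓡 n) (nullProj g K) v ξ)]
    exact (congrArg _ h).trans (map_zero _)

end NullChart

/-! ### Tangent, vertical and horizontal vectors of the null congruence -/

section NullTangent

variable {n : ℕ} {M : Type*} [TopologicalSpace M] [ChartedSpace (EuclideanSpace ℝ (Fin n)) M]
  [IsManifold (𝓡 n) ∞ M]

local notation "𝔼" n => EuclideanSpace ℝ (Fin n)

variable {g : LorentzMetric n M} {K : TimelikeField g} {p₀ : M} {v : nullCongruence g K}

/-- The derivative of a scalar product of two vector fields along a map to `M`, in a chart. -/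
theorem mvfderiv_chartMetric_apply {E : Type*} [NormedAddCommGroup E] [NormedSpace ℝ E]
    {H : Type*} [TopologicalSpace H] {I : ModelWithCorners ℝ E H} {N : Type*} [TopologicalSpace N]
    [ChartedSpace H N] {x : N} {y s t : N → 𝔼 n} (hyt : y x ∈ (extChartAt (𝓡 n) p₀).target)
    (hy : MDifferentiableAt I 𝓘(ℝ, 𝔼 n) y x) (hs : MDifferentiableAt I 𝓘(ℝ, 𝔼 n) s x)
    (ht : MDifferentiableAt I 𝓘(ℝ, 𝔼 n) t x) (ξ : TangentSpace I x) :
    mvfderiv I (fun w => chartMetric g p₀ (y w) (s w) (t w)) x ξ =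
      chartMetric g p₀ (y x)
        (mvfderiv I s x ξ + chartChristoffel g p₀ (y x) (mvfderiv I y x ξ) (s x)) (t x)
      + chartMetric g p₀ (y x) (s x)
        (mvfderiv I t x ξ + chartChristoffel g p₀ (y x) (mvfderiv I y x ξ) (t x)) := by
  have hG := (contDiffAt_chartMetric g hyt).differentiableAt (by simp)
  rw [mvfderiv_clm_apply₂ (mdifferentiableAt_fderiv_comp hG hy) hs ht, mvfderiv_fderiv_comp hG hy,
    fderiv_eq_christoffel (chartMetric_nondegenerate g hyt) hG
      (.of_forall (chartMetric_symm g))]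
  simp only [map_add, add_apply]
  ring

theorem mdifferentiableAt_nullChart (hv : v.1.proj ∈ (extChartAt (𝓡 n) p₀).source) :
    MDifferentiableAt (𝓡 (2 * n - 2)) 𝓘(ℝ, (𝔼 n) × (𝔼 n)) (nullChart p₀) v :=
  (contMDiffAt_nullChart hv).mdifferentiableAt (by simp)

theorem mdifferentiableAt_nullChart_fst (hv : v.1.proj ∈ (extChartAt (𝓡 n) p₀).source) :
    MDifferentiableAt (𝓡 (2 * n - 2)) 𝓘(ℝ, 𝔼 n)
      (fun w : nullCongruence g K => (nullChart p₀ w).1) v :=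
  mdifferentiableAt_fderiv_comp (h := (Prod.fst : (𝔼 n) × (𝔼 n) → 𝔼 n)) differentiableAt_fst
    (mdifferentiableAt_nullChart hv)

theorem mdifferentiableAt_nullChart_snd (hv : v.1.proj ∈ (extChartAt (𝓡 n) p₀).source) :
    MDifferentiableAt (𝓡 (2 * n - 2)) 𝓘(ℝ, 𝔼 n)
      (fun w : nullCongruence g K => (nullChart p₀ w).2) v :=
  mdifferentiableAt_fderiv_comp (h := (Prod.snd : (𝔼 n) × (𝔼 n) → 𝔼 n)) differentiableAt_snd
    (mdifferentiableAt_nullChart hv)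

theorem fibrePart_eq (hv : v.1.proj ∈ (extChartAt (𝓡 n) p₀).source)
    (ξ : TangentSpace (𝓡 (2 * n - 2)) v) : fibrePart p₀ v ξ =
      mvfderiv (𝓡 (2 * n - 2)) (fun w : nullCongruence g K => (nullChart p₀ w).2) v ξ
        + chartChristoffel g p₀ (nullChart p₀ v).1 (basePart p₀ v ξ) (nullChart p₀ v).2 := by
  have := mvfderiv_fderiv_comp (h := (Prod.snd : (𝔼 n) × (𝔼 n) → 𝔼 n)) differentiableAt_snd
    (mdifferentiableAt_nullChart hv) ξ
  rw [fderiv_snd] at this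
  rw [this]
  rfl

/-- A vector tangent to the null congruence has a fibre component orthogonal to the base point. -/
theorem chartMetric_fibrePart (hv : v.1.proj ∈ (extChartAt (𝓡 n) p₀).source)
    (ξ : TangentSpace (𝓡 (2 * n - 2)) v) :
    chartMetric g p₀ (nullChart p₀ v).1 (nullChart p₀ v).2 (fibrePart p₀ v ξ) = 0 := by
  have h1 := mvfderiv_chartMetric_apply (g := g)
    (y := fun w : nullCongruence g K => (nullChart p₀ w).1) (nullChart_mem_target hv)
    (mdifferentiableAt_nullChart_fst hv) (mdifferentiableAt_nullChart_snd hv)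
    (mdifferentiableAt_nullChart_snd hv) ξ
  have h2 : (fun w : nullCongruence g K => chartMetric g p₀ (nullChart p₀ w).1 (nullChart p₀ w).2
      (nullChart p₀ w).2) =ᶠ[𝓝 v] fun _ => 0 := by
    filter_upwards [eventually_null_proj_mem hv] with w hw using chartMetric_null hw
  rw [mvfderiv_congr h2, mvfderiv_const, mvfderiv_nullChart_fst hv, ← fibrePart_eq hv,
    chartMetric_symm g _ (fibrePart p₀ v ξ)] at h1
  have h3 : (0 : ℝ) = _ := h1
  linarith

/-- Differentiate g(v, K) = -1 by metric compatibility: v contributes its fibre part paired with K,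
and K contributes v paired with ∇K, which is `slope`. -/
theorem chartMetric_fibrePart_K (hv : v.1.proj ∈ (extChartAt (𝓡 n) p₀).source)
    (ξ : TangentSpace (𝓡 (2 * n - 2)) v) :
    chartMetric g p₀ (nullChart p₀ v).1 (fibrePart p₀ v ξ) (fieldRep p₀ K.val (nullChart p₀ v).1)
      + slope g K p₀ (nullChart p₀ v) (basePart p₀ v ξ) = 0 := by
  have hk := (contDiffAt_fieldRep K.smooth (nullChart_mem_target hv)).differentiableAt (by simp)
  have h1 := mvfderiv_chartMetric_apply (g := g)
    (y := fun w : nullCongruence g K => (nullChart p₀ w).1) (nullChart_mem_target hv)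
    (mdifferentiableAt_nullChart_fst hv) (mdifferentiableAt_nullChart_snd hv)
    (mdifferentiableAt_fderiv_comp (f := fun w : nullCongruence g K => (nullChart p₀ w).1) hk
      (mdifferentiableAt_nullChart_fst hv)) ξ
  have h2 : (fun w : nullCongruence g K => chartMetric g p₀ (nullChart p₀ w).1 (nullChart p₀ w).2
      (fieldRep p₀ K.val (nullChart p₀ w).1)) =ᶠ[𝓝 v] fun _ => -1 := by
    filter_upwards [eventually_null_proj_mem hv] with w hw using chartMetric_null_K hw
  rw [mvfderiv_congr h2, mvfderiv_const,
    mvfderiv_fderiv_comp (f := fun w : nullCongruence g K => (nullChart p₀ w).1) hk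
      (mdifferentiableAt_nullChart_fst hv), mvfderiv_nullChart_fst hv,
    ← fibrePart_eq hv, ← slope_apply] at h1
  exact h1.symm

theorem basePart_sub (ζ ξ : TangentSpace (𝓡 (2 * n - 2)) v) :
    basePart p₀ v (ζ - ξ) = basePart p₀ v ζ - basePart p₀ v ξ := by
  rw [basePart, map_sub]
  rfl

theorem fibrePart_sub (ζ ξ : TangentSpace (𝓡 (2 * n - 2)) v) :
    fibrePart p₀ v (ζ - ξ) = fibrePart p₀ v ζ - fibrePart p₀ v ξ := by
  rw [fibrePart, map_sub, map_sub]
  rfl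

theorem basePart_zero : basePart p₀ v 0 = 0 := by
  rw [basePart, map_zero]
  rfl

theorem fibrePart_zero : fibrePart p₀ v 0 = 0 := by
  rw [fibrePart, map_zero, map_zero]

/-- The tangent space of the null congruence is cut out by the derivatives of its equations. -/
theorem exists_parts (hv : v.1.proj ∈ (extChartAt (𝓡 n) p₀).source) {p b : 𝔼 n}
    (h1 : chartMetric g p₀ (nullChart p₀ v).1 (nullChart p₀ v).2 b = 0)
    (h2 : chartMetric g p₀ (nullChart p₀ v).1 b (fieldRep p₀ K.val (nullChart p₀ v).1)
      + slope g K p₀ (nullChart p₀ v) p = 0) :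
    ∃ ξ : TangentSpace (𝓡 (2 * n - 2)) v, basePart p₀ v ξ = p ∧ fibrePart p₀ v ξ = b := by
  set z := nullChart p₀ v with hz
  set B := chartMetric g p₀ z.1 with hB
  set k := fieldRep p₀ K.val z.1 with hk
  let D : (𝔼 (2 * n - 2)) →ₗ[ℝ] (𝔼 n) × (𝔼 n) :=
    (mvfderiv (𝓡 (2 * n - 2)) (nullChart p₀) v).toLinearMap
  let V := vertComp (chartChristoffel g p₀) z
  let L : (𝔼 n) × (𝔼 n) →ₗ[ℝ] ℝ × ℝ := ((B z.2 ∘L V).prod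
    (B.flip k ∘L V + slope g K p₀ z ∘L ContinuousLinearMap.fst ℝ (𝔼 n) (𝔼 n))).toLinearMap
  have hL : ∀ ζ, L ζ = (B z.2 (V ζ), B (V ζ) k + slope g K p₀ z ζ.1) := fun ζ => rfl
  have hDL : LinearMap.range D ≤ LinearMap.ker L := by
    rintro _ ⟨ξ, rfl⟩
    rw [LinearMap.mem_ker, hL]
    exact Prod.ext (chartMetric_fibrePart hv ξ) (chartMetric_fibrePart_K hv ξ)
  have hrD : finrank ℝ (LinearMap.range D) = 2 * n - 2 := by
    have hinj : Function.Injective D := mvfderiv_nullChart_injective hv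
    rw [LinearMap.finrank_range_of_inj hinj]
    simp
  have hLs : LinearMap.range L = ⊤ := by
    rw [LinearMap.range_eq_top]
    rintro ⟨s, t⟩
    have haa : B z.2 z.2 = 0 := chartMetric_null hv
    have hak : B z.2 k = -1 := chartMetric_null_K hv
    have hV : ∀ w, V (0, w) = w := fun w => by simp [V, vertComp_apply]
    -- Surjectivity already holds on vectors with zero base component. The coefficient of k is
    -- forced by the first equation, and that of a then corrects the second.
    refine ⟨(0, -s • k - (t + s * B k k) • z.2), ?_⟩
    rw [hL, hV]
    refine Prod.ext ?_ ?_
    · simp only [map_sub, map_smul, smul_eq_mul, haa, hak]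
      ring
    · simp only [map_sub, map_smul, smul_eq_mul, sub_apply, smul_apply, hak, map_zero]
      ring
  have hkL : finrank ℝ (LinearMap.ker L) = 2 * n - 2 := by
    have := LinearMap.finrank_range_add_finrank_ker L
    rw [hLs, finrank_top] at this
    simp only [finrank_prod, finrank_self, finrank_euclideanSpace, Fintype.card_fin] at this
    omega
  -- The image of the tangent space lies in the kernel of the two independent equations, and both
  -- have dimension 2n - 2.
  have heq := Submodule.eq_of_le_of_finrank_eq hDL (hrD.trans hkL.symm)
  have hmem : (p, b - chartChristoffel g p₀ z.1 p z.2) ∈ LinearMap.ker L := by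
    have hV : V (p, b - chartChristoffel g p₀ z.1 p z.2) = b := by
      simp [V, vertComp_apply]
    rw [LinearMap.mem_ker, hL, hV]
    exact Prod.ext h1 h2
  rw [← heq] at hmem
  obtain ⟨ξ, hξ⟩ := hmem
  have hξ' : mvfderiv (𝓡 (2 * n - 2)) (nullChart p₀) v ξ =
    (p, b - chartChristoffel g p₀ z.1 p z.2) := hξ
  refine ⟨ξ, ?_, ?_⟩
  · exact congrArg Prod.fst hξ'
  · exact (congrArg V hξ').trans (sub_add_cancel _ _)

/-- If ξ is horizontal, the difference of the two sides is orthogonal to a and k by the tangency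
equations, and to the rest because every vector orthogonal to a and k is the fibre part of a
vertical vector. Conversely, a is orthogonal to the fibre part of every tangent vector. -/
theorem isHorizontal_iff (hv : v.1.proj ∈ (extChartAt (𝓡 n) p₀).source)
    (ξ : TangentSpace (𝓡 (2 * n - 2)) v) :
    IsHorizontal (𝓡 n) (inducedMetric g K) (nullProj g K) v ξ ↔
      fibrePart p₀ v ξ = slope g K p₀ (nullChart p₀ v) (basePart p₀ v ξ) • (nullChart p₀ v).2 := by
  constructor
  · intro h
    rw [← sub_eq_zero]
    refine eq_zero_of_orthogonal (chartMetric_symm g _)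
      (chartMetric_nondegenerate g (nullChart_mem_target hv)) (chartMetric_null hv)
      (chartMetric_null_K hv) ?_ ?_ fun w hw1 hw2 => ?_
    · rw [map_sub, map_smul, chartMetric_fibrePart hv, chartMetric_null hv]
      simp
    · rw [map_sub, map_smul, sub_apply, smul_apply, chartMetric_null_K hv]
      have := chartMetric_fibrePart_K hv ξ
      simpa using this
    · obtain ⟨η, hη1, hη2⟩ := exists_parts hv (p := 0) hw1 (by rw [hw2, map_zero, add_zero])
      have := h η ((isVertical_iff hv η).2 hη1)
      rw [inducedMetric_eq_parts hv, hη1, hη2, map_zero, zero_add] at this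
      rw [map_sub, map_smul, sub_apply, smul_apply, hw1, this]
      simp
  · intro h η hη
    rw [inducedMetric_eq_parts hv, (isVertical_iff hv η).1 hη, h, map_smul, smul_apply,
      chartMetric_fibrePart hv]
    simp

/-- The witness has base part 0 and fibre part equal to that of ξ minus its horizontal multiple of
a; subtracting it from ξ leaves exactly that multiple. -/
theorem verticalPart_spec (v : nullCongruence g K) (ξ : TangentSpace (𝓡 (2 * n - 2)) v) :
    IsVertical (𝓡 n) (nullProj g K) v
        (verticalPart (𝓡 n) (inducedMetric g K) (nullProj g K) v ξ) ∧
      IsHorizontal (𝓡 n) (inducedMetric g K) (nullProj g K) v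
        (ξ - verticalPart (𝓡 n) (inducedMetric g K) (nullProj g K) v ξ) := by
  have hv := mem_extChartAt_source (I := 𝓡 n) v.1.proj
  set p₀ := v.1.proj with hp₀
  refine Classical.epsilon_spec (p := fun η : TangentSpace (𝓡 (2 * n - 2)) v =>
    IsVertical (𝓡 n) (nullProj g K) v η ∧
      IsHorizontal (𝓡 n) (inducedMetric g K) (nullProj g K) v (ξ - η)) ?_
  obtain ⟨η, hη1, hη2⟩ := exists_parts hv (p := 0)
    (b := fibrePart p₀ v ξ - slope g K p₀ (nullChart p₀ v) (basePart p₀ v ξ) • (nullChart p₀ v).2)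
    (by
      rw [map_sub, map_smul, chartMetric_fibrePart hv, chartMetric_null hv]
      simp)
    (by
      rw [map_sub, map_smul, sub_apply, smul_apply, chartMetric_null_K hv]
      have := chartMetric_fibrePart_K hv ξ
      simpa using this)
  refine ⟨η, (isVertical_iff hv η).2 hη1, (isHorizontal_iff hv _).2 ?_⟩
  rw [fibrePart_sub, basePart_sub, hη1, hη2, sub_zero, sub_sub_cancel]

theorem basePart_verticalPart (hv : v.1.proj ∈ (extChartAt (𝓡 n) p₀).source)
    (ξ : TangentSpace (𝓡 (2 * n - 2)) v) :
    basePart p₀ v (verticalPart (𝓡 n) (inducedMetric g K) (nullProj g K) v ξ) = 0 :=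
  (isVertical_iff hv _).1 (verticalPart_spec v ξ).1

theorem fibrePart_verticalPart (hv : v.1.proj ∈ (extChartAt (𝓡 n) p₀).source)
    (ξ : TangentSpace (𝓡 (2 * n - 2)) v) :
    fibrePart p₀ v (verticalPart (𝓡 n) (inducedMetric g K) (nullProj g K) v ξ) =
      fibrePart p₀ v ξ
        - slope g K p₀ (nullChart p₀ v) (basePart p₀ v ξ) • (nullChart p₀ v).2 := by
  have := (isHorizontal_iff hv _).1 (verticalPart_spec v ξ).2
  rw [fibrePart_sub, basePart_sub, basePart_verticalPart hv, sub_zero] at this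
  rw [← this, sub_sub_cancel]

theorem verticalPart_eq_zero {ξ : TangentSpace (𝓡 (2 * n - 2)) v}
    (h : IsHorizontal (𝓡 n) (inducedMetric g K) (nullProj g K) v ξ) :
    verticalPart (𝓡 n) (inducedMetric g K) (nullProj g K) v ξ = 0 := by
  have hv := mem_extChartAt_source (I := 𝓡 n) v.1.proj
  refine ext_parts hv ?_ ?_
  · rw [basePart_verticalPart hv, basePart_zero]
  · rw [fibrePart_verticalPart hv, (isHorizontal_iff hv ξ).1 h, sub_self, fibrePart_zero]

theorem horizontalPart_eq_self {ξ : TangentSpace (𝓡 (2 * n - 2)) v}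
    (h : IsHorizontal (𝓡 n) (inducedMetric g K) (nullProj g K) v ξ) :
    horizontalPart (𝓡 n) (inducedMetric g K) (nullProj g K) v ξ = ξ := by
  rw [horizontalPart, verticalPart_eq_zero h, sub_zero]

theorem exists_horizontal (hv : v.1.proj ∈ (extChartAt (𝓡 n) p₀).source) (p : 𝔼 n) :
    ∃ ξ : TangentSpace (𝓡 (2 * n - 2)) v, basePart p₀ v ξ = p ∧
      fibrePart p₀ v ξ = slope g K p₀ (nullChart p₀ v) p • (nullChart p₀ v).2 := by
  refine exists_parts hv ?_ ?_
  · rw [map_smul, chartMetric_null hv, smul_zero]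
  · rw [map_smul, smul_apply, chartMetric_null_K hv]
    simp

theorem horizontalLift_spec (X : ∀ p : M, TangentSpace (𝓡 n) p) (v : nullCongruence g K) :
    IsHorizontal (𝓡 n) (inducedMetric g K) (nullProj g K) v
        (horizontalLift (𝓡 n) (inducedMetric g K) (nullProj g K) X v) ∧
      mfderiv (𝓡 (2 * n - 2)) (𝓡 n) (nullProj g K) v
        (horizontalLift (𝓡 n) (inducedMetric g K) (nullProj g K) X v) = X (nullProj g K v) := by
  refine Classical.epsilon_spec (p := fun ξ : TangentSpace (𝓡 (2 * n - 2)) v =>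
    IsHorizontal (𝓡 n) (inducedMetric g K) (nullProj g K) v ξ ∧
      mfderiv (𝓡 (2 * n - 2)) (𝓡 n) (nullProj g K) v ξ = X (nullProj g K v)) ?_
  have hv := mem_extChartAt_source (I := 𝓡 n) v.1.proj
  set p₀ := v.1.proj with hp₀
  obtain ⟨ξ, h1, h2⟩ := exists_horizontal hv
    (mvfderiv (𝓡 n) (extChartAt (𝓡 n) p₀) v.1.proj (X (nullProj g K v)))
  refine ⟨ξ, (isHorizontal_iff hv ξ).2 (by rw [h1, h2]), ?_⟩
  rw [basePart_eq hv] at h1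
  have h3 := congrArg (chartVec p₀ v.1.proj) h1
  exact ((chartVec_mvfderiv hv _).symm.trans h3).trans (chartVec_mvfderiv hv _)

theorem basePart_horizontalLift (hv : v.1.proj ∈ (extChartAt (𝓡 n) p₀).source)
    (X : ∀ p : M, TangentSpace (𝓡 n) p) :
    basePart p₀ v (horizontalLift (𝓡 n) (inducedMetric g K) (nullProj g K) X v) =
      fieldRep p₀ X (nullChart p₀ v).1 := by
  rw [basePart_eq hv, (horizontalLift_spec X v).2]
  exact (fieldRep_apply hv X).symm

theorem fibrePart_horizontalLift (hv : v.1.proj ∈ (extChartAt (𝓡 n) p₀).source)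
    (X : ∀ p : M, TangentSpace (𝓡 n) p) :
    fibrePart p₀ v (horizontalLift (𝓡 n) (inducedMetric g K) (nullProj g K) X v) =
      slope g K p₀ (nullChart p₀ v) (fieldRep p₀ X (nullChart p₀ v).1) • (nullChart p₀ v).2 := by
  rw [(isHorizontal_iff hv _).1 (horizontalLift_spec X v).1, basePart_horizontalLift hv]

/-- An indefinite metric may degenerate on a submanifold, so this needs proof. A vector in the
radical is horizontal; against horizontal vectors only the base parts count, because a is null, so
its base part vanishes and with it the fibre part. -/
theorem inducedMetric_nondegenerate (v : nullCongruence g K) (ξ : TangentSpace (𝓡 (2 * n - 2)) v)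
    (h : ∀ η, inducedMetric g K v ξ η = 0) : ξ = 0 := by
  have hv := mem_extChartAt_source (I := 𝓡 n) v.1.proj
  have h1 := (isHorizontal_iff hv ξ).1 fun η _ => h η
  have h2 : basePart v.1.proj v ξ = 0 := by
    refine chartMetric_nondegenerate g (nullChart_mem_target hv) _ fun p => ?_
    obtain ⟨η, hη1, hη2⟩ := exists_horizontal hv p
    have := h η
    rw [inducedMetric_eq_parts hv, hη1, hη2, h1, map_smul, map_smul, smul_apply,
      chartMetric_null hv] at this
    simpa using this
  refine ext_parts hv (h2.trans basePart_zero.symm) ?_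
  rw [h1, h2, fibrePart_zero, map_zero, zero_smul]

end NullTangent

/-! ### Curvature in the bracket of coordinate lifts -/

section LiftDerivative

variable {E : Type*} [NormedAddCommGroup E] [NormedSpace ℝ E] {Γ : E → E →L[ℝ] E →L[ℝ] E}
  {x y : E → E} {r s : E × E → ℝ} {z : E × E}

theorem fderiv_liftField (hΓ : DifferentiableAt ℝ Γ z.1) (hy : DifferentiableAt ℝ y z.1)
    (hs : DifferentiableAt ℝ s z) (ζ : E × E) :
    fderiv ℝ (fun w : E × E => (y w.1, s w • w.2 - Γ w.1 (y w.1) w.2)) z ζ =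
      (fderiv ℝ y z.1 ζ.1, s z • ζ.2 + fderiv ℝ s z ζ • z.2
        - (Γ z.1 (y z.1) ζ.2 + (Γ z.1 (fderiv ℝ y z.1 ζ.1) z.2 + fderiv ℝ Γ z.1 ζ.1 (y z.1) z.2))) := by
  have h1 : HasFDerivAt (fun w : E × E => y w.1) (fderiv ℝ y z.1 ∘L ContinuousLinearMap.fst ℝ E E) z :=
    hy.hasFDerivAt.comp z hasFDerivAt_fst
  have h2 : HasFDerivAt (fun w : E × E => Γ w.1)
      (fderiv ℝ Γ z.1 ∘L ContinuousLinearMap.fst ℝ E E) z :=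
    hΓ.hasFDerivAt.comp z hasFDerivAt_fst
  have h3 := (h2.clm_apply h1).clm_apply (hasFDerivAt_snd (𝕜 := ℝ) (p := z))
  have h4 := hs.hasFDerivAt.smul (hasFDerivAt_snd (𝕜 := ℝ) (p := z))
  have h5 := h1.prodMk (h4.sub h3)
  exact congrArg (fun L : E × E →L[ℝ] E × E => L ζ) h5.fderiv

/-- The bracket of two horizontal lifts has the curvature as its vertical component, modulo the
Liouville field. -/
theorem exists_vertComp_bracket (hΓ : DifferentiableAt ℝ Γ z.1) (hx : DifferentiableAt ℝ x z.1)
    (hy : DifferentiableAt ℝ y z.1) (hr : DifferentiableAt ℝ r z) (hs : DifferentiableAt ℝ s z) :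
    ∃ t : ℝ, vertComp Γ z
      (fderiv ℝ (fun w : E × E => (y w.1, s w • w.2 - Γ w.1 (y w.1) w.2)) z
          (x z.1, r z • z.2 - Γ z.1 (x z.1) z.2)
        - fderiv ℝ (fun w : E × E => (x w.1, r w • w.2 - Γ w.1 (x w.1) w.2)) z
          (y z.1, s z • z.2 - Γ z.1 (y z.1) z.2)) =
      t • z.2 - chartCurvature Γ z.1 (x z.1) (y z.1) z.2 := by
  -- Only the derivatives of the coefficients r and s survive as multiples of z.2. The
  -- undifferentiated r and s cancel because Γ is linear in the fibre variable, and the derivatives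
  -- of x and y cancel against the Christoffel term of `vertComp`.
  refine ⟨fderiv ℝ s z (x z.1, r z • z.2 - Γ z.1 (x z.1) z.2)
    - fderiv ℝ r z (y z.1, s z • z.2 - Γ z.1 (y z.1) z.2), ?_⟩
  rw [fderiv_liftField hΓ hy hs, fderiv_liftField hΓ hx hr, vertComp_apply, chartCurvature]
  simp only [Prod.fst_sub, Prod.snd_sub, map_sub, map_smul, sub_apply]
  module

end LiftDerivative

/-! ### Horizontal lifts and vertical fields, and their brackets -/

section NullFields

variable {n : ℕ} {M : Type*} [TopologicalSpace M] [ChartedSpace (EuclideanSpace ℝ (Fin n)) M]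
  [IsManifold (𝓡 n) ∞ M]

local notation "𝔼" n => EuclideanSpace ℝ (Fin n)

variable {g : LorentzMetric n M} {K : TimelikeField g} {p₀ : M} {v : nullCongruence g K}

/-- The coordinate expression of the horizontal lift of a vector field. -/
def liftRep (g : LorentzMetric n M) (K : TimelikeField g) (p₀ : M)
    (X : ∀ p : M, TangentSpace (𝓡 n) p) (z : (𝔼 n) × (𝔼 n)) : (𝔼 n) × (𝔼 n) :=
  (fieldRep p₀ X z.1, slope g K p₀ z (fieldRep p₀ X z.1) • z.2
    - chartChristoffel g p₀ z.1 (fieldRep p₀ X z.1) z.2)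

theorem mvfderiv_nullChart_eq_parts (ξ : TangentSpace (𝓡 (2 * n - 2)) v) :
    mvfderiv (𝓡 (2 * n - 2)) (nullChart p₀) v ξ = (basePart p₀ v ξ, fibrePart p₀ v ξ
      - chartChristoffel g p₀ (nullChart p₀ v).1 (basePart p₀ v ξ) (nullChart p₀ v).2) := by
  refine Prod.ext rfl ?_
  rw [fibrePart, vertComp_apply]
  exact (add_sub_cancel_right _ _).symm

variable {X Y : ∀ p : M, TangentSpace (𝓡 n) p}

theorem contDiffAt_slope_fieldRep (hX : IsSmoothField X) {z : (𝔼 n) × (𝔼 n)}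
    (hz : z.1 ∈ (extChartAt (𝓡 n) p₀).target) :
    ContDiffAt ℝ ∞ (fun z => slope g K p₀ z (fieldRep p₀ X z.1)) z :=
  (contDiffAt_slope g K hz).clm_apply ((contDiffAt_fieldRep hX hz).comp z contDiffAt_fst)

theorem contDiffAt_liftRep (hX : IsSmoothField X) {z : (𝔼 n) × (𝔼 n)}
    (hz : z.1 ∈ (extChartAt (𝓡 n) p₀).target) : ContDiffAt ℝ ∞ (liftRep g K p₀ X) z := by
  have hx : ContDiffAt ℝ ∞ (fun z : (𝔼 n) × (𝔼 n) => fieldRep p₀ X z.1) z :=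
    (contDiffAt_fieldRep hX hz).comp z contDiffAt_fst
  have hΓ : ContDiffAt ℝ ∞ (fun z : (𝔼 n) × (𝔼 n) => chartChristoffel g p₀ z.1) z :=
    (contDiffAt_chartChristoffel g hz).comp z contDiffAt_fst
  exact hx.prodMk (((contDiffAt_slope_fieldRep hX hz).smul contDiffAt_snd).sub
    ((hΓ.clm_apply hx).clm_apply contDiffAt_snd))

theorem mvfderiv_horizontalLift (hv : v.1.proj ∈ (extChartAt (𝓡 n) p₀).source)
    (X : ∀ p : M, TangentSpace (𝓡 n) p) :
    mvfderiv (𝓡 (2 * n - 2)) (nullChart p₀) v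
      (horizontalLift (𝓡 n) (inducedMetric g K) (nullProj g K) X v) =
      liftRep g K p₀ X (nullChart p₀ v) := by
  rw [mvfderiv_nullChart_eq_parts, fibrePart_horizontalLift hv, basePart_horizontalLift hv, liftRep]

/-- The lift is chosen pointwise, so its regularity is read off from its image under the immersion,
a smooth function of the coordinates. -/
theorem mdifferentiableAt_horizontalLift (hX : IsSmoothField X) (v : nullCongruence g K) :
    MDifferentiableAt (𝓡 (2 * n - 2)) (𝓡 (2 * n - 2)).tangent
      (fun w => (⟨w, horizontalLift (𝓡 n) (inducedMetric g K) (nullProj g K) X w⟩ :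
        TangentBundle (𝓡 (2 * n - 2)) (nullCongruence g K))) v := by
  have hv := mem_extChartAt_source (I := 𝓡 n) v.1.proj
  refine mdifferentiableAt_of_immersion (contMDiffAt_nullChart hv) (mvfderiv_nullChart_injective hv)
    (mdifferentiableAt_fderiv_comp
      ((contDiffAt_liftRep (g := g) (K := K) hX (nullChart_mem_target hv)).differentiableAt (by simp))
      (mdifferentiableAt_nullChart hv)) ?_
  filter_upwards [eventually_null_proj_mem hv] with w hw using mvfderiv_horizontalLift hw X

/-- The coordinate expression of a vertical field. -/
def verticalRep (g : LorentzMetric n M) (K : TimelikeField g) (p₀ : M) (w : 𝔼 n)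
    (z : (𝔼 n) × (𝔼 n)) : (𝔼 n) × (𝔼 n) :=
  (0, nullPairProj (chartMetric g p₀ z.1) z.2 (fieldRep p₀ K.val z.1) w)

theorem contDiffAt_verticalRep (w : 𝔼 n) {z : (𝔼 n) × (𝔼 n)}
    (hz : z.1 ∈ (extChartAt (𝓡 n) p₀).target) : ContDiffAt ℝ ∞ (verticalRep g K p₀ w) z := by
  have hk : ContDiffAt ℝ ∞ (fun z : (𝔼 n) × (𝔼 n) => fieldRep p₀ K.val z.1) z :=
    (contDiffAt_fieldRep K.smooth hz).comp z contDiffAt_fst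
  have hB : ContDiffAt ℝ ∞ (fun z : (𝔼 n) × (𝔼 n) => chartMetric g p₀ z.1) z :=
    (contDiffAt_chartMetric g hz).comp z contDiffAt_fst
  have hw : ContDiffAt ℝ ∞ (fun z : (𝔼 n) × (𝔼 n) => chartMetric g p₀ z.1 w) z :=
    hB.clm_apply contDiffAt_const
  have ha : ContDiffAt ℝ ∞ (fun z : (𝔼 n) × (𝔼 n) => chartMetric g p₀ z.1 w z.2) z :=
    hw.clm_apply contDiffAt_snd
  exact contDiffAt_const.prodMk ((contDiffAt_const.add (ha.smul hk)).add
    (((ha.mul ((hB.clm_apply hk).clm_apply hk)).add (hw.clm_apply hk)).smul contDiffAt_snd))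

/-- A vertical vector extends to a vertical field. -/
theorem exists_vertical_field (hv : v.1.proj ∈ (extChartAt (𝓡 n) p₀).source) {w : 𝔼 n}
    (h1 : chartMetric g p₀ (nullChart p₀ v).1 (nullChart p₀ v).2 w = 0)
    (h2 : chartMetric g p₀ (nullChart p₀ v).1 w (fieldRep p₀ K.val (nullChart p₀ v).1) = 0) :
    ∃ U : ∀ u : nullCongruence g K, TangentSpace (𝓡 (2 * n - 2)) u,
      MDifferentiableAt (𝓡 (2 * n - 2)) (𝓡 (2 * n - 2)).tangent
        (fun u => (⟨u, U u⟩ : TangentBundle (𝓡 (2 * n - 2)) (nullCongruence g K))) v ∧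
      (∀ᶠ u in 𝓝 v, basePart p₀ u (U u) = 0) ∧ fibrePart p₀ v (U v) = w := by
  -- The constant vector w is projected at each point u to the complement of the position vector and
  -- K, giving the fibre part of a vertical vector. Away from the chart domain nothing is asked and
  -- 0 serves.
  have hex : ∀ u : nullCongruence g K, ∃ ξ : TangentSpace (𝓡 (2 * n - 2)) u,
      u.1.proj ∈ (extChartAt (𝓡 n) p₀).source → basePart p₀ u ξ = 0 ∧ fibrePart p₀ u ξ =
        nullPairProj (chartMetric g p₀ (nullChart p₀ u).1) (nullChart p₀ u).2
          (fieldRep p₀ K.val (nullChart p₀ u).1) w := by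
    intro u
    by_cases hu : u.1.proj ∈ (extChartAt (𝓡 n) p₀).source
    · obtain ⟨ξ, hξ⟩ := exists_parts hu (p := 0)
        (nullPairProj_left (chartMetric_symm g _) (chartMetric_null hu) (chartMetric_null_K hu) w)
        (by rw [nullPairProj_right (chartMetric_symm g _) (chartMetric_null_K hu), map_zero,
          add_zero])
      exact ⟨ξ, fun _ => hξ⟩
    · exact ⟨0, fun h => absurd h hu⟩
  choose U hU using hex
  refine ⟨U, ?_, ?_, ?_⟩
  · refine mdifferentiableAt_of_immersion (contMDiffAt_nullChart hv)
      (mvfderiv_nullChart_injective hv) (mdifferentiableAt_fderiv_comp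
        ((contDiffAt_verticalRep (g := g) (K := K) w (nullChart_mem_target hv)).differentiableAt
          (by simp)) (mdifferentiableAt_nullChart hv)) ?_
    filter_upwards [eventually_null_proj_mem hv] with u hu
    rw [mvfderiv_nullChart_eq_parts, (hU u hu).1, (hU u hu).2, map_zero, zero_apply, sub_zero,
      verticalRep]
  · filter_upwards [eventually_null_proj_mem hv] with u hu using (hU u hu).1
  · rw [(hU v hv).2, nullPairProj_eq_self (chartMetric_symm g _) h1 h2]

variable {F₁ F₂ : ∀ u : nullCongruence g K, TangentSpace (𝓡 (2 * n - 2)) u}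

/-- For projectable fields, apply the bracket formula to the base coordinate alone: along it the
components x and y depend only on the base point. -/
theorem basePart_mlieBracket (hv : v.1.proj ∈ (extChartAt (𝓡 n) p₀).source)
    (h₁ : MDifferentiableAt (𝓡 (2 * n - 2)) (𝓡 (2 * n - 2)).tangent
      (fun u => (⟨u, F₁ u⟩ : TangentBundle (𝓡 (2 * n - 2)) (nullCongruence g K))) v)
    (h₂ : MDifferentiableAt (𝓡 (2 * n - 2)) (𝓡 (2 * n - 2)).tangent
      (fun u => (⟨u, F₂ u⟩ : TangentBundle (𝓡 (2 * n - 2)) (nullCongruence g K))) v)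
    {x y : (𝔼 n) → 𝔼 n} (hx : DifferentiableAt ℝ x (nullChart p₀ v).1)
    (hy : DifferentiableAt ℝ y (nullChart p₀ v).1)
    (hx' : ∀ᶠ u in 𝓝 v, basePart p₀ u (F₁ u) = x (nullChart p₀ u).1)
    (hy' : ∀ᶠ u in 𝓝 v, basePart p₀ u (F₂ u) = y (nullChart p₀ u).1) :
    basePart p₀ v (mlieBracket (𝓡 (2 * n - 2)) F₁ F₂ v) =
      fderiv ℝ y (nullChart p₀ v).1 (basePart p₀ v (F₁ v))
        - fderiv ℝ x (nullChart p₀ v).1 (basePart p₀ v (F₂ v)) := by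
  have hΦ : ContMDiffAt (𝓡 (2 * n - 2)) 𝓘(ℝ, 𝔼 n) ∞
      (fun u : nullCongruence g K => (nullChart p₀ u).1) v :=
    (contDiffAt_fst.contMDiffAt (n := ∞)).comp v (contMDiffAt_nullChart hv)
  have key : ∀ {F : ∀ u : nullCongruence g K, TangentSpace (𝓡 (2 * n - 2)) u} {f : (𝔼 n) → 𝔼 n}
      (_ : DifferentiableAt ℝ f (nullChart p₀ v).1)
      (_ : ∀ᶠ u in 𝓝 v, basePart p₀ u (F u) = f (nullChart p₀ u).1)
      (ξ : TangentSpace (𝓡 (2 * n - 2)) v),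
      mvfderiv (𝓡 (2 * n - 2)) (fun u => mvfderiv (𝓡 (2 * n - 2))
        (fun u : nullCongruence g K => (nullChart p₀ u).1) u (F u)) v ξ =
        fderiv ℝ f (nullChart p₀ v).1 (basePart p₀ v ξ) := by
    intro F f hf hF ξ
    have hev : (fun u => mvfderiv (𝓡 (2 * n - 2))
        (fun u : nullCongruence g K => (nullChart p₀ u).1) u (F u)) =ᶠ[𝓝 v]
        fun u => f (nullChart p₀ u).1 := by
      filter_upwards [hF, eventually_null_proj_mem hv] with u hu hu'
      rw [mvfderiv_nullChart_fst hu', hu]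
    rw [mvfderiv_congr hev, mvfderiv_fderiv_comp
      (f := fun u : nullCongruence g K => (nullChart p₀ u).1) hf
      (mdifferentiableAt_nullChart_fst hv), mvfderiv_nullChart_fst hv]
  rw [← mvfderiv_nullChart_fst hv, mvfderiv_mlieBracket hΦ h₁ h₂, key hy hy', key hx hx']

theorem exists_fibrePart_mlieBracket (hv : v.1.proj ∈ (extChartAt (𝓡 n) p₀).source)
    (hX : IsSmoothField X) (hY : IsSmoothField Y) :
    ∃ t : ℝ, fibrePart p₀ v (mlieBracket (𝓡 (2 * n - 2))
        (horizontalLift (𝓡 n) (inducedMetric g K) (nullProj g K) X)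
        (horizontalLift (𝓡 n) (inducedMetric g K) (nullProj g K) Y) v) =
      t • (nullChart p₀ v).2 - chartCurvature (chartChristoffel g p₀) (nullChart p₀ v).1
        (fieldRep p₀ X (nullChart p₀ v).1) (fieldRep p₀ Y (nullChart p₀ v).1)
        (nullChart p₀ v).2 := by
  have hz := nullChart_mem_target hv
  have key : ∀ {Z : ∀ p : M, TangentSpace (𝓡 n) p} (_ : IsSmoothField Z)
      (ξ : TangentSpace (𝓡 (2 * n - 2)) v),
      mvfderiv (𝓡 (2 * n - 2)) (fun u => mvfderiv (𝓡 (2 * n - 2)) (nullChart p₀) u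
        (horizontalLift (𝓡 n) (inducedMetric g K) (nullProj g K) Z u)) v ξ =
        fderiv ℝ (liftRep g K p₀ Z) (nullChart p₀ v)
          (mvfderiv (𝓡 (2 * n - 2)) (nullChart p₀) v ξ) := by
    intro Z hZ ξ
    have hev : (fun u => mvfderiv (𝓡 (2 * n - 2)) (nullChart p₀) u
        (horizontalLift (𝓡 n) (inducedMetric g K) (nullProj g K) Z u)) =ᶠ[𝓝 v]
        fun u => liftRep g K p₀ Z (nullChart p₀ u) := by
      filter_upwards [eventually_null_proj_mem hv] with u hu using mvfderiv_horizontalLift hu Z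
    rw [mvfderiv_congr hev, mvfderiv_fderiv_comp
      ((contDiffAt_liftRep hZ hz).differentiableAt (by simp)) (mdifferentiableAt_nullChart hv)]
  rw [fibrePart, mvfderiv_mlieBracket (contMDiffAt_nullChart hv)
    (mdifferentiableAt_horizontalLift hX v) (mdifferentiableAt_horizontalLift hY v), key hX, key hY,
    mvfderiv_horizontalLift hv, mvfderiv_horizontalLift hv]
  exact exists_vertComp_bracket (x := fieldRep p₀ X) (y := fieldRep p₀ Y)
    (r := fun z => slope g K p₀ z (fieldRep p₀ X z.1))
    (s := fun z => slope g K p₀ z (fieldRep p₀ Y z.1))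
    ((contDiffAt_chartChristoffel g hz).differentiableAt (by simp))
    ((contDiffAt_fieldRep hX hz).differentiableAt (by simp))
    ((contDiffAt_fieldRep hY hz).differentiableAt (by simp))
    ((contDiffAt_slope_fieldRep hX hz).differentiableAt (by simp))
    ((contDiffAt_slope_fieldRep hY hz).differentiableAt (by simp))

end NullFields

/-! ### The O'Neill tensor of the null congruence -/

section ONeill

variable {n : ℕ} {M : Type*} [TopologicalSpace M] [ChartedSpace (EuclideanSpace ℝ (Fin n)) M]
  [IsManifold (𝓡 n) ∞ M]

local notation "𝔼" n => EuclideanSpace ℝ (Fin n)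

variable {g : LorentzMetric n M} {K : TimelikeField g} {p₀ : M} {v : nullCongruence g K}
  {X Y : ∀ p : M, TangentSpace (𝓡 n) p}
  {F F₁ F₂ : ∀ u : nullCongruence g K, TangentSpace (𝓡 (2 * n - 2)) u}

theorem inducedMetric_symm (ζ ξ : TangentSpace (𝓡 (2 * n - 2)) v) :
    inducedMetric g K v ζ ξ = inducedMetric g K v ξ ζ := by
  rw [inducedMetric, inducedMetric, sasaki, sasaki, g.symm, g.symm _ (connector g _ _)]

theorem sasakiForm_symm (z a b : (𝔼 n) × (𝔼 n)) :
    sasakiForm (chartMetric g p₀) (chartChristoffel g p₀) z a b =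
      sasakiForm (chartMetric g p₀) (chartChristoffel g p₀) z b a := by
  rw [sasakiForm_apply, sasakiForm_apply, chartMetric_symm, chartMetric_symm g _ (vertComp _ _ _)]

theorem differentiableAt_sasakiForm (hv : v.1.proj ∈ (extChartAt (𝓡 n) p₀).source) :
    DifferentiableAt ℝ (sasakiForm (chartMetric g p₀) (chartChristoffel g p₀)) (nullChart p₀ v) :=
  (contDiffAt_sasakiForm (contDiffAt_chartMetric g (nullChart_mem_target hv))
    (contDiffAt_chartChristoffel g (nullChart_mem_target hv))).differentiableAt (n := ∞) (by simp)

theorem eventually_inducedMetric_eq (hv : v.1.proj ∈ (extChartAt (𝓡 n) p₀).source) :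
    ∀ᶠ u in 𝓝 v, ∀ ζ ξ, inducedMetric g K u ζ ξ =
      sasakiForm (chartMetric g p₀) (chartChristoffel g p₀) (nullChart p₀ u)
        (mvfderiv (𝓡 (2 * n - 2)) (nullChart p₀) u ζ)
        (mvfderiv (𝓡 (2 * n - 2)) (nullChart p₀) u ξ) := by
  filter_upwards [eventually_null_proj_mem hv] with u hu using inducedMetric_eq hu

theorem koszul_inducedMetric
    (h₁ : MDifferentiableAt (𝓡 (2 * n - 2)) (𝓡 (2 * n - 2)).tangent
      (fun u => (⟨u, F₁ u⟩ : TangentBundle (𝓡 (2 * n - 2)) (nullCongruence g K))) v)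
    (h₂ : MDifferentiableAt (𝓡 (2 * n - 2)) (𝓡 (2 * n - 2)).tangent
      (fun u => (⟨u, F₂ u⟩ : TangentBundle (𝓡 (2 * n - 2)) (nullCongruence g K))) v)
    (h : MDifferentiableAt (𝓡 (2 * n - 2)) (𝓡 (2 * n - 2)).tangent
      (fun u => (⟨u, F u⟩ : TangentBundle (𝓡 (2 * n - 2)) (nullCongruence g K))) v) :
    2 * inducedMetric g K v (leviCivita (inducedMetric g K) F₁ F₂ v) (F v) =
      koszul (inducedMetric g K) F₁ F₂ F v := by
  have hv := mem_extChartAt_source (I := 𝓡 n) v.1.proj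
  exact two_mul_leviCivita (contMDiffAt_nullChart hv) (differentiableAt_sasakiForm hv)
    (sasakiForm_symm _) (eventually_inducedMetric_eq hv) (inducedMetric_nondegenerate v) h₁ h₂ h

theorem leviCivita_inducedMetric_zero
    (h : MDifferentiableAt (𝓡 (2 * n - 2)) (𝓡 (2 * n - 2)).tangent
      (fun u => (⟨u, F u⟩ : TangentBundle (𝓡 (2 * n - 2)) (nullCongruence g K))) v) :
    leviCivita (inducedMetric g K) F (fun _ => 0) v = 0 := by
  have hv := mem_extChartAt_source (I := 𝓡 n) v.1.proj
  exact leviCivita_zero_right (contMDiffAt_nullChart hv) (differentiableAt_sasakiForm hv)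
    (sasakiForm_symm _) (eventually_inducedMetric_eq hv) (inducedMetric_nondegenerate v) h

theorem inducedMetric_vertical (hv : v.1.proj ∈ (extChartAt (𝓡 n) p₀).source)
    (ζ : TangentSpace (𝓡 (2 * n - 2)) v) {ξ : TangentSpace (𝓡 (2 * n - 2)) v}
    (h : basePart p₀ v ξ = 0) : inducedMetric g K v ζ ξ =
      chartMetric g p₀ (nullChart p₀ v).1 (fibrePart p₀ v ζ) (fibrePart p₀ v ξ) := by
  rw [inducedMetric_eq_parts hv, h, map_zero, zero_add]

theorem inducedMetric_horizontalLift_vertical (hv : v.1.proj ∈ (extChartAt (𝓡 n) p₀).source)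
    (X : ∀ p : M, TangentSpace (𝓡 n) p) {ξ : TangentSpace (𝓡 (2 * n - 2)) v}
    (h : basePart p₀ v ξ = 0) : inducedMetric g K v
      (horizontalLift (𝓡 n) (inducedMetric g K) (nullProj g K) X v) ξ = 0 :=
  (horizontalLift_spec X v).1 ξ ((isVertical_iff hv ξ).2 h)

/-- The lift projects to X and F projects to the zero field, so their bracket projects to [X, 0] =
0. -/
theorem basePart_mlieBracket_vertical (hv : v.1.proj ∈ (extChartAt (𝓡 n) p₀).source)
    (hX : IsSmoothField X)
    (h : MDifferentiableAt (𝓡 (2 * n - 2)) (𝓡 (2 * n - 2)).tangent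
      (fun u => (⟨u, F u⟩ : TangentBundle (𝓡 (2 * n - 2)) (nullCongruence g K))) v)
    (hF : ∀ᶠ u in 𝓝 v, basePart p₀ u (F u) = 0) :
    basePart p₀ v (mlieBracket (𝓡 (2 * n - 2))
      (horizontalLift (𝓡 n) (inducedMetric g K) (nullProj g K) X) F v) = 0 := by
  rw [basePart_mlieBracket hv (mdifferentiableAt_horizontalLift hX v) h (y := fun _ => 0)
    ((contDiffAt_fieldRep hX (nullChart_mem_target hv)).differentiableAt (by simp))
    (differentiableAt_const _) ?_ hF, hF.self_of_nhds]
  · simp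
  · filter_upwards [eventually_null_proj_mem hv] with u hu using basePart_horizontalLift hu X

/-- The scalar product of two horizontal lifts is constant along the fibres. -/
theorem mvfderiv_inducedMetric_horizontalLift (hv : v.1.proj ∈ (extChartAt (𝓡 n) p₀).source)
    (hX : IsSmoothField X) (hY : IsSmoothField Y) {ξ : TangentSpace (𝓡 (2 * n - 2)) v}
    (h : basePart p₀ v ξ = 0) :
    mvfderiv (𝓡 (2 * n - 2)) (fun u => inducedMetric g K u
      (horizontalLift (𝓡 n) (inducedMetric g K) (nullProj g K) X u)
      (horizontalLift (𝓡 n) (inducedMetric g K) (nullProj g K) Y u)) v ξ = 0 := by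
  have hev : (fun u => inducedMetric g K u
      (horizontalLift (𝓡 n) (inducedMetric g K) (nullProj g K) X u)
      (horizontalLift (𝓡 n) (inducedMetric g K) (nullProj g K) Y u)) =ᶠ[𝓝 v] fun u =>
      (fun y => chartMetric g p₀ y (fieldRep p₀ X y) (fieldRep p₀ Y y)) (nullChart p₀ u).1 := by
    filter_upwards [eventually_null_proj_mem hv] with u hu
    -- Both fibre parts are multiples of the same null vector, so only the base term remains.
    rw [inducedMetric_eq_parts hu, basePart_horizontalLift hu, basePart_horizontalLift hu,
      fibrePart_horizontalLift hu, fibrePart_horizontalLift hu, map_smul, map_smul, smul_apply,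
      chartMetric_null hu, smul_zero, smul_zero, add_zero]
  have hz := nullChart_mem_target hv
  have hd : DifferentiableAt ℝ
      (fun y => chartMetric g p₀ y (fieldRep p₀ X y) (fieldRep p₀ Y y)) (nullChart p₀ v).1 :=
    (((contDiffAt_chartMetric g hz).clm_apply (contDiffAt_fieldRep hX hz)).clm_apply
      (contDiffAt_fieldRep hY hz)).differentiableAt (by simp)
  rw [mvfderiv_congr hev, mvfderiv_fderiv_comp
    (f := fun u : nullCongruence g K => (nullChart p₀ u).1) hd
    (mdifferentiableAt_nullChart_fst hv), mvfderiv_nullChart_fst hv, h, map_zero]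

/-- O'Neill's formula: the vertical part of `∇_X̃ Ỹ` is half of the vertical part of the bracket. -/
theorem two_mul_leviCivita_horizontalLift (hv : v.1.proj ∈ (extChartAt (𝓡 n) p₀).source)
    (hX : IsSmoothField X) (hY : IsSmoothField Y)
    (h : MDifferentiableAt (𝓡 (2 * n - 2)) (𝓡 (2 * n - 2)).tangent
      (fun u => (⟨u, F u⟩ : TangentBundle (𝓡 (2 * n - 2)) (nullCongruence g K))) v)
    (hF : ∀ᶠ u in 𝓝 v, basePart p₀ u (F u) = 0) :
    2 * inducedMetric g K v (leviCivita (inducedMetric g K)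
        (horizontalLift (𝓡 n) (inducedMetric g K) (nullProj g K) X)
        (horizontalLift (𝓡 n) (inducedMetric g K) (nullProj g K) Y) v) (F v) =
      inducedMetric g K v (mlieBracket (𝓡 (2 * n - 2))
        (horizontalLift (𝓡 n) (inducedMetric g K) (nullProj g K) X)
        (horizontalLift (𝓡 n) (inducedMetric g K) (nullProj g K) Y) v) (F v) := by
  rw [koszul_inducedMetric (mdifferentiableAt_horizontalLift hX v)
    (mdifferentiableAt_horizontalLift hY v) h, koszul]
  have e1 : (fun u => inducedMetric g K u
      (horizontalLift (𝓡 n) (inducedMetric g K) (nullProj g K) Y u) (F u)) =ᶠ[𝓝 v] fun _ => 0 := by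
    filter_upwards [eventually_null_proj_mem hv, hF] with u hu hu'
    exact inducedMetric_horizontalLift_vertical hu Y hu'
  have e2 : (fun u => inducedMetric g K u (F u)
      (horizontalLift (𝓡 n) (inducedMetric g K) (nullProj g K) X u)) =ᶠ[𝓝 v] fun _ => 0 := by
    filter_upwards [eventually_null_proj_mem hv, hF] with u hu hu'
    rw [inducedMetric_symm]
    exact inducedMetric_horizontalLift_vertical hu X hu'
  have b1 := basePart_mlieBracket_vertical hv hY h hF
  have b2 := basePart_mlieBracket_vertical hv hX h hF
  have b3 : basePart p₀ v (mlieBracket (𝓡 (2 * n - 2)) F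
      (horizontalLift (𝓡 n) (inducedMetric g K) (nullProj g K) X) v) = 0 := by
    rw [mlieBracket_swap_apply, ← zero_sub (mlieBracket _ _ _ _), basePart_sub, b2, basePart_zero,
      sub_zero]
  -- Of the six Koszul terms, two derivatives vanish by orthogonality, the third by constancy along
  -- the fibres, and two bracket terms because those brackets are vertical.
  rw [mvfderiv_congr e1, mvfderiv_congr e2,
    mvfderiv_inducedMetric_horizontalLift hv hX hY hF.self_of_nhds,
    inducedMetric_symm (mlieBracket (𝓡 (2 * n - 2)) _ F v), inducedMetric_symm (mlieBracket _ F _ v),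
    inducedMetric_horizontalLift_vertical hv X b1, inducedMetric_horizontalLift_vertical hv Y b3,
    mvfderiv_const]
  simp

/-- The vertical part of the second lift is identically zero, so the first term of the tensor is the
horizontal part of a covariant derivative of the zero field. -/
theorem oneillA_horizontalLift (hX : IsSmoothField X) (v : nullCongruence g K) :
    oneillA (𝓡 n) (inducedMetric g K) (nullProj g K)
        (horizontalLift (𝓡 n) (inducedMetric g K) (nullProj g K) X)
        (horizontalLift (𝓡 n) (inducedMetric g K) (nullProj g K) Y) v =
      verticalPart (𝓡 n) (inducedMetric g K) (nullProj g K) v (leviCivita (inducedMetric g K)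
        (horizontalLift (𝓡 n) (inducedMetric g K) (nullProj g K) X)
        (horizontalLift (𝓡 n) (inducedMetric g K) (nullProj g K) Y) v) := by
  have hh : ∀ Z : ∀ p : M, TangentSpace (𝓡 n) p, (fun u => horizontalPart (𝓡 n) (inducedMetric g K)
      (nullProj g K) u (horizontalLift (𝓡 n) (inducedMetric g K) (nullProj g K) Z u)) =
      horizontalLift (𝓡 n) (inducedMetric g K) (nullProj g K) Z := fun Z =>
    funext fun u => horizontalPart_eq_self (horizontalLift_spec Z u).1
  have hvv : (fun u => verticalPart (𝓡 n) (inducedMetric g K) (nullProj g K) u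
      (horizontalLift (𝓡 n) (inducedMetric g K) (nullProj g K) Y u)) = fun _ => 0 :=
    funext fun u => verticalPart_eq_zero (horizontalLift_spec Y u).1
  have h0 : IsHorizontal (𝓡 n) (inducedMetric g K) (nullProj g K) v 0 := by
    have hv := mem_extChartAt_source (I := 𝓡 n) v.1.proj
    rw [isHorizontal_iff hv, fibrePart_zero, basePart_zero, map_zero, zero_smul]
  rw [oneillA, hh X, hh Y, hvv, leviCivita_inducedMetric_zero (mdifferentiableAt_horizontalLift hX v),
    horizontalPart_eq_self h0, zero_add]

/-- The fibre component of `2 A_X̃ Ỹ` in a chart. -/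
theorem two_smul_fibrePart_oneillA (hv : v.1.proj ∈ (extChartAt (𝓡 n) p₀).source)
    (hX : IsSmoothField X) (hY : IsSmoothField Y) {R : 𝔼 n}
    (hR : R = chartCurvature (chartChristoffel g p₀) (nullChart p₀ v).1
        (fieldRep p₀ X (nullChart p₀ v).1) (fieldRep p₀ Y (nullChart p₀ v).1)
        (nullChart p₀ v).2) :
    (2 : ℝ) • fibrePart p₀ v (oneillA (𝓡 n) (inducedMetric g K) (nullProj g K)
        (horizontalLift (𝓡 n) (inducedMetric g K) (nullProj g K) X)
        (horizontalLift (𝓡 n) (inducedMetric g K) (nullProj g K) Y) v) =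
      -R - chartMetric g p₀ (nullChart p₀ v).1 R (fieldRep p₀ K.val (nullChart p₀ v).1)
        • (nullChart p₀ v).2 := by
  rw [oneillA_horizontalLift hX]
  set L := leviCivita (inducedMetric g K) (horizontalLift (𝓡 n) (inducedMetric g K) (nullProj g K) X)
    (horizontalLift (𝓡 n) (inducedMetric g K) (nullProj g K) Y) v with hL
  set W := verticalPart (𝓡 n) (inducedMetric g K) (nullProj g K) v L with hW
  obtain ⟨t, ht⟩ := exists_fibrePart_mlieBracket hv hX hY
  rw [← hR] at ht
  -- Instead of invoking the skew symmetry of the curvature, this uses that the bracket is tangent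
  -- to the congruence: its fibre part t a - R is orthogonal to a, and so is a itself.
  have haR : chartMetric g p₀ (nullChart p₀ v).1 (nullChart p₀ v).2 R = 0 := by
    have := chartMetric_fibrePart hv (mlieBracket (𝓡 (2 * n - 2))
      (horizontalLift (𝓡 n) (inducedMetric g K) (nullProj g K) X)
      (horizontalLift (𝓡 n) (inducedMetric g K) (nullProj g K) Y) v)
    rw [ht, map_sub, map_smul, chartMetric_null hv] at this
    simpa using this
  have hWk := chartMetric_fibrePart_K hv W
  rw [hW, basePart_verticalPart hv, map_zero, add_zero, ← hW] at hWk
  -- Both sides are orthogonal to a and k, the right side because g(a, k) = -1. It remains to test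
  -- against w orthogonal to both, where every multiple of a disappears, including the unknown t and
  -- the correction made by the vertical projection.
  rw [← sub_eq_zero]
  refine eq_zero_of_orthogonal (chartMetric_symm g _)
    (chartMetric_nondegenerate g (nullChart_mem_target hv)) (chartMetric_null hv)
    (chartMetric_null_K hv) ?_ ?_ fun w hw1 hw2 => ?_
  · simp only [map_sub, map_neg, map_smul, chartMetric_fibrePart hv, haR, chartMetric_null hv]
    simp
  · simp only [map_sub, map_neg, map_smul, sub_apply, neg_apply, smul_apply, hWk,
      chartMetric_null_K hv]
    simp
  · obtain ⟨U, hU, hU0, hUw⟩ := exists_vertical_field hv hw1 hw2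
    have key := two_mul_leviCivita_horizontalLift hv hX hY hU hU0
    rw [← hL, inducedMetric_vertical hv _ hU0.self_of_nhds,
      inducedMetric_vertical hv _ hU0.self_of_nhds, ht, hUw] at key
    rw [hW, fibrePart_verticalPart hv]
    simp only [map_sub, map_neg, map_smul, sub_apply, neg_apply, smul_apply, hw1,
      smul_eq_mul, mul_zero, sub_zero] at key ⊢
    linarith

end ONeill

end

end NullCong

/-! ### The formula in the tangent bundle -/

theorem mainTheorem5 (n : ℕ) (hn : 3 ≤ n) {M : Type*} [TopologicalSpace M] [T2Space M]
    [SecondCountableTopology M] [ConnectedSpace M] [ChartedSpace (EuclideanSpace ℝ (Fin n)) M]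
    [IsManifold (𝓡 n) ∞ M] (g : LorentzMetric n M) (K : TimelikeField g)
    (X Y : ∀ p : M, TangentSpace (𝓡 n) p) (hX : IsSmoothField X) (hY : IsSmoothField Y)
    (v : nullCongruence g K) :
    inclDeriv g K v ((2 : ℝ) • oneillA (𝓡 n) (inducedMetric g K) (nullProj g K)
        (horizontalLift (𝓡 n) (inducedMetric g K) (nullProj g K) X)
        (horizontalLift (𝓡 n) (inducedMetric g K) (nullProj g K) Y) v) =
      - vlift v.1 (curvature g.form v.1.proj (X v.1.proj) (Y v.1.proj) v.1.2)
        - sasaki g v (vlift v.1 (curvature g.form v.1.proj (X v.1.proj) (Y v.1.proj) v.1.2))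
            (vlift v.1 (K.val v.1.proj)) • vlift v.1 v.1.2 := by
  have hv := mem_extChartAt_source (I := 𝓡 n) v.1.proj
  set p₀ := v.1.proj with hp₀
  set R := curvature g.form v.1.proj (X v.1.proj) (Y v.1.proj) v.1.2 with hR
  have hR' := mvfderiv_curvature g v.1.proj (X v.1.proj) (Y v.1.proj) v.1.2
  rw [← hR, ← fieldRep_apply hv X, ← fieldRep_apply hv Y] at hR'
  have hA := two_smul_fibrePart_oneillA hv hX hY hR'
  have hs : sasaki g v (vlift v.1 R) (vlift v.1 (K.val v.1.proj)) =
      chartMetric g p₀ (nullChart p₀ v).1 (mvfderiv (𝓡 n) (extChartAt (𝓡 n) p₀) v.1.proj R)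
        (fieldRep p₀ K.val (nullChart p₀ v).1) := by
    rw [sasaki_eq g hv, mvfderiv_tmChart_vlift hv, mvfderiv_tmChart_vlift hv, sasakiForm_apply,
      vertComp_apply, vertComp_apply]
    simp only [map_zero, zero_apply, add_zero, zero_add]
    rw [← fieldRep_apply hv]
    rfl
  -- The identity is compared in the chart of TM at the base point of v. The base components of both
  -- sides vanish, as the left side is vertical and the right side is built from vertical lifts;
  -- with base part zero the fibre coordinate is the fibre part, which `hA` computes.
  refine mvfderiv_tmChart_injective hv ?_
  rw [← mvfderiv_nullChart hv, map_smul, mvfderiv_nullChart_eq_parts, map_sub, map_neg, map_smul,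
    mvfderiv_tmChart_vlift hv, mvfderiv_tmChart_vlift hv, hs, oneillA_horizontalLift hX,
    basePart_verticalPart hv, ← oneillA_horizontalLift hX]
  refine Prod.ext ?_ ?_
  · simp
  · simp only [map_zero, zero_apply, sub_zero]
    exact hA
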